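/- **Theorem.** $\mathbf{RCA}_0$ proves the following (equivalently, it holds in every model $(M,\mathcal S)$ of $\mathbf{RCA}_0$, where $M$ may be nonstandard, all orders, sets and functions are members of $\mathcal S$, and all elements are numbers of $M$). For every linear order $X=(X,<_X)$ the order $\Gamma_X$ exists, and it is a minimal Bachmann--Howard fixed point of the transformation $T(Y)=1+2\times Y^2+X$ of linear orders. Moreover, with the ordinal arithmetic of $\Gamma_X$ (addition, multiplication and $\alpha\mapsto\omega^\alpha$ on Cantor normal forms, where $\omega^\alpha=\alpha$ if $\alpha=\Gamma_x$ or $\alpha=\varphi_\gamma\delta$ with $\gamma\neq 0$, and $\omega^\alpha=\varphi_0\alpha$ otherwise, and $1=\omega^0$), the function $\vartheta:1+2\times\Gamma_X^2+X\to\Gamma_X$ with $$\vartheta(\bot)=0,\quad \vartheta(\langle 0,\alpha,\beta\rangle)=\omega^{\omega^{\alpha+1}}\cdot(\beta+1),\quad \vartheta(\langle 1,\alpha,\beta\rangle)=\varphi_{1+\alpha}(\beta+1),\quad \vartheta(x)=\Gamma_x$$ is a Bachmann--Howard collapse. Here the following definitions are used. *The transformation.* Sums of orders are taken from left to right and products are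 ordered lexicographically with dominant first component. The elements of $T(Y)$ are $\bot$ (from the summand $1$), $\langle i,y_0,y_1\rangle$ with $i\in\{0,1\}$ and $y_0,y_1\in Y$, and $x\in X$. *Bachmann--Howard fixed points.* The support of $\sigma\in T(Y)$ is $\operatorname{supp}_Y(\sigma)=\bigcap\{Y_0\subseteq Y\mid \sigma\in T(Y_0)\}$. A function $\vartheta:T(Y)\to Y$ is a Bachmann--Howard collapse if for all $\sigma,\tau\in T(Y)$: (i) if $\sigma<_{T(Y)}\tau$ and $y<_Y\vartheta(\tau)$ for all $y\in\operatorname{supp}_Y(\sigma)$, then $\vartheta(\sigma)<_Y\vartheta(\tau)$; (ii) $y<_Y\vartheta(\sigma)$ for all $y\in\operatorname{supp}_Y(\sigma)$. A linear order $Y$ with such a $\vartheta$ is a Bachmann--Howard fixed point of $T$; it is minimal if it embeds (by a strictly increasing function) into every Bachmann--Howard fixed point of $T$. *The order $\Gamma_X$.* The set $\Gamma_X$ of terms, a subset $\mathbf H\subseteq\Gamma_X$, a function $h:\Gamma_X\to\Gamma_X$ and the relation $<$ on $\Gamma_X$ are determined by the following simultaneous recursion. Terms: $0\in\Gamma_X\setminus\mathbf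 H$ with $h(0)=0$; $\Gamma_x\in\mathbf H$ with $h(\Gamma_x)=\Gamma_x$, for $x\in X$; $\varphi_\alpha\beta\in\mathbf H$ with $h(\varphi_\alpha\beta)=\alpha$, for $\alpha,\beta\in\Gamma_X$ such that $h(\beta)\le\alpha$, and such that $\beta\ne 0$ if $\alpha$ is of the form $\Gamma_x$; and $\alpha_1+\dots+\alpha_n\in\Gamma_X\setminus\mathbf H$ with $h(\alpha_1+\dots+\alpha_n)=0$, for $n>1$ and $\alpha_n\le\dots\le\alpha_1$ in $\mathbf H$. Order: $0$ is the smallest element; $\Gamma_x<\Gamma_y$ iff $x<_Xy$; $\varphi_\alpha\beta<\Gamma_x$ iff $\alpha,\beta<\Gamma_x$; $\Gamma_x<\varphi_\alpha\beta$ iff $\Gamma_x\le\alpha$ or $\Gamma_x\le\beta$; $\varphi_\alpha\beta<\varphi_\gamma\delta$ iff either $\alpha<\gamma$ and $\beta<\varphi_\gamma\delta$, or $\alpha=\gamma$ and $\beta<\delta$, or $\gamma<\alpha$ and $\varphi_\alpha\beta<\delta$; sums are compared lexicographically, an element of $\mathbf H$ counting as a sum with one summand. -/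

import Mathlib

/-!
Provability in `RCA₀` is expressed as truth in all models of `RCA₀`.  A model consists of a type
`M` of numbers (possibly nonstandard) with `0, 1, +, ·, <`, and of a collection `S` of subsets of
`M`, the range of the set variables.  All objects below are elements of `M` or sets in `S`, and
every clause quantifies over elements of `M` and members of `S` only, so that the claim is the
truth of one sentence of second order arithmetic in every model.
-/

namespace SecondOrder

/-! ### The language of second order arithmetic and the theory `RCA₀` -/

/-- Numerical terms, with number variables `var 0, var 1, …`. -/
inductive Tm : Type
  | var (i : ℕ)
  | zero
  | one
  | add (s t : Tm)
  | mul (s t : Tm)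

/-- `Δ⁰₀` formulas with number variables (de Bruijn indices) and set variables. In `ball t φ`,
the bounded quantifier `∀ x < t`, the variable `var 0` of `φ` is `x`, and `var (i + 1)` of `φ` is
`var i` of the context. Disjunction, implication and bounded existential quantification are
definable from the given connectives. -/
inductive Delta0 : Type
  | eq (s t : Tm)
  | lt (s t : Tm)
  | mem (t : Tm) (Z : ℕ)
  | not (φ : Delta0)
  | and (φ ψ : Delta0)
  | ball (t : Tm) (φ : Delta0)

/-- The assignment that gives `var 0` the value `a` and shifts the other variables. -/
def push {M : Type*} (a : M) (v : ℕ → M) : ℕ → M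
  | 0 => a
  | i + 1 => v i

section Semantics

variable {M : Type*} [Zero M] [One M] [Add M] [Mul M] [LT M]

/-- The value of a term. -/
def Tm.eval (v : ℕ → M) : Tm → M
  | .var i => v i
  | .zero => 0
  | .one => 1
  | .add s t => s.eval v + t.eval v
  | .mul s t => s.eval v * t.eval v

/-- Satisfaction of a `Δ⁰₀` formula under assignments to number and set variables. -/
def Delta0.Holds (V : ℕ → Set M) : Delta0 → (ℕ → M) → Prop
  | .eq s t, v => s.eval v = t.eval v
  | .lt s t, v => s.eval v < t.eval v
  | .mem t Z, v => t.eval v ∈ V Z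
  | .not φ, v => ¬ φ.Holds V v
  | .and φ ψ, v => φ.Holds V v ∧ ψ.Holds V v
  | .ball t φ, v => ∀ a : M, a < t.eval v → φ.Holds V (push a v)

/-- The `Σ⁰₁` formula `∃ x, φ(x, n)` with further parameters `v` and `V`. -/
def Sigma1 (φ : Delta0) (v : ℕ → M) (V : ℕ → Set M) (n : M) : Prop :=
  ∃ x : M, φ.Holds V (push x (push n v))

/-- The `Π⁰₁` formula `∀ x, φ(x, n)` with further parameters `v` and `V`. -/
def Pi1 (φ : Delta0) (v : ℕ → M) (V : ℕ → Set M) (n : M) : Prop :=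
  ∀ x : M, φ.Holds V (push x (push n v))

end Semantics

/-- `(M, S)` is a model of `RCA₀`: the basic axioms, induction for `Σ⁰₁` formulas and comprehension
for `Δ⁰₁` formulas, both with number and set parameters. -/
structure IsModelRCA0 (M : Type*) [Zero M] [One M] [Add M] [Mul M] [LT M]
    (S : Set (Set M)) : Prop where
  sets_nonempty : S.Nonempty
  succ_ne_zero : ∀ n : M, n + 1 ≠ 0
  succ_inj : ∀ m n : M, m + 1 = n + 1 → m = n
  add_zero : ∀ m : M, m + 0 = m
  add_succ : ∀ m n : M, m + (n + 1) = (m + n) + 1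
  mul_zero : ∀ m : M, m * 0 = 0
  mul_succ : ∀ m n : M, m * (n + 1) = m * n + m
  not_lt_zero : ∀ m : M, ¬ m < 0
  lt_succ : ∀ m n : M, m < n + 1 ↔ m < n ∨ m = n
  sigma1_induction : ∀ (φ : Delta0) (v : ℕ → M) (V : ℕ → Set M), (∀ i, V i ∈ S) →
    Sigma1 φ v V 0 → (∀ n, Sigma1 φ v V n → Sigma1 φ v V (n + 1)) → ∀ n, Sigma1 φ v V n
  delta1_comprehension : ∀ (φ ψ : Delta0) (v : ℕ → M) (V : ℕ → Set M), (∀ i, V i ∈ S) →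
    (∀ n, Sigma1 φ v V n ↔ Pi1 ψ v V n) → {n | Sigma1 φ v V n} ∈ S

/-! ### Orders and functions inside a model -/

/-- The pairing `⟨a, b⟩ = (a + b)² + a` on numbers. -/
def pair {M : Type*} [Add M] [Mul M] (a b : M) : M := (a + b) * (a + b) + a

/-- A set of numbers with a (strict) relation. -/
@[ext] structure NOrder (M : Type*) where
  carrier : Set M
  lt : M → M → Prop

section Orders

variable {M : Type*}

/-- The non-strict relation. -/
def NOrder.le (O : NOrder M) (a b : M) : Prop := a = b ∨ O.lt a b

/-- The suborder of `O` with underlying set `A`. -/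
def NOrder.restrict (O : NOrder M) (A : Set M) : NOrder M where
  carrier := A
  lt a b := a ∈ A ∧ b ∈ A ∧ O.lt a b

/-- `O` belongs to the model: its underlying set and its relation, coded as a set of pairs of
elements of the underlying set, lie in `S`. -/
structure NOrder.IsInner [Add M] [Mul M] (S : Set (Set M)) (O : NOrder M) : Prop where
  carrier_mem : O.carrier ∈ S
  lt_mem : {p : M | ∃ a b, p = pair a b ∧ O.lt a b} ∈ S
  lt_field : ∀ a b, O.lt a b → a ∈ O.carrier ∧ b ∈ O.carrier

/-- `O` is a linear order that belongs to the model. -/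
structure NOrder.IsLinear [Add M] [Mul M] (S : Set (Set M)) (O : NOrder M) : Prop
    extends O.IsInner S where
  irrefl : ∀ a, ¬ O.lt a a
  trans : ∀ a b c, O.lt a b → O.lt b c → O.lt a c
  total : ∀ a ∈ O.carrier, ∀ b ∈ O.carrier, O.lt a b ∨ a = b ∨ O.lt b a

/-- `f` is a function from `A` to `B` whose graph belongs to the model. -/
def IsInnerFun [Add M] [Mul M] (S : Set (Set M)) (A B : Set M) (f : M → M) : Prop :=
  (∀ a ∈ A, f a ∈ B) ∧ {p : M | ∃ a ∈ A, p = pair a (f a)} ∈ S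

/-- `f` is a binary function from `A × A` to `A` whose graph belongs to the model. -/
def IsInnerFun₂ [Add M] [Mul M] (S : Set (Set M)) (A : Set M) (f : M → M → M) : Prop :=
  (∀ a ∈ A, ∀ b ∈ A, f a b ∈ A) ∧
    {p : M | ∃ a ∈ A, ∃ b ∈ A, p = pair (pair a b) (f a b)} ∈ S

/-- The order `1` with the single element `0`. -/
def NOrder.one [Zero M] : NOrder M where
  carrier := {0}
  lt _ _ := False

/-- The order `2` with elements `0 < 1`. -/
def NOrder.two [Zero M] [One M] : NOrder M where
  carrier := {0, 1}
  lt a b := a = 0 ∧ b = 1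

/-- The sum of two orders, with elements `⟨0, a⟩` and `⟨1, b⟩`. -/
def NOrder.sum [Zero M] [One M] [Add M] [Mul M] (A B : NOrder M) : NOrder M where
  carrier := {s | (∃ a ∈ A.carrier, s = pair 0 a) ∨ ∃ b ∈ B.carrier, s = pair 1 b}
  lt s t :=
    (∃ a a', A.lt a a' ∧ s = pair 0 a ∧ t = pair 0 a') ∨
    (∃ b b', B.lt b b' ∧ s = pair 1 b ∧ t = pair 1 b') ∨
    (∃ a ∈ A.carrier, ∃ b ∈ B.carrier, s = pair 0 a ∧ t = pair 1 b)

/-- The product of two orders: pairs `⟨a, b⟩`, the first component being the dominant one. -/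
def NOrder.prod [Add M] [Mul M] (A B : NOrder M) : NOrder M where
  carrier := {s | ∃ a ∈ A.carrier, ∃ b ∈ B.carrier, s = pair a b}
  lt s t := ∃ a ∈ A.carrier, ∃ a' ∈ A.carrier, ∃ b ∈ B.carrier, ∃ b' ∈ B.carrier,
    s = pair a b ∧ t = pair a' b' ∧ (A.lt a a' ∨ (a = a' ∧ B.lt b b'))

end Orders

/-! ### Bachmann–Howard fixed points -/

section BachmannHoward

variable {M : Type*} [Add M] [Mul M]

/-- The support of `σ ∈ T(Y)`: the intersection of all `Y₀ ⊆ Y` with `σ ∈ T(Y₀)`. -/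
def supp (S : Set (Set M)) (T : NOrder M → NOrder M) (Y : NOrder M) (σ : M) : Set M :=
  {y | y ∈ Y.carrier ∧
    ∀ Y₀ ∈ S, Y₀ ⊆ Y.carrier → σ ∈ (T (Y.restrict Y₀)).carrier → y ∈ Y₀}

/-- `θ : T(Y) → Y` is a Bachmann–Howard collapse. -/
structure IsCollapse (S : Set (Set M)) (T : NOrder M → NOrder M) (Y : NOrder M)
    (θ : M → M) : Prop where
  inner : IsInnerFun S (T Y).carrier Y.carrier θ
  almost_mono : ∀ σ ∈ (T Y).carrier, ∀ τ ∈ (T Y).carrier, (T Y).lt σ τ →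
    (∀ y ∈ supp S T Y σ, Y.lt y (θ τ)) → Y.lt (θ σ) (θ τ)
  supp_lt : ∀ σ ∈ (T Y).carrier, ∀ y ∈ supp S T Y σ, Y.lt y (θ σ)

/-- `Y` is a linear order that admits a Bachmann–Howard collapse. -/
def IsBHFixedPoint (S : Set (Set M)) (T : NOrder M → NOrder M) (Y : NOrder M) : Prop :=
  Y.IsLinear S ∧ ∃ θ, IsCollapse S T Y θ

/-- `Y` is a Bachmann–Howard fixed point that embeds into any other one. -/
def IsMinimalBHFixedPoint (S : Set (Set M)) (T : NOrder M → NOrder M) (Y : NOrder M) : Prop :=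
  IsBHFixedPoint S T Y ∧ ∀ Z, IsBHFixedPoint S T Z →
    ∃ f, IsInnerFun S Y.carrier Z.carrier f ∧
      ∀ a ∈ Y.carrier, ∀ b ∈ Y.carrier, Y.lt a b → Z.lt (f a) (f b)

end BachmannHoward

/-! ### The transformation `Y ↦ 1 + 2 × Y² + X` and the notation system `Γ_X` -/

section Gamma

variable {M : Type*} [Zero M] [One M] [Add M] [Mul M]

/-- The order `1 + 2 × Y² + X`. -/
def gammaTrans (X Y : NOrder M) : NOrder M :=
  NOrder.one.sum ((NOrder.two.prod (Y.prod Y)).sum X)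

/-- The element `⊥` of `1 + 2 × Y² + X`. -/
def tBot : M := pair 0 0

/-- The element `⟨i, a, b⟩` of `1 + 2 × Y² + X`. -/
def tMid (i a b : M) : M := pair 1 (pair 0 (pair i (pair a b)))

/-- The element of `1 + 2 × Y² + X` given by `x ∈ X`. -/
def tTop (x : M) : M := pair 1 (pair 1 x)

/-- The term `0`. -/
def zeroT : M := pair 0 0

/-- The term `Γ_x`. -/
def gammaT (x : M) : M := pair 1 x

/-- The term `φ_a b`. -/
def phiT (a b : M) : M := pair (1 + 1) (pair a b)

/-- The term `a + b`. A sum `α₁ + ⋯ + αₙ` with `n > 1` is coded as the list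
`sumT α₁ (sumT α₂ (⋯ (sumT αₙ₋₁ αₙ)))`. -/
def sumT (a b : M) : M := pair (1 + 1 + 1) (pair a b)

/-- The terms in `𝐇` (additively principal). -/
inductive IsPrincipal : M → Prop
  | gamma (x : M) : IsPrincipal (gammaT x)
  | phi (a b : M) : IsPrincipal (phiT a b)

/-- `IsHead s c`: the first summand of the nonzero term `s` is `c`. -/
inductive IsHead : M → M → Prop
  | principal (p : M) : IsPrincipal p → IsHead p p
  | sum (a b : M) : IsHead (sumT a b) a

/-- `HasH s r`: the graph of the auxiliary function `h`, i.e. `h(s) = r`. -/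
inductive HasH : M → M → Prop
  | zero : HasH zeroT zeroT
  | gamma (x : M) : HasH (gammaT x) (gammaT x)
  | phi (a b : M) : HasH (phiT a b) a
  | sum (a b : M) : HasH (sumT a b) zeroT

/-- The clauses for membership in `Γ_X`, relative to `G` in the role of `Γ_X`. -/
inductive TermClause (X G : NOrder M) : M → Prop
  | zero : TermClause X G zeroT
  | gamma (x : M) : x ∈ X.carrier → TermClause X G (gammaT x)
  | phi (a b : M) : a ∈ G.carrier → b ∈ G.carrier →
      (∃ r, HasH b r ∧ G.le r a) → ((∃ x, a = gammaT x) → b ≠ zeroT) →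
      TermClause X G (phiT a b)
  | sum (a b : M) : a ∈ G.carrier → b ∈ G.carrier → IsPrincipal a →
      (∃ c, IsHead b c ∧ G.le c a) → TermClause X G (sumT a b)

/-- The clauses for the order on `Γ_X`, relative to `G` in the role of `Γ_X`: each `Γ_x` is closed
under `φ`, values of `φ` are compared as in the Veblen hierarchy, and sums of principal terms are
compared lexicographically. -/
inductive LtClause (X G : NOrder M) : M → M → Prop
  | zero (t : M) : t ≠ zeroT → LtClause X G zeroT t
  | gamma_gamma (x y : M) : X.lt x y → LtClause X G (gammaT x) (gammaT y)
  | gamma_phi (x a b : M) : G.le (gammaT x) a ∨ G.le (gammaT x) b →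
      LtClause X G (gammaT x) (phiT a b)
  | phi_gamma (a b x : M) : G.lt a (gammaT x) → G.lt b (gammaT x) →
      LtClause X G (phiT a b) (gammaT x)
  | phi_phi (a b c d : M) :
      (G.lt a c ∧ G.lt b (phiT c d)) ∨ (a = c ∧ G.lt b d) ∨ (G.lt c a ∧ G.lt (phiT a b) d) →
      LtClause X G (phiT a b) (phiT c d)
  | principal_sum (p a b : M) : IsPrincipal p → G.le p a → LtClause X G p (sumT a b)
  | sum_principal (a b p : M) : IsPrincipal p → G.lt a p → LtClause X G (sumT a b) p
  | sum_sum (a b c d : M) : G.lt a c ∨ (a = c ∧ G.lt b d) →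
      LtClause X G (sumT a b) (sumT c d)

/-- `G` is the notation system `Γ_X` of the model, i.e. it satisfies the simultaneous recursion that
defines the underlying set and the order of `Γ_X`. -/
structure IsGammaSystem (S : Set (Set M)) (X G : NOrder M) : Prop
    extends G.IsInner S where
  mem_iff : ∀ s, s ∈ G.carrier ↔ TermClause X G s
  lt_iff : ∀ s t, G.lt s t ↔ s ∈ G.carrier ∧ t ∈ G.carrier ∧ LtClause X G s t

/-- The term `1 = ω⁰ = φ₀0`. -/
def oneT : M := phiT zeroT zeroT

/-- The terms `Γ_x` and `φ_a b` with `a ≠ 0`, which represent `ε`-numbers. -/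
inductive IsEps : M → Prop
  | gamma (x : M) : IsEps (gammaT x)
  | phi (a b : M) : a ≠ zeroT → IsEps (phiT a b)

open Classical in
/-- Exponentiation to the base `ω`. -/
noncomputable def omegaT (s : M) : M := if IsEps s then s else phiT zeroT s

/-- `add s t` is the sum `s + t`, and `mul e t` is the product `ω ^ e · t`, for `s, t, e ∈ Γ_X`,
given by recursion over Cantor normal forms. -/
structure IsArithmetic (S : Set (Set M)) (G : NOrder M) (add mul : M → M → M) : Prop where
  add_inner : IsInnerFun₂ S G.carrier add
  mul_inner : IsInnerFun₂ S G.carrier mul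
  zero_add : ∀ t ∈ G.carrier, add zeroT t = t
  add_zero : ∀ s ∈ G.carrier, add s zeroT = s
  principal_add_of_lt : ∀ p ∈ G.carrier, ∀ t ∈ G.carrier, ∀ c,
    IsPrincipal p → IsHead t c → G.lt p c → add p t = t
  principal_add_of_le : ∀ p ∈ G.carrier, ∀ t ∈ G.carrier, ∀ c,
    IsPrincipal p → IsHead t c → G.le c p → add p t = sumT p t
  sum_add : ∀ p q, sumT p q ∈ G.carrier → ∀ t ∈ G.carrier,
    add (sumT p q) t = add p (add q t)
  mul_zero : ∀ e ∈ G.carrier, mul e zeroT = zeroT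
  mul_omega : ∀ e ∈ G.carrier, ∀ c ∈ G.carrier, mul e (omegaT c) = omegaT (add e c)
  mul_sum : ∀ e ∈ G.carrier, ∀ p q, sumT p q ∈ G.carrier →
    mul e (sumT p q) = add (mul e p) (mul e q)

/-- `θ` is the function `1 + 2 × Γ_X² + X → Γ_X` with `θ(⊥) = 0`,
`θ(⟨0, α, β⟩) = ω ^ (ω ^ (α + 1)) · (β + 1)`, `θ(⟨1, α, β⟩) = φ_{1 + α}(β + 1)` and
`θ(x) = Γ_x`. -/
structure IsExplicitCollapse (X G : NOrder M) (add mul : M → M → M) (θ : M → M) : Prop where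
  bot : θ tBot = zeroT
  mid_zero : ∀ a ∈ G.carrier, ∀ b ∈ G.carrier,
    θ (tMid 0 a b) = mul (omegaT (add a oneT)) (add b oneT)
  mid_one : ∀ a ∈ G.carrier, ∀ b ∈ G.carrier,
    θ (tMid 1 a b) = phiT (add oneT a) (add b oneT)
  top : ∀ x ∈ X.carrier, θ (tTop x) = gammaT x

end Gamma

end SecondOrder

/-! The function `ϑ` is a collapse because its values have the right closure properties. Every `Γ_x`
and every `φ_{1+γ}(δ+1)` is an `ε`-number, hence closed under addition, `ω`-powers and the products
`ω^s·t`; this gives the comparisons of values with index `0` with those of index `1` and with the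
`Γ_x`. Two values with index `0` are compared by absorption: for `α < γ` one has `ω^(α+1) + ω^(γ+1)
= ω^(γ+1)`, so multiplication by `ω^ω^(α+1)` does not lead from below `ω^ω^(γ+1)·(δ+1)` to above it.
Two values with index `1` are compared by the clause for `φ`. Condition (ii) needs that `α` and `β`
lie below `φ_α β` (`GT.PhiOK.lt_phi`), which rests on the normal form condition `h(β) ≤ α`.

For minimality, let `Z` carry any collapse with values `bot`, `lo a b`, `hi a b`, `top x`. The map
`f` sends `0` to `bot`, `Γ_x` to `top x`, `φ_a b` with `a ≠ 0` to `hi (f a) (f b)`, and a term `ω^a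
+ q` in Cantor normal form that is no `ε`-number to `lo (f a) (f q)`. If `s < t`, there are two
possibilities. Either `s` is at most an immediate constituent of `t`, and (ii) applies; or the image
of `s` has the smaller preimage under the collapse and the constituents of `s` lie below `t`, and
(i) applies. In both cases the inequalities between constituents come from the induction hypothesis
(`GT.exists_strictMono`). The map `f` need not commute with the arithmetic, and for `Z = Γ_X` it is
not the identity: `1 = ω^0` goes to `ω^ω`.

No well-foundedness is available, so nothing is proved by induction along `X` or `Γ_X`. All
inductions and recursions run along codes of terms: the code of a term exceeds the codes of its
subterms, and the code of a pair grows with the sum of its components. The properties proved by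
induction are decidable.

To do this inside an arbitrary model, objects are treated as functions between coded types whose
graphs lie in the model (`Comp`). Such functions are closed under composition by `Δ⁰₁`
comprehension, under minimization (`Comp.exists_fun`), and under course-of-values recursion
(`coded_recursion`); the latter uses codes for finite sequences, obtained from Gödel's pairwise
coprime moduli. The simultaneous recursion that defines `Γ_X` is untangled by first defining the
order clauses on all numbers and then the set of terms. -/

namespace SecondOrder

/-! ### Elementary arithmetic in a model of `RCA₀` -/

namespace IsModelRCA0

section Arithmetic

variable {M : Type*} [Zero M] [One M] [Add M] [Mul M] [LT M] {S : Set (Set M)}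

/-- The assignment of `a` and `b` to the first two variables. -/
def params (a b : M) : ℕ → M := push a (push b fun _ => 0)

/-- In `Sigma1 φ v V n` the existential witness is `var 0` and the induction variable is `var 1`;
hence the parameters `a` and `b` are `var 2` and `var 3` in all formulas below. Sets do not occur,
and some member of `S` is needed only as a value for the set variables. -/
lemma induction_of_formula (hM : IsModelRCA0 M S) (φ : Delta0) (a b : M) {P : M → Prop}
    (hφ : ∀ (V : ℕ → Set M) (n : M), Sigma1 φ (params a b) V n ↔ P n)
    (h0 : P 0) (hs : ∀ n, P n → P (n + 1)) (n : M) : P n := by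
  obtain ⟨A, hA⟩ := hM.sets_nonempty
  have := hM.sigma1_induction φ (params a b) (fun _ => A) (fun _ => hA)
  simp only [hφ] at this
  exact this h0 hs n

variable (hM : IsModelRCA0 M S)
include hM

lemma zero_add' (n : M) : 0 + n = n :=
  hM.induction_of_formula (P := fun n => 0 + n = n) (.eq (.add .zero (.var 1)) (.var 1)) 0 0
    (fun V n => by simp [Sigma1, Delta0.Holds, Tm.eval, push])
    (hM.add_zero 0) (fun n ih => by rw [hM.add_succ, ih]) n

lemma succ_add' (m n : M) : (m + 1) + n = (m + n) + 1 :=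
  hM.induction_of_formula (P := fun n => (m + 1) + n = (m + n) + 1)
    (.eq (.add (.add (.var 2) .one) (.var 1)) (.add (.add (.var 2) (.var 1)) .one)) m 0
    (fun V n => by simp [Sigma1, Delta0.Holds, Tm.eval, push, params])
    (by rw [hM.add_zero, hM.add_zero]) (fun n ih => by rw [hM.add_succ, ih, hM.add_succ]) n

lemma add_comm' (m n : M) : m + n = n + m :=
  hM.induction_of_formula (P := fun n => m + n = n + m)
    (.eq (.add (.var 2) (.var 1)) (.add (.var 1) (.var 2))) m 0
    (fun V n => by simp [Sigma1, Delta0.Holds, Tm.eval, push, params])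
    (by rw [hM.add_zero, hM.zero_add'])
    (fun n ih => by rw [hM.add_succ, ih, hM.succ_add']) n

lemma add_assoc' (a b c : M) : (a + b) + c = a + (b + c) :=
  hM.induction_of_formula (P := fun c => (a + b) + c = a + (b + c))
    (.eq (.add (.add (.var 2) (.var 3)) (.var 1)) (.add (.var 2) (.add (.var 3) (.var 1)))) a b
    (fun V n => by simp [Sigma1, Delta0.Holds, Tm.eval, push, params])
    (by rw [hM.add_zero, hM.add_zero])
    (fun n ih => by rw [hM.add_succ, ih, hM.add_succ, hM.add_succ]) c

lemma add_left_comm' (a b c : M) : a + (b + c) = b + (a + c) := by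
  rw [← hM.add_assoc', hM.add_comm' a b, hM.add_assoc']

lemma zero_mul' (n : M) : 0 * n = 0 :=
  hM.induction_of_formula (P := fun n => 0 * n = 0) (.eq (.mul .zero (.var 1)) .zero) 0 0
    (fun V n => by simp [Sigma1, Delta0.Holds, Tm.eval, push])
    (hM.mul_zero 0) (fun n ih => by rw [hM.mul_succ, ih, hM.add_zero]) n

lemma succ_mul' (m n : M) : (m + 1) * n = m * n + n :=
  hM.induction_of_formula (P := fun n => (m + 1) * n = m * n + n)
    (.eq (.mul (.add (.var 2) .one) (.var 1)) (.add (.mul (.var 2) (.var 1)) (.var 1))) m 0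
    (fun V n => by simp [Sigma1, Delta0.Holds, Tm.eval, push, params])
    (by rw [hM.mul_zero, hM.mul_zero, hM.add_zero])
    (fun n ih => by
      rw [hM.mul_succ, ih, hM.mul_succ, hM.add_assoc', hM.add_assoc', hM.add_left_comm' n]) n

lemma mul_comm' (m n : M) : m * n = n * m :=
  hM.induction_of_formula (P := fun n => m * n = n * m)
    (.eq (.mul (.var 2) (.var 1)) (.mul (.var 1) (.var 2))) m 0
    (fun V n => by simp [Sigma1, Delta0.Holds, Tm.eval, push, params])
    (by rw [hM.mul_zero, hM.zero_mul'])
    (fun n ih => by rw [hM.mul_succ, ih, hM.succ_mul']) n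

lemma mul_add' (a b c : M) : a * (b + c) = a * b + a * c :=
  hM.induction_of_formula (P := fun c => a * (b + c) = a * b + a * c)
    (.eq (.mul (.var 2) (.add (.var 3) (.var 1)))
      (.add (.mul (.var 2) (.var 3)) (.mul (.var 2) (.var 1)))) a b
    (fun V n => by simp [Sigma1, Delta0.Holds, Tm.eval, push, params])
    (by rw [hM.add_zero, hM.mul_zero, hM.add_zero])
    (fun n ih => by rw [hM.add_succ, hM.mul_succ, ih, hM.mul_succ, hM.add_assoc']) c

lemma mul_assoc' (a b c : M) : (a * b) * c = a * (b * c) :=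
  hM.induction_of_formula (P := fun c => (a * b) * c = a * (b * c))
    (.eq (.mul (.mul (.var 2) (.var 3)) (.var 1)) (.mul (.var 2) (.mul (.var 3) (.var 1)))) a b
    (fun V n => by simp [Sigma1, Delta0.Holds, Tm.eval, push, params])
    (by rw [hM.mul_zero, hM.mul_zero, hM.mul_zero])
    (fun n ih => by rw [hM.mul_succ, ih, hM.mul_succ, hM.mul_add']) c

lemma mul_one' (a : M) : a * 1 = a := by
  rw [← hM.zero_add' 1, hM.mul_succ, hM.mul_zero, hM.zero_add']

lemma add_right_cancel' (m n k : M) : m + k = n + k → m = n :=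
  hM.induction_of_formula (P := fun k => m + k = n + k → m = n)
    (.not (.and (.eq (.add (.var 2) (.var 1)) (.add (.var 3) (.var 1)))
      (.not (.eq (.var 2) (.var 3))))) m n
    (fun V n => by simp [Sigma1, Delta0.Holds, Tm.eval, push, params])
    (by rw [hM.add_zero, hM.add_zero]; exact id)
    (fun k ih h => by
      rw [hM.add_succ, hM.add_succ] at h
      exact ih (hM.succ_inj _ _ h)) k

/-- The predecessor `k` is the witness `var 0` of the `Σ⁰₁` formula. The quantifier can be moved in
front of the disjunction, which is written with negation and conjunction. -/
lemma eq_zero_or_succ (n : M) : n = 0 ∨ ∃ k, n = k + 1 :=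
  hM.induction_of_formula (P := fun n => n = 0 ∨ ∃ k, n = k + 1)
    (.not (.and (.not (.eq (.var 1) .zero)) (.not (.eq (.var 1) (.add (.var 0) .one))))) 0 0
    (fun V n => by
      simp only [Sigma1, Delta0.Holds, Tm.eval, push, not_and, not_not]
      by_cases h : n = 0 <;> simp [h])
    (Or.inl rfl) (fun n _ => Or.inr ⟨n, rfl⟩) n

lemma lt_add_succ (m k : M) : m < m + (k + 1) :=
  hM.induction_of_formula (P := fun k => m < m + (k + 1))
    (.lt (.var 2) (.add (.var 2) (.add (.var 1) .one))) m 0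
    (fun V n => by simp [Sigma1, Delta0.Holds, Tm.eval, push, params])
    (by rw [hM.add_succ, hM.lt_succ, hM.add_zero]; exact Or.inr rfl)
    (fun k ih => by rw [hM.add_succ, hM.lt_succ]; exact Or.inl ih) k

lemma exists_of_lt (m n : M) : m < n → ∃ k, n = m + (k + 1) :=
  hM.induction_of_formula (P := fun n => m < n → ∃ k, n = m + (k + 1))
    (.not (.and (.lt (.var 2) (.var 1))
      (.not (.eq (.var 1) (.add (.var 2) (.add (.var 0) .one)))))) m 0
    (fun V n => by
      simp only [Sigma1, Delta0.Holds, Tm.eval, push, params, not_and, not_not]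
      by_cases h : m < n <;> simp [h])
    (fun h => (hM.not_lt_zero m h).elim)
    (fun n ih h => by
      rcases (hM.lt_succ m n).1 h with h | rfl
      · obtain ⟨k, rfl⟩ := ih h
        exact ⟨k + 1, by rw [← hM.add_succ]⟩
      · exact ⟨0, by rw [hM.zero_add']⟩) n

lemma lt_iff_exists (m n : M) : m < n ↔ ∃ k, n = m + (k + 1) :=
  ⟨hM.exists_of_lt m n, by rintro ⟨k, rfl⟩; exact hM.lt_add_succ m k⟩

lemma lt_trichotomy' (m n : M) : m < n ∨ m = n ∨ n < m :=
  hM.induction_of_formula (P := fun n => m < n ∨ m = n ∨ n < m)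
    (.not (.and (.not (.lt (.var 2) (.var 1)))
      (.and (.not (.eq (.var 2) (.var 1))) (.not (.lt (.var 1) (.var 2)))))) m 0
    (fun V n => by simp [Sigma1, Delta0.Holds, Tm.eval, push, params]; tauto)
    (by
      rcases hM.eq_zero_or_succ m with rfl | ⟨k, rfl⟩
      · exact Or.inr (Or.inl rfl)
      · exact Or.inr (Or.inr ((hM.lt_iff_exists _ _).2 ⟨k, (hM.zero_add' _).symm⟩)))
    (fun n ih => by
      rcases ih with h | rfl | h
      · exact Or.inl ((hM.lt_succ _ _).2 (Or.inl h))
      · exact Or.inl ((hM.lt_succ _ _).2 (Or.inr rfl))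
      · obtain ⟨k, rfl⟩ := hM.exists_of_lt _ _ h
        rcases hM.eq_zero_or_succ k with rfl | ⟨j, rfl⟩
        · exact Or.inr (Or.inl (by rw [hM.zero_add']))
        · refine Or.inr (Or.inr ((hM.lt_iff_exists _ _).2 ⟨j, ?_⟩))
          rw [hM.add_succ, ← hM.succ_add']) n

lemma lt_irrefl' (m : M) : ¬ m < m := fun h => by
  obtain ⟨k, hk⟩ := hM.exists_of_lt _ _ h
  rw [hM.add_comm'] at hk
  have : 0 + m = (k + 1) + m := by rw [hM.zero_add']; exact hk
  exact hM.succ_ne_zero k (hM.add_right_cancel' _ _ _ this).symm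

lemma lt_trans' {a b c : M} (h : a < b) (h' : b < c) : a < c := by
  obtain ⟨k, rfl⟩ := hM.exists_of_lt _ _ h
  obtain ⟨j, rfl⟩ := hM.exists_of_lt _ _ h'
  exact (hM.lt_iff_exists _ _).2 ⟨(k + 1) + j, by rw [hM.add_assoc', hM.add_succ]⟩

lemma add_lt_add_right' {a b : M} (h : a < b) (c : M) : a + c < b + c := by
  obtain ⟨k, rfl⟩ := hM.exists_of_lt _ _ h
  exact (hM.lt_iff_exists _ _).2
    ⟨k, by rw [hM.add_assoc', hM.add_comm' (k + 1), hM.add_assoc']⟩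

/-- The numbers of a model of `RCA₀` form a commutative semiring. -/
@[reducible] def toCommSemiring : CommSemiring M where
  add_assoc := hM.add_assoc'
  zero_add := hM.zero_add'
  add_zero := hM.add_zero
  add_comm := hM.add_comm'
  nsmul := nsmulRec
  left_distrib := hM.mul_add'
  right_distrib a b c := by
    rw [hM.mul_comm', hM.mul_add', hM.mul_comm' c, hM.mul_comm' c]
  zero_mul := hM.zero_mul'
  mul_zero := hM.mul_zero
  mul_assoc := hM.mul_assoc'
  one_mul a := by rw [hM.mul_comm', hM.mul_one']
  mul_one := hM.mul_one'
  mul_comm := hM.mul_comm'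

open Classical in
/-- The numbers of a model of `RCA₀` are linearly ordered. -/
@[reducible] noncomputable def toLinearOrder : LinearOrder M where
  le a b := a < b ∨ a = b
  lt a b := a < b
  le_refl a := Or.inr rfl
  le_trans a b c := by
    rintro (h | rfl) (h' | rfl)
    · exact Or.inl (hM.lt_trans' h h')
    · exact Or.inl h
    · exact Or.inl h'
    · exact Or.inr rfl
  lt_iff_le_not_ge a b := by
    constructor
    · intro h
      refine ⟨Or.inl h, ?_⟩
      rintro (h' | rfl)
      · exact hM.lt_irrefl' _ (hM.lt_trans' h h')
      · exact hM.lt_irrefl' _ h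
    · rintro ⟨h | rfl, h'⟩
      · exact h
      · exact (h' (Or.inr rfl)).elim
  le_antisymm a b := by
    rintro (h | rfl) (h' | h')
    · exact (hM.lt_irrefl' _ (hM.lt_trans' h h')).elim
    · exact h'.symm
    · rfl
    · rfl
  le_total a b := by
    rcases hM.lt_trichotomy' a b with h | h | h
    · exact Or.inl (Or.inl h)
    · exact Or.inl (Or.inr h)
    · exact Or.inr (Or.inl h)
  toDecidableLE := Classical.decRel _
  toDecidableEq := Classical.decEq _
  toDecidableLT := Classical.decRel _

lemma isStrictOrderedRing :
    @IsStrictOrderedRing M hM.toCommSemiring.toSemiring hM.toLinearOrder.toPartialOrder := by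
  let _ := hM.toCommSemiring
  let _ := hM.toLinearOrder
  have hlt : ∀ a b : M, a < b → ∀ c : M, a + c < b + c := fun a b h c => hM.add_lt_add_right' h c
  have hle : ∀ a b : M, a ≤ b → ∀ c : M, a + c ≤ b + c := fun a b h c => by
    rcases h.lt_or_eq with h | rfl
    · exact (hlt _ _ h c).le
    · exact le_rfl
  have hmul : ∀ a : M, 0 < a → ∀ b c : M, b < c → a * b < a * c := by
    intro a ha b c h
    obtain ⟨j, rfl⟩ := hM.exists_of_lt _ _ ha
    obtain ⟨k, rfl⟩ := hM.exists_of_lt _ _ h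
    -- With `a = 0 + (j + 1)` and `c = b + (k + 1)`, the difference of the products is `(j + 1)(k +
    -- 1) = (j(k + 1) + k) + 1`.
    refine (hM.lt_iff_exists _ _).2 ⟨j * (k + 1) + k, ?_⟩
    ring
  exact
    { add_le_add_left := hle
      le_of_add_le_add_left := fun a b c h => by
        by_contra h'
        have := hlt _ _ (not_le.1 h') a
        rw [add_comm c, add_comm b] at this
        exact absurd h (not_le.2 this)
      zero_le_one := Or.inl ((hM.lt_iff_exists _ _).2 ⟨0, by
        rw [hM.zero_add', hM.zero_add']⟩)
      exists_pair_ne := ⟨0, 1, fun h => hM.succ_ne_zero 0 (by rw [hM.zero_add', ← h])⟩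
      mul_lt_mul_of_pos_left := fun a ha b c h => hmul a ha b c h
      mul_lt_mul_of_pos_right := fun a ha b c h => by
        simpa only [mul_comm] using hmul a ha b c h }

end Arithmetic

end IsModelRCA0

end SecondOrder

namespace SecondOrder

set_option linter.unusedSectionVars false

/-! ### Models as ordered semirings -/

/-- The numbers `M` carry a model of `RCA₀` with the given ordered semiring structure. -/
class Model (M : Type*) [CommSemiring M] [LinearOrder M] [IsStrictOrderedRing M] where
  /-- The sets of the model. -/
  sets : Set (Set M)
  isModel : IsModelRCA0 M sets

section Basic

variable {M : Type*} [CommSemiring M] [LinearOrder M] [IsStrictOrderedRing M] [Model M]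

open Model

instance : CanonicallyOrderedAdd M where
  exists_add_of_le {a b} h := by
    rcases h.lt_or_eq with h | rfl
    · obtain ⟨k, rfl⟩ := isModel.exists_of_lt a b h
      exact ⟨k + 1, rfl⟩
    · exact ⟨0, (add_zero a).symm⟩
  le_self_add a b := by
    rcases isModel.eq_zero_or_succ b with rfl | ⟨k, rfl⟩
    · rw [add_zero]
    · exact (isModel.lt_add_succ a k).le
  le_add_self a b := by
    rcases isModel.eq_zero_or_succ b with rfl | ⟨k, rfl⟩
    · rw [zero_add]
    · rw [add_comm]
      exact (isModel.lt_add_succ a k).le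

lemma lt_succ_iff {m n : M} : m < n + 1 ↔ m ≤ n := by
  rw [isModel.lt_succ, le_iff_lt_or_eq]

lemma succ_le_iff {m n : M} : m + 1 ≤ n ↔ m < n := by
  rw [← not_lt, lt_succ_iff, not_le]

/-! ### The pairing function -/

lemma le_mul_self_of_model (a : M) : a ≤ a * a := by
  rcases isModel.eq_zero_or_succ a with rfl | ⟨k, rfl⟩
  · simp
  · exact le_mul_of_one_le_right' (le_add_self)

lemma left_le_pair (a b : M) : a ≤ pair a b := le_add_self

lemma right_le_pair (a b : M) : b ≤ pair a b :=
  (le_add_self.trans (le_mul_self_of_model (a + b))).trans le_self_add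

/-- With `s = a + b`, the code lies between `s²` and `s² + s < (s + 1)²`, so the sum of the
components dominates. Besides injectivity, this allows recursion on coded pairs whenever the sum of
the codes decreases. -/
lemma pair_lt_pair_of_add_lt {a b c d : M} (h : a + b < c + d) : pair a b < pair c d := by
  have h1 : a + b + 1 ≤ c + d := succ_le_iff.2 h
  calc pair a b ≤ (a + b) * (a + b) + (a + b) := by unfold pair; gcongr; exact le_self_add
    _ < (a + b) * (a + b) + (a + b) + (a + b + 1) :=
        lt_add_of_pos_right _ (lt_of_lt_of_le zero_lt_one le_add_self)
    _ = (a + b + 1) * (a + b + 1) := by ring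
    _ ≤ (c + d) * (c + d) := by gcongr
    _ ≤ pair c d := le_self_add

lemma pair_inj {a b c d : M} : pair a b = pair c d ↔ a = c ∧ b = d := by
  refine ⟨fun h => ?_, by rintro ⟨rfl, rfl⟩; rfl⟩
  have hs : a + b = c + d := by
    rcases lt_trichotomy (a + b) (c + d) with h' | h' | h'
    · exact absurd h (pair_lt_pair_of_add_lt h').ne
    · exact h'
    · exact absurd h (pair_lt_pair_of_add_lt h').ne'
  unfold pair at h
  rw [hs] at h
  have hac := add_left_cancel h
  subst hac
  exact ⟨rfl, add_left_cancel hs⟩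

end Basic

/-! ### Comprehension -/

/-- The term for the pairing function. -/
def Tm.pair (s t : Tm) : Tm := .add (.mul (.add s t) (.add s t)) s

/-- Disjunction. -/
def Delta0.or (φ ψ : Delta0) : Delta0 := .not (.and (.not φ) (.not ψ))

/-- Implication. -/
def Delta0.imp (φ ψ : Delta0) : Delta0 := .not (.and φ (.not ψ))

/-- Bounded existential quantification. -/
def Delta0.bex (t : Tm) (φ : Delta0) : Delta0 := .not (.ball t (.not φ))

/-- `exPair k φ` says that `var k` is a pair `⟨a, b⟩` such that `φ` holds with `b` and `a` as new
variables `var 0` and `var 1`. -/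
def Delta0.exPair (k : ℕ) (φ : Delta0) : Delta0 :=
  .bex (.add (.var k) .one) (.bex (.add (.var (k + 1)) .one)
    (.and (.eq (.var (k + 2)) (.pair (.var 1) (.var 0))) φ))

section Formulas

variable {M : Type*} [CommSemiring M] [LinearOrder M] [IsStrictOrderedRing M] [Model M]
  (V : ℕ → Set M) (v : ℕ → M) (φ ψ : Delta0)

lemma Tm.eval_pair (s t : Tm) : (Tm.pair s t).eval v = SecondOrder.pair (s.eval v) (t.eval v) := rfl

lemma Delta0.holds_or : (φ.or ψ).Holds V v ↔ φ.Holds V v ∨ ψ.Holds V v := by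
  simp only [Delta0.or, Holds]; tauto

lemma Delta0.holds_imp : (φ.imp ψ).Holds V v ↔ (φ.Holds V v → ψ.Holds V v) := by
  simp only [Delta0.imp, Holds]; tauto

lemma Delta0.holds_bex (t : Tm) :
    (Delta0.bex t φ).Holds V v ↔ ∃ a, a < t.eval v ∧ φ.Holds V (push a v) := by
  simp [Delta0.bex, Holds]

lemma Delta0.holds_exPair (k : ℕ) :
    (Delta0.exPair k φ).Holds V v ↔
      ∃ a b, v k = SecondOrder.pair a b ∧ φ.Holds V (push b (push a v)) := by
  simp only [Delta0.exPair, holds_bex, Holds, Tm.eval_pair, Tm.eval, push, lt_succ_iff]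
  constructor
  · rintro ⟨a, -, b, -, h⟩
    exact ⟨a, b, h⟩
  · rintro ⟨a, b, h, h'⟩
    exact ⟨a, h ▸ left_le_pair a b, b, h ▸ right_le_pair a b, h, h'⟩

end Formulas

/-- The assignment of three sets to the set variables. -/
def setParams {M : Type*} (A B C : Set M) : ℕ → Set M
  | 0 => A
  | 1 => B
  | _ => C

open Model

section Sets

variable {M : Type*} [CommSemiring M] [LinearOrder M] [IsStrictOrderedRing M] [Model M]
  {A B C : Set M}

lemma setParams_mem (hA : A ∈ sets) (hB : B ∈ sets) (hC : C ∈ sets) (i : ℕ) :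
    setParams A B C i ∈ sets :=
  match i with
  | 0 => hA
  | 1 => hB
  | _ + 2 => hC

/-- All number variables other than the quantified one and `n` receive the same value `c`: one
number parameter suffices, since several could be supplied through sets. -/
lemma setOf_mem_sets_of_sigma_pi (hA : A ∈ sets) (hB : B ∈ sets) (hC : C ∈ sets)
    (φ ψ : Delta0) (c : M) {P : M → Prop}
    (hφ : ∀ n, Sigma1 φ (fun _ => c) (setParams A B C) n ↔ P n)
    (hψ : ∀ n, Pi1 ψ (fun _ => c) (setParams A B C) n ↔ P n) : {n | P n} ∈ sets := by
  have := isModel.delta1_comprehension φ ψ (fun _ => c) _ (setParams_mem hA hB hC)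
  simpa only [hφ, hψ, implies_true, forall_const] using this

lemma setOf_mem_sets_of_delta0 (hA : A ∈ sets) (hB : B ∈ sets) (hC : C ∈ sets)
    (φ : Delta0) (c : M) {P : M → Prop}
    (hφ : ∀ x n, φ.Holds (setParams A B C) (push x (push n fun _ => c)) ↔ P n) :
    {n | P n} ∈ sets :=
  setOf_mem_sets_of_sigma_pi hA hB hC φ φ c (fun n => by simp [Sigma1, hφ])
    (fun n => by simp [Pi1, hφ])

lemma compl_mem_sets (hA : A ∈ sets) : Aᶜ ∈ sets :=
  setOf_mem_sets_of_delta0 (P := fun n => n ∉ A) hA hA hA (.not (.mem (.var 1) 0)) 0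
    (by simp [Delta0.Holds, Tm.eval, push, setParams])

lemma inter_mem_sets (hA : A ∈ sets) (hB : B ∈ sets) : A ∩ B ∈ sets :=
  setOf_mem_sets_of_delta0 (P := fun n => n ∈ A ∧ n ∈ B) hA hB hB (.and (.mem (.var 1) 0) (.mem (.var 1) 1)) 0
    (by simp [Delta0.Holds, Tm.eval, push, setParams])

lemma union_mem_sets (hA : A ∈ sets) (hB : B ∈ sets) : A ∪ B ∈ sets := by
  simpa [Set.compl_inter] using compl_mem_sets (inter_mem_sets (compl_mem_sets hA) (compl_mem_sets hB))

lemma univ_mem_sets : (Set.univ : Set M) ∈ sets := by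
  obtain ⟨A, hA⟩ := (isModel (M := M)).sets_nonempty
  simpa using union_mem_sets hA (compl_mem_sets hA)

lemma singleton_mem_sets (c : M) : {c} ∈ sets :=
  setOf_mem_sets_of_delta0 (P := fun n => n = c) univ_mem_sets univ_mem_sets univ_mem_sets (.eq (.var 1) (.var 2)) c
    (by simp [Delta0.Holds, Tm.eval, push])

/-- Finiteness is meant externally: the set is built up by unions with singletons. It yields the
supports `{a, b}` and all functions on finite types of truth values. -/
lemma _root_.Set.Finite.mem_sets (hA : A.Finite) : A ∈ sets := by
  induction A, hA using Set.Finite.induction_on with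
  | empty => simpa using compl_mem_sets (univ_mem_sets (M := M))
  | insert _ _ ih => exact union_mem_sets (singleton_mem_sets _) ih

end Sets

/-! ### Coded types and computable functions -/

/-- The elements of `α` are coded by the numbers in a set of the model. -/
class Coded (M : Type*) [CommSemiring M] [LinearOrder M] [IsStrictOrderedRing M] [Model M]
    (α : Type*) where
  /-- The code of an element. -/
  enc : α → M
  enc_injective : Function.Injective enc
  range_mem : Set.range enc ∈ sets

open Coded

section Comp

variable (M : Type*) [CommSemiring M] [LinearOrder M] [IsStrictOrderedRing M] [Model M]
  {α β γ : Type*} [Coded M α] [Coded M β] [Coded M γ]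

/-- The graph of `f` belongs to the model. -/
@[fun_prop]
def Comp (f : α → β) : Prop :=
  {z : M | ∃ a, z = pair (enc a) (enc (f a))} ∈ sets

instance : Coded M M where
  enc := id
  enc_injective := Function.injective_id
  range_mem := by simpa using univ_mem_sets

-- With truth values coded by `0` and `1`, a decidable predicate is just a computable function into
-- `Prop`, and logical connectives are handled by composition.
open Classical in
noncomputable instance : Coded M Prop where
  enc p := if p then 1 else 0
  enc_injective p q h := by
    by_cases hp : p <;> by_cases hq : q <;> simp_all
  range_mem := (Set.finite_range _).mem_sets

instance : Coded M (α × β) where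
  enc a := pair (enc a.1) (enc a.2)
  enc_injective a b h := by
    obtain ⟨h1, h2⟩ := pair_inj.1 h
    exact Prod.ext (enc_injective h1) (enc_injective h2)
  range_mem := by
    refine setOf_mem_sets_of_delta0 (range_mem (M := M) (α := α)) (range_mem (M := M) (α := β))
      univ_mem_sets (.exPair 1 (.and (.mem (.var 1) 0) (.mem (.var 0) 1))) 0 ?_
    intro x z
    simp only [Set.mem_range, Prod.exists, Delta0.holds_exPair, Delta0.Holds,
      Tm.eval, push, setParams]
    constructor
    · rintro ⟨_, _, rfl, ⟨a, rfl⟩, ⟨b, rfl⟩⟩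
      exact ⟨a, b, rfl⟩
    · rintro ⟨a, b, rfl⟩
      exact ⟨_, _, rfl, ⟨a, rfl⟩, ⟨b, rfl⟩⟩

variable {M}

lemma enc_id (a : M) : (enc a : M) = a := rfl

lemma enc_prod (a : α × β) : (enc a : M) = pair (enc a.1) (enc a.2) := rfl

lemma enc_eq_iff {a b : α} : (enc a : M) = enc b ↔ a = b := enc_injective.eq_iff

lemma comp_of_delta0 {f : α → β} {A B C : Set M} (hA : A ∈ sets) (hB : B ∈ sets) (hC : C ∈ sets)
    (φ : Delta0) (c : M)
    (hφ : ∀ x n, φ.Holds (setParams A B C) (push x (push n fun _ => c)) ↔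
      ∃ a, n = pair (enc a) (enc (f a))) : Comp M f :=
  setOf_mem_sets_of_delta0 hA hB hC φ c hφ

@[fun_prop]
lemma comp_id : Comp M (fun a : α => a) := by
  have h := range_mem (M := M) (α := α)
  refine comp_of_delta0 h h h (.exPair 1 (.and (.eq (.var 0) (.var 1)) (.mem (.var 0) 0))) 0 ?_
  intro x n
  simp only [Delta0.holds_exPair, Delta0.Holds, Tm.eval, push, setParams, Set.mem_range]
  constructor
  · rintro ⟨a, b, rfl, rfl, a, rfl⟩
    exact ⟨a, rfl⟩
  · rintro ⟨a, rfl⟩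
    exact ⟨_, _, rfl, rfl, a, rfl⟩

@[fun_prop]
lemma comp_const (b : β) : Comp M (fun _ : α => b) := by
  have h := range_mem (M := M) (α := α)
  refine comp_of_delta0 h h h
    (.exPair 1 (.and (.mem (.var 1) 0) (.eq (.var 0) (.var 4)))) (enc b) ?_
  intro x n
  simp only [Delta0.holds_exPair, Delta0.Holds, Tm.eval, push, setParams, Set.mem_range]
  constructor
  · rintro ⟨a, b, rfl, ⟨a, rfl⟩, rfl⟩
    exact ⟨a, rfl⟩
  · rintro ⟨a, rfl⟩
    exact ⟨_, _, rfl, ⟨a, rfl⟩, rfl⟩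

-- Here `Δ⁰₁` comprehension is used with genuinely different formulas: the graph of the composition
-- says that some intermediate value leads to the result, or equivalently that every intermediate
-- value does.
@[fun_prop]
lemma Comp.comp {g : β → γ} {f : α → β} (hg : Comp M g) (hf : Comp M f) :
    Comp M (fun a => g (f a)) := by
  refine setOf_mem_sets_of_sigma_pi hf hg (range_mem (M := M) (α := α))
    (.exPair 1 (.and (.mem (.pair (.var 1) (.var 2)) 0) (.mem (.pair (.var 2) (.var 0)) 1)))
    (.exPair 1 (.and (.mem (.var 1) 2)
      (.imp (.mem (.pair (.var 1) (.var 2)) 0) (.mem (.pair (.var 2) (.var 0)) 1)))) 0 ?_ ?_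
  · intro n
    simp only [Sigma1, Delta0.holds_exPair, Delta0.Holds, Tm.eval, Tm.eval_pair, push, setParams,
      Set.mem_ofPred_eq, pair_inj]
    constructor
    · rintro ⟨x, _, _, rfl, ⟨a, rfl, rfl⟩, ⟨b, hb, rfl⟩⟩
      rw [enc_eq_iff] at hb
      exact ⟨a, by rw [hb]⟩
    · rintro ⟨a, rfl⟩
      exact ⟨_, _, _, rfl, ⟨a, rfl, rfl⟩, _, rfl, rfl⟩
  · intro n
    simp only [Pi1, Delta0.holds_exPair, Delta0.holds_imp, Delta0.Holds, Tm.eval, Tm.eval_pair,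
      push, setParams, Set.mem_ofPred_eq, pair_inj, Set.mem_range]
    constructor
    · intro h
      -- The instance `0` is used only for the part that does not depend on the intermediate value,
      -- namely that `n` is a pair with first component in the domain. The instance `enc (f a)` then
      -- has a true premise.
      obtain ⟨_, _, rfl, ⟨a, rfl⟩, -⟩ := h 0
      obtain ⟨_, _, h1, -, h2⟩ := h (enc (f a))
      obtain ⟨rfl, rfl⟩ := pair_inj.1 h1
      obtain ⟨b, hb, h3⟩ := h2 ⟨a, rfl, rfl⟩
      rw [enc_eq_iff] at hb
      exact ⟨a, by rw [hb, h3]⟩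
    · rintro ⟨a, rfl⟩ x
      refine ⟨_, _, rfl, ⟨a, rfl⟩, ?_⟩
      rintro ⟨b, hb, rfl⟩
      rw [enc_eq_iff] at hb
      exact ⟨f a, by rw [hb], rfl⟩

lemma comp_fst : Comp M (fun z : α × β => z.1) := by
  refine comp_of_delta0 (range_mem (M := M) (α := α)) (range_mem (M := M) (α := β))
    univ_mem_sets (.exPair 1 (.exPair 1 (.and (.eq (.var 2) (.var 1))
      (.and (.mem (.var 1) 0) (.mem (.var 0) 1))))) 0 ?_
  intro x n
  simp only [Delta0.holds_exPair, Delta0.Holds, Tm.eval, push, setParams, Set.mem_range,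
    Prod.exists, enc_prod]
  constructor
  · rintro ⟨_, _, rfl, _, _, rfl, rfl, ⟨a, rfl⟩, b, rfl⟩
    exact ⟨a, b, rfl⟩
  · rintro ⟨a, b, rfl⟩
    exact ⟨_, _, rfl, _, _, rfl, rfl, ⟨a, rfl⟩, b, rfl⟩

lemma comp_snd : Comp M (fun z : α × β => z.2) := by
  refine comp_of_delta0 (range_mem (M := M) (α := α)) (range_mem (M := M) (α := β))
    univ_mem_sets (.exPair 1 (.exPair 1 (.and (.eq (.var 2) (.var 0))
      (.and (.mem (.var 1) 0) (.mem (.var 0) 1))))) 0 ?_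
  intro x n
  simp only [Delta0.holds_exPair, Delta0.Holds, Tm.eval, push, setParams, Set.mem_range,
    Prod.exists, enc_prod]
  constructor
  · rintro ⟨_, _, rfl, _, _, rfl, rfl, ⟨a, rfl⟩, b, rfl⟩
    exact ⟨a, b, rfl⟩
  · rintro ⟨a, b, rfl⟩
    exact ⟨_, _, rfl, _, _, rfl, rfl, ⟨a, rfl⟩, b, rfl⟩

@[fun_prop]
lemma Comp.fst {f : α → β × γ} (hf : Comp M f) : Comp M (fun a => (f a).1) := comp_fst.comp hf

@[fun_prop]
lemma Comp.snd {f : α → β × γ} (hf : Comp M f) : Comp M (fun a => (f a).2) := comp_snd.comp hf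

@[fun_prop]
lemma Comp.prodMk {f : α → β} {g : α → γ} (hf : Comp M f) (hg : Comp M g) :
    Comp M (fun a => (f a, g a)) := by
  refine comp_of_delta0 hf hg hg (.exPair 1 (.exPair 0
    (.and (.mem (.pair (.var 3) (.var 1)) 0) (.mem (.pair (.var 3) (.var 0)) 1)))) 0 ?_
  intro x n
  simp only [Delta0.holds_exPair, Delta0.Holds, Tm.eval, Tm.eval_pair, push, setParams,
    Set.mem_ofPred_eq, enc_prod, pair_inj]
  constructor
  · rintro ⟨_, _, rfl, _, _, rfl, ⟨a, rfl, rfl⟩, ⟨b, hb, rfl⟩⟩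
    rw [enc_eq_iff] at hb
    exact ⟨a, by rw [hb]⟩
  · rintro ⟨a, rfl⟩
    exact ⟨_, _, rfl, _, _, rfl, ⟨a, rfl, rfl⟩, ⟨a, rfl, rfl⟩⟩

lemma comp_add : Comp M (fun z : M × M => z.1 + z.2) := by
  refine comp_of_delta0 univ_mem_sets univ_mem_sets univ_mem_sets
    (.exPair 1 (.exPair 1 (.eq (.var 2) (.add (.var 1) (.var 0))))) 0 ?_
  intro x n
  simp only [Delta0.holds_exPair, Delta0.Holds, Tm.eval, push, Prod.exists, enc_prod, enc_id]
  constructor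
  · rintro ⟨_, _, rfl, a, b, rfl, rfl⟩
    exact ⟨a, b, rfl⟩
  · rintro ⟨a, b, rfl⟩
    exact ⟨_, _, rfl, _, _, rfl, rfl⟩

lemma comp_mul : Comp M (fun z : M × M => z.1 * z.2) := by
  refine comp_of_delta0 univ_mem_sets univ_mem_sets univ_mem_sets
    (.exPair 1 (.exPair 1 (.eq (.var 2) (.mul (.var 1) (.var 0))))) 0 ?_
  intro x n
  simp only [Delta0.holds_exPair, Delta0.Holds, Tm.eval, push, Prod.exists, enc_prod, enc_id]
  constructor
  · rintro ⟨_, _, rfl, a, b, rfl, rfl⟩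
    exact ⟨a, b, rfl⟩
  · rintro ⟨a, b, rfl⟩
    exact ⟨_, _, rfl, _, _, rfl, rfl⟩

@[fun_prop]
lemma Comp.add {f g : α → M} (hf : Comp M f) (hg : Comp M g) : Comp M (fun a => f a + g a) :=
  comp_add.comp (hf.prodMk hg)

@[fun_prop]
lemma Comp.mul {f g : α → M} (hf : Comp M f) (hg : Comp M g) : Comp M (fun a => f a * g a) :=
  comp_mul.comp (hf.prodMk hg)

@[fun_prop]
lemma Comp.pair {f g : α → M} (hf : Comp M f) (hg : Comp M g) :
    Comp M (fun a => SecondOrder.pair (f a) (g a)) := by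
  unfold SecondOrder.pair
  fun_prop

lemma comp_enc : Comp M (fun a : α => (enc a : M)) := comp_id (M := M) (α := α)

@[fun_prop]
lemma Comp.enc {f : α → β} (hf : Comp M f) : Comp M (fun a => (enc (f a) : M)) := comp_enc.comp hf

lemma comp_of_finite [Finite α] (f : α → β) : Comp M f := by
  have : {z : M | ∃ a, z = SecondOrder.pair (Coded.enc a) (Coded.enc (f a))} =
      Set.range fun a => (SecondOrder.pair (Coded.enc a) (Coded.enc (f a)) : M) := by
    ext z; simp [eq_comm]
  rw [Comp, this]
  exact (Set.finite_range _).mem_sets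

/-! ### Decidable predicates -/

/-- The graph of a characteristic function and the set of codes where it is true are `Δ⁰₀` definable
from each other. This connects predicates as functions with sets of the model. -/
lemma comp_prop_iff {p : α → Prop} :
    Comp M p ↔ {z : M | ∃ a, z = Coded.enc a ∧ p a} ∈ sets := by
  have hr := range_mem (M := M) (α := α)
  constructor
  · intro h
    refine setOf_mem_sets_of_delta0 h h h (.mem (.pair (.var 1) .one) 0) 0 ?_
    intro x n
    simp only [Delta0.Holds, Tm.eval, Tm.eval_pair, push, setParams, Set.mem_ofPred_eq, pair_inj]
    refine exists_congr fun a => and_congr_right fun _ => ?_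
    by_cases hp : p a <;> simp [Coded.enc, hp]
  · intro h
    refine comp_of_delta0 hr h h (.exPair 1 (.and (.mem (.var 1) 0)
      (.or (.and (.mem (.var 1) 1) (.eq (.var 0) .one))
        (.and (.not (.mem (.var 1) 1)) (.eq (.var 0) .zero))))) 0 ?_
    intro x n
    simp only [Delta0.holds_exPair, Delta0.holds_or, Delta0.Holds, Tm.eval, push, setParams,
      Set.mem_ofPred_eq, Set.mem_range]
    constructor
    · rintro ⟨_, b, rfl, ⟨a, rfl⟩, ⟨⟨a', h1, h2⟩, rfl⟩ | ⟨h1, rfl⟩⟩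
      · rw [enc_eq_iff] at h1
        subst h1
        exact ⟨a, by simp [Coded.enc, h2]⟩
      · refine ⟨a, ?_⟩
        have : ¬ p a := fun h => h1 ⟨a, rfl, h⟩
        simp [Coded.enc, this]
    · rintro ⟨a, rfl⟩
      refine ⟨_, _, rfl, ⟨a, rfl⟩, ?_⟩
      by_cases hp : p a
      · exact Or.inl ⟨⟨a, rfl, hp⟩, by simp [Coded.enc, hp]⟩
      · refine Or.inr ⟨?_, by simp [Coded.enc, hp]⟩
        rintro ⟨a', h1, h2⟩
        rw [enc_eq_iff] at h1
        exact hp (h1 ▸ h2)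

@[fun_prop]
lemma Comp.not {p : α → Prop} (hp : Comp M p) : Comp M (fun a => ¬ p a) :=
  (comp_of_finite (M := M) Not).comp hp

@[fun_prop]
lemma Comp.and {p q : α → Prop} (hp : Comp M p) (hq : Comp M q) : Comp M (fun a => p a ∧ q a) :=
  (comp_of_finite (M := M) fun z : Prop × Prop => z.1 ∧ z.2).comp (hp.prodMk hq)

@[fun_prop]
lemma Comp.or {p q : α → Prop} (hp : Comp M p) (hq : Comp M q) : Comp M (fun a => p a ∨ q a) :=
  (comp_of_finite (M := M) fun z : Prop × Prop => z.1 ∨ z.2).comp (hp.prodMk hq)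

@[fun_prop]
lemma Comp.imp {p q : α → Prop} (hp : Comp M p) (hq : Comp M q) : Comp M (fun a => p a → q a) :=
  (comp_of_finite (M := M) fun z : Prop × Prop => z.1 → z.2).comp (hp.prodMk hq)

@[fun_prop]
lemma Comp.iff {p q : α → Prop} (hp : Comp M p) (hq : Comp M q) : Comp M (fun a => p a ↔ q a) :=
  (comp_of_finite (M := M) fun z : Prop × Prop => z.1 ↔ z.2).comp (hp.prodMk hq)

lemma Comp.of_iff {p q : α → Prop} (hp : Comp M p) (h : ∀ a, q a ↔ p a) : Comp M q := by
  have : q = p := funext fun a => propext (h a)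
  rwa [this]

lemma Comp.of_eq {f g : α → β} (hf : Comp M f) (h : ∀ a, g a = f a) : Comp M g := by
  have : g = f := funext h
  rwa [this]

lemma comp_lt : Comp M (fun z : M × M => z.1 < z.2) := by
  rw [comp_prop_iff]
  refine setOf_mem_sets_of_delta0 univ_mem_sets univ_mem_sets univ_mem_sets
    (.exPair 1 (.lt (.var 1) (.var 0))) 0 ?_
  intro x n
  simp [Delta0.holds_exPair, Delta0.Holds, Tm.eval, push, enc_prod, enc_id]

@[fun_prop]
lemma Comp.lt {f g : α → M} (hf : Comp M f) (hg : Comp M g) : Comp M (fun a => f a < g a) :=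
  comp_lt.comp (hf.prodMk hg)

@[fun_prop]
lemma Comp.le {f g : α → M} (hf : Comp M f) (hg : Comp M g) : Comp M (fun a => f a ≤ g a) :=
  (hg.lt hf).not.of_iff fun _ => not_lt.symm

@[fun_prop]
lemma Comp.eq {f g : α → β} (hf : Comp M f) (hg : Comp M g) : Comp M (fun a => f a = g a) :=
  ((hf.enc.le hg.enc).and (hg.enc.le hf.enc)).of_iff fun a => by
    rw [← le_antisymm_iff, enc_eq_iff]

lemma comp_mem_iff {A : Set M} : Comp M (fun a : M => a ∈ A) ↔ A ∈ sets := by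
  rw [comp_prop_iff]
  have : {z | ∃ a, z = (Coded.enc a : M) ∧ a ∈ A} = A := by
    ext z; simp [enc_id]
  rw [this]

lemma Comp.mem {A : Set M} (hA : A ∈ sets) {f : α → M} (hf : Comp M f) :
    Comp M (fun a => f a ∈ A) :=
  (comp_mem_iff.2 hA).comp hf

/-- The predicate under the quantifier enters as a set parameter, so that nested bounded quantifiers
only require formulas with one of them at a time. -/
lemma Comp.forall_lt {f : α → M} {p : α → M → Prop} (hf : Comp M f)
    (hp : Comp M fun z : α × M => p z.1 z.2) : Comp M (fun a => ∀ i, i < f a → p a i) := by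
  have key : Comp M (fun z : α × M => ∀ i, i < z.2 → p z.1 i) := by
    rw [comp_prop_iff] at hp ⊢
    refine setOf_mem_sets_of_delta0 hp (range_mem (M := M) (α := α)) univ_mem_sets
      (.exPair 1 (.and (.mem (.var 1) 1) (.ball (.var 0) (.mem (.pair (.var 2) (.var 0)) 0)))) 0 ?_
    intro x n
    simp only [Delta0.holds_exPair, Delta0.Holds, Tm.eval, Tm.eval_pair, push, setParams,
      Set.mem_range, Set.mem_ofPred_eq, Prod.exists, enc_prod, enc_id, pair_inj]
    constructor
    · rintro ⟨_, b, rfl, ⟨a, rfl⟩, h⟩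
      refine ⟨a, b, rfl, fun i hi => ?_⟩
      obtain ⟨a', i', ⟨h1, rfl⟩, h2⟩ := h i hi
      rw [enc_eq_iff] at h1
      exact h1 ▸ h2
    · rintro ⟨a, b, rfl, h⟩
      exact ⟨_, _, rfl, ⟨a, rfl⟩, fun i hi => ⟨a, i, ⟨rfl, rfl⟩, h i hi⟩⟩
  exact key.comp (comp_id.prodMk hf)

lemma Comp.exists_lt {f : α → M} {p : α → M → Prop} (hf : Comp M f)
    (hp : Comp M fun z : α × M => p z.1 z.2) : Comp M (fun a => ∃ i, i < f a ∧ p a i) :=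
  (hf.forall_lt (p := fun a i => ¬ p a i) hp.not).not.of_iff fun a => by simp

/-- An existential quantifier over numbers that can be bounded. -/
lemma Comp.exists_of_le {f : α → M} {p : α → M → Prop} (hf : Comp M f)
    (hp : Comp M fun z : α × M => p z.1 z.2) (h : ∀ a i, p a i → i ≤ f a) :
    Comp M (fun a => ∃ i, p a i) :=
  ((hf.add (comp_const (1 : M))).exists_lt hp).of_iff fun a =>
    ⟨fun ⟨i, hi⟩ => ⟨i, lt_succ_iff.2 (h a i hi), hi⟩, fun ⟨i, _, hi⟩ => ⟨i, hi⟩⟩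

/-- A function may be defined by arbitrary means, including classical choice, as long as its graph
turns out to be decidable. -/
lemma comp_iff_graph {f : α → β} : Comp M f ↔ Comp M fun z : α × β => f z.1 = z.2 := by
  refine ⟨fun h => by fun_prop, fun h => ?_⟩
  rw [comp_prop_iff] at h
  have : {z : M | ∃ a : α × β, z = Coded.enc a ∧ f a.1 = a.2} =
      {z : M | ∃ a, z = SecondOrder.pair (Coded.enc a) (Coded.enc (f a))} := by
    ext z
    simp [enc_prod]
  rwa [this] at h

/-! ### Induction -/

/-- With `p` as a set parameter the matrix of the `Σ⁰₁` formula is a single membership statement. -/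
lemma sigma_induction {p : M → M → Prop} (hp : Comp M fun z : M × M => p z.1 z.2)
    (h0 : ∃ y, p 0 y) (hs : ∀ n, (∃ y, p n y) → ∃ y, p (n + 1) y) (n : M) : ∃ y, p n y := by
  rw [comp_prop_iff] at hp
  have key := isModel.sigma1_induction (.mem (.pair (.var 1) (.var 0)) 0) (fun _ => 0) _
    (setParams_mem hp hp hp)
  have : ∀ n, Sigma1 (.mem (.pair (.var 1) (.var 0)) 0) (fun _ => (0 : M))
      (setParams {z : M | ∃ a : M × M, z = Coded.enc a ∧ p a.1 a.2}
        {z : M | ∃ a : M × M, z = Coded.enc a ∧ p a.1 a.2}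
        {z : M | ∃ a : M × M, z = Coded.enc a ∧ p a.1 a.2}) n ↔ ∃ y, p n y := by
    intro n
    simp [Sigma1, Delta0.Holds, Tm.eval, Tm.eval_pair, push, setParams, enc_prod, enc_id, pair_inj]
  simp only [this] at key
  exact key h0 hs n

/-- Induction along a computable measure. -/
theorem measure_induction {m : α → M} (hm : Comp M m) {p : α → Prop} (hp : Comp M p)
    (h : ∀ a, (∀ b, m b < m a → p b) → p a) (a : α) : p a := by
  by_contra ha
  -- From a counterexample `a` one descends: for each `i` there is a counterexample `b` with `m b +
  -- i ≤ m a`, which is absurd for `i = m a + 1`. The measure does not bound codes, so the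
  -- quantifier over `b` is unbounded and the induction formula has to be existential.
  have key := sigma_induction (M := M)
    (p := fun i x => ∃ b : α, x = Coded.enc b ∧ m b + i ≤ m a ∧ ¬ p b) ?_
    ⟨_, a, rfl, by simp, ha⟩ ?_ (m a + 1)
  · obtain ⟨_, b, -, hb, -⟩ := key
    exact absurd (le_add_self.trans hb) (not_le.2 (lt_succ_iff.2 le_rfl))
  · have : Comp M fun z : M × α => m z.2 + z.1 ≤ m a ∧ ¬ p z.2 := by fun_prop
    rw [comp_prop_iff] at this ⊢
    convert this using 1
    ext z
    simp only [Prod.exists, enc_prod, enc_id, Set.mem_ofPred_eq]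
    constructor
    · rintro ⟨i, _, rfl, b, rfl, h⟩
      exact ⟨i, b, rfl, h⟩
    · rintro ⟨i, b, rfl, h⟩
      exact ⟨i, _, rfl, b, rfl, h⟩
  · rintro n ⟨_, b, rfl, hb, hpb⟩
    have : ∃ b', m b' < m b ∧ ¬ p b' := by
      by_contra hc
      push Not at hc
      exact hpb (h b hc)
    obtain ⟨b', hlt, hb'⟩ := this
    refine ⟨_, b', rfl, ?_, hb'⟩
    calc m b' + (n + 1) = m b' + 1 + n := by ring
      _ ≤ m b + n := by gcongr; exact succ_le_iff.2 hlt
      _ ≤ m a := hb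

lemma strong_induction {p : M → Prop} (hp : Comp M p) (h : ∀ n, (∀ i, i < n → p i) → p n) (n : M) :
    p n :=
  measure_induction comp_id hp h n

lemma simple_induction {p : M → Prop} (hp : Comp M p) (h0 : p 0) (hs : ∀ n, p n → p (n + 1))
    (n : M) : p n := by
  refine strong_induction hp (fun n ih => ?_) n
  rcases isModel.eq_zero_or_succ n with rfl | ⟨k, rfl⟩
  · exact h0
  · exact hs k (ih k (lt_succ_iff.2 le_rfl))

lemma exists_least {p : M → Prop} (hp : Comp M p) (h : ∃ n, p n) :
    ∃ n, p n ∧ ∀ i, i < n → ¬ p i := by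
  by_contra hc
  push Not at hc
  obtain ⟨n, hn⟩ := h
  refine strong_induction hp.not (fun n ih hn => ?_) n hn
  obtain ⟨i, hi, hpi⟩ := hc n hn
  exact ih i hi hpi

/-- Minimization: the least witness has a decidable graph, because minimality is a bounded
quantifier. -/
lemma Comp.exists_fun {p : α → M → Prop} (hp : Comp M fun z : α × M => p z.1 z.2)
    (h : ∀ a, ∃ n, p a n) : ∃ f : α → M, Comp M f ∧ ∀ a, p a (f a) := by
  have : ∀ a, ∃ n, p a n ∧ ∀ i, i < n → ¬ p a i := fun a =>
    exists_least (p := fun n => p a n) (hp.comp (f := fun n => (a, n)) (by fun_prop)) (h a)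
  choose f hf hf' using this
  refine ⟨f, ?_, hf⟩
  rw [comp_iff_graph]
  have hc : Comp M fun z : α × M => p z.1 z.2 ∧ ∀ i, i < z.2 → ¬ p z.1 i := by
    refine hp.and (Comp.forall_lt (f := fun z : α × M => z.2) (p := fun z i => ¬ p z.1 i)
      (by fun_prop) ?_)
    exact (hp.comp (f := fun z : (α × M) × M => (z.1.1, z.2)) (by fun_prop)).not
  refine hc.of_iff fun z => ⟨?_, fun hz => ?_⟩
  · intro hz
    rw [← hz]
    exact ⟨hf _, hf' _⟩
  · rcases lt_trichotomy (f z.1) z.2 with h | h | h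
    · exact absurd (hf _) (hz.2 _ h)
    · exact h
    · exact absurd hz.1 (hf' _ _ h)

@[fun_prop]
lemma Comp.ite {p : α → Prop} {_ : ∀ a, Decidable (p a)} {f g : α → β} (hp : Comp M p) (hf : Comp M f) (hg : Comp M g) :
    Comp M (fun a => if p a then f a else g a) := by
  rw [comp_iff_graph]
  have : Comp M (fun z : α × β => (p z.1 → f z.1 = z.2) ∧ (¬ p z.1 → g z.1 = z.2)) := by
    fun_prop
  refine this.of_iff fun z => ?_
  by_cases h : p z.1 <;> simp [h]

end Comp

end SecondOrder

namespace SecondOrder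

open Model Coded

set_option linter.unusedSectionVars false

section Sequences

variable {M : Type*} [CommSemiring M] [LinearOrder M] [IsStrictOrderedRing M] [Model M]
  {α β γ : Type*} [Coded M α] [Coded M β] [Coded M γ]

/-! ### Finite sets -/

/-- In the absence of subtraction the two quotients are compared. If that of `a` is at least that of
`a + b`, cancellation forces `b = 0`. -/
lemma dvd_of_dvd_add {p a b : M} (h : p ∣ a + b) (ha : p ∣ a) : p ∣ b := by
  obtain ⟨u, rfl⟩ := ha
  obtain ⟨v, hv⟩ := h
  rcases le_total u v with huv | huv
  · obtain ⟨w, rfl⟩ := exists_add_of_le huv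
    rw [mul_add] at hv
    exact ⟨w, add_left_cancel hv⟩
  · obtain ⟨w, rfl⟩ := exists_add_of_le huv
    have : p * v + (p * w + b) = p * v + 0 := by
      rw [add_zero, ← add_assoc, ← mul_add]; exact hv
    have := add_left_cancel this
    rw [(add_eq_zero.1 this).2]
    exact dvd_zero p

@[fun_prop]
lemma Comp.dvd {f g : α → M} (hf : Comp M f) (hg : Comp M g) : Comp M (fun a => f a ∣ g a) := by
  have : Comp M fun a => ∃ c, c ≤ g a ∧ g a = f a * c :=
    Comp.exists_of_le hg (by fun_prop) fun a c h => h.1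
  refine this.of_iff fun a => ⟨?_, fun ⟨c, _, h⟩ => ⟨c, h⟩⟩
  rintro ⟨c, hc⟩
  -- A divisor `0` puts no bound on the quotient, which is then replaced by `0`.
  rcases eq_or_ne (f a) 0 with h0 | h0
  · exact ⟨0, zero_le, by rw [hc, h0]; simp⟩
  · refine ⟨c, ?_, hc⟩
    rw [hc]
    exact le_mul_of_one_le_left' (by simpa using succ_le_iff.2 (pos_iff_ne_zero.2 h0))

/-- A substitute for the factorial: only existence is asserted, so `Σ⁰₁` induction is enough and no
recursion is required. -/
lemma exists_common_multiple (k : M) : ∃ m : M, 0 < m ∧ ∀ j, j < k + 1 → 0 < j → j ∣ m := by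
  refine sigma_induction (p := fun k m => 0 < m ∧ ∀ j, j < k + 1 → 0 < j → j ∣ m) ?_ ?_ ?_ k
  · exact Comp.and (by fun_prop) (Comp.forall_lt (f := fun z : M × M => z.1 + 1)
      (p := fun z j => 0 < j → j ∣ z.2) (by fun_prop) (by fun_prop))
  · exact ⟨1, zero_lt_one, fun j hj h0 => by
      rw [lt_succ_iff] at hj
      exact absurd hj (not_le.2 h0)⟩
  · rintro k ⟨m, hm, h⟩
    refine ⟨m * (k + 1), by positivity, fun j hj h0 => ?_⟩
    rcases (lt_succ_iff.1 hj).lt_or_eq with hj | rfl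
    · exact (h j hj h0).mul_right _
    · exact dvd_mul_left _ _

/-- The factor `m` is invertible modulo `m * u + 1`, as witnessed by `(m * u + 1) * t = u * (m * t)
+ t`. -/
lemma dvd_of_dvd_mul_modulus {m u t : M} (h : m * u + 1 ∣ m * t) : m * u + 1 ∣ t := by
  refine dvd_of_dvd_add (a := u * (m * t)) ?_ (h.mul_left u)
  exact ⟨t, by ring⟩

/-- Coprimality of Gödel's moduli, in the form of a cancellation rule. Two moduli differ by `m * d`,
where `d` is the distance of `i` and `j`. Hence the modulus for `i` divides `n * (m * d)` and so `n
* d`; since `d` divides `m`, it divides `n * m` and finally `n`. -/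
lemma dvd_of_dvd_mul_other {k m n i j : M} (hm : ∀ d, d < k + 1 → 0 < d → d ∣ m)
    (hi : i < k) (hj : j < k) (hij : i ≠ j)
    (h : m * (i + 1) + 1 ∣ n * (m * (j + 1) + 1)) : m * (i + 1) + 1 ∣ n := by
  have key : ∀ d, 0 < d → d < k + 1 → m * (i + 1) + 1 ∣ n * (m * d) → m * (i + 1) + 1 ∣ n := by
    intro d hd hdk hdvd
    have h1 : m * (i + 1) + 1 ∣ n * d := dvd_of_dvd_mul_modulus (by convert hdvd using 1; ring)
    obtain ⟨e, he⟩ := hm d hdk hd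
    refine dvd_of_dvd_mul_modulus ?_
    have := h1.mul_right e
    have h2 : m * n = n * d * e := by rw [he]; ring
    rwa [h2]
  rcases lt_or_gt_of_ne hij with hlt | hlt
  · obtain ⟨d, rfl⟩ := exists_add_of_le hlt.le
    refine key d (by simpa using hlt) (lt_succ_iff.2 (le_add_self.trans hj.le)) ?_
    refine dvd_of_dvd_add (a := n * (m * (i + 1) + 1)) ?_ (dvd_mul_left _ _)
    convert h using 1
    ring
  · obtain ⟨d, rfl⟩ := exists_add_of_le hlt.le
    refine key d (by simpa using hlt) (lt_succ_iff.2 (le_add_self.trans hi.le)) ?_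
    refine dvd_of_dvd_add (a := n * (m * (j + 1) + 1)) ?_ h
    exact ⟨n, by ring⟩

/-- `i` belongs to the finite set with code `s`. -/
def FMem (i s : M) : Prop :=
  ∃ k q, s = pair k q ∧ i < k ∧ ∃ m n, q = pair m n ∧ m * (i + 1) + 1 ∣ n

lemma FMem.lt {i s : M} (h : FMem i s) : i < s := by
  obtain ⟨k, q, rfl, hi, -⟩ := h
  exact hi.trans_le (left_le_pair _ _)

@[fun_prop]
lemma Comp.fMem {f g : α → M} (hf : Comp M f) (hg : Comp M g) :
    Comp M (fun a => FMem (f a) (g a)) := by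
  refine Comp.exists_of_le (f := g) hg ?_ ?_
  · refine Comp.exists_of_le (f := fun z => g z.1) (by fun_prop) ?_ ?_
    · refine Comp.and (by fun_prop) (Comp.and (by fun_prop) ?_)
      refine Comp.exists_of_le (f := fun z => z.2) (by fun_prop) ?_ ?_
      · refine Comp.exists_of_le (f := fun z => z.1.2) (by fun_prop) (by fun_prop) ?_
        rintro a i ⟨h, -⟩
        rw [h]; exact right_le_pair _ _
      · rintro a i ⟨b, h, -⟩
        rw [h]; exact left_le_pair _ _
    · rintro a i ⟨h, -⟩
      rw [h]; exact right_le_pair _ _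
  · rintro a i ⟨b, h, -⟩
    rw [h]; exact left_le_pair _ _

/-- The number `n` is the product of the moduli `m * (i + 1) + 1` for `i < k` in `A`, produced one
factor at a time by `Σ⁰₁` induction. Positivity of `m` ensures that no modulus divides the empty
product `1`. -/
lemma exists_code {A : Set M} (hA : A ∈ sets) (k : M) : ∃ s, ∀ i, FMem i s ↔ i < k ∧ i ∈ A := by
  obtain ⟨m, hm0, hm⟩ := exists_common_multiple k
  have key : ∀ k', ∃ n, ∀ i, i < k → (m * (i + 1) + 1 ∣ n ↔ i < k' ∧ i ∈ A) := by
    have hc := comp_mem_iff.2 hA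
    intro k'
    refine sigma_induction
      (p := fun k' n => ∀ i, i < k → (m * (i + 1) + 1 ∣ n ↔ i < k' ∧ i ∈ A)) ?_ ?_ ?_ k'
    · refine Comp.forall_lt (f := fun _ : M × M => k)
        (p := fun (z : M × M) i => m * (i + 1) + 1 ∣ z.2 ↔ i < z.1 ∧ i ∈ A) (by fun_prop) ?_
      have : Comp M fun z : (M × M) × M => z.2 ∈ A := hc.comp (by fun_prop)
      fun_prop
    · refine ⟨1, fun i _ => ⟨fun h => ?_, fun h => absurd h.1 (not_lt.2 zero_le)⟩⟩
      obtain ⟨c, hc⟩ := h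
      exfalso
      have hc0 : c ≠ 0 := by
        rintro rfl
        simp at hc
      have h1 : m * (i + 1) + 1 ≤ 1 :=
        (le_mul_of_one_le_right' (by simpa using succ_le_iff.2 (pos_iff_ne_zero.2 hc0))).trans_eq
          hc.symm
      have h2 : 1 < m * (i + 1) + 1 := lt_add_of_pos_left _ (by positivity)
      exact absurd h1 (not_le.2 h2)
    · rintro k' ⟨n, hn⟩
      by_cases hk : k' < k ∧ k' ∈ A
      · refine ⟨n * (m * (k' + 1) + 1), fun i hi => ?_⟩
        rcases eq_or_ne i k' with rfl | hne
        · simp [hk.2]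
        · rw [lt_succ_iff, le_iff_lt_or_eq, or_iff_left hne, ← hn i hi]
          exact ⟨dvd_of_dvd_mul_other hm hi hk.1 hne, fun h => h.mul_right _⟩
      · refine ⟨n, fun i hi => ?_⟩
        rw [hn i hi]
        constructor
        · rintro ⟨h, h'⟩
          exact ⟨lt_succ_iff.2 h.le, h'⟩
        · rintro ⟨h, h'⟩
          refine ⟨lt_of_le_of_ne (lt_succ_iff.1 h) ?_, h'⟩
          rintro rfl
          exact hk ⟨hi, h'⟩
  obtain ⟨n, hn⟩ := key k
  refine ⟨pair k (pair m n), fun i => ?_⟩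
  constructor
  · rintro ⟨k', q, h, hi, m', n', rfl, hd⟩
    simp only [pair_inj] at h
    obtain ⟨rfl, rfl, rfl⟩ := h
    exact (hn i hi).1 hd
  · rintro ⟨hi, hA⟩
    exact ⟨k, _, rfl, hi, m, n, rfl, (hn i hi).2 ⟨hi, hA⟩⟩

/-! ### Finite sequences -/

/-- A finite sequence is a finite set of pairs of index and value; an index without value gets `0`.
Elements of a finite set are smaller than its code, which bounds the search. -/
lemma exists_app : ∃ app : M × M → M, Comp M app ∧
    ∀ z, FMem (pair z.2 (app z)) z.1 ∨ (app z = 0 ∧ ∀ y, y < z.1 → ¬ FMem (pair z.2 y) z.1) := by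
  refine Comp.exists_fun (p := fun (z : M × M) y => FMem (pair z.2 y) z.1 ∨
    (y = 0 ∧ ∀ y, y < z.1 → ¬ FMem (pair z.2 y) z.1)) ?_ ?_
  · refine Comp.or (by fun_prop) (Comp.and (by fun_prop) ?_)
    exact Comp.forall_lt (f := fun z : (M × M) × M => z.1.1)
      (p := fun z y => ¬ FMem (pair z.1.2 y) z.1.1) (by fun_prop) (by fun_prop)
  · intro z
    by_cases h : ∃ y, FMem (pair z.2 y) z.1
    · obtain ⟨y, hy⟩ := h
      exact ⟨y, Or.inl hy⟩
    · push Not at h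
      exact ⟨0, Or.inr ⟨rfl, fun y _ => h y⟩⟩

/-- The `i`-th value of the finite sequence with code `s`. -/
noncomputable def app (s i : M) : M := Classical.choose (exists_app (M := M)) (s, i)

lemma app_spec (s i : M) :
    FMem (pair i (app s i)) s ∨ (app s i = 0 ∧ ∀ y, y < s → ¬ FMem (pair i y) s) :=
  (Classical.choose_spec (exists_app (M := M))).2 (s, i)

@[fun_prop]
lemma Comp.app {f g : α → M} (hf : Comp M f) (hg : Comp M g) :
    Comp M (fun a => SecondOrder.app (f a) (g a)) :=
  (Classical.choose_spec (exists_app (M := M))).1.comp (hf.prodMk hg)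

lemma app_le (s i : M) : app s i ≤ s := by
  rcases app_spec s i with h | h
  · exact (right_le_pair _ _).trans h.lt.le
  · rw [h.1]; exact zero_le

lemma app_eq {s i y : M} (h : ∀ y', FMem (pair i y') s ↔ y' = y) : app s i = y := by
  rcases app_spec s i with h' | h'
  · exact (h _).1 h'
  · have hy := (h y).2 rfl
    exact absurd hy (h'.2 y ((right_le_pair _ _).trans_lt hy.lt))

lemma exists_extension (s n y : M) : ∃ s', (∀ i, i < n → app s' i = app s i) ∧ app s' n = y := by
  have hA : Comp M fun z : M × M => (z.1 < n ∧ z.2 = app s z.1) ∨ (z.1 = n ∧ z.2 = y) := by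
    fun_prop
  rw [comp_prop_iff] at hA
  -- All pairs of the new graph have component sum below `n + 1 + (s + y)`, because values of `s`
  -- are at most `s`; so the bound loses none of them.
  obtain ⟨s', hs'⟩ := exists_code hA (pair (n + 1) (s + y))
  have key : ∀ i z, FMem (pair i z) s' ↔ (i < n ∧ z = app s i) ∨ (i = n ∧ z = y) := by
    intro i z
    rw [hs', Set.mem_ofPred_eq]
    constructor
    · rintro ⟨-, ⟨i', z'⟩, h, h'⟩
      obtain ⟨rfl, rfl⟩ := pair_inj.1 h
      exact h'
    · refine fun h => ⟨pair_lt_pair_of_add_lt ?_, (i, z), rfl, h⟩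
      rcases h with ⟨h, rfl⟩ | ⟨rfl, rfl⟩
      · exact add_lt_add_of_lt_of_le (h.trans (lt_succ_iff.2 le_rfl))
          ((app_le s i).trans le_self_add)
      · exact add_lt_add_of_lt_of_le (lt_succ_iff.2 le_rfl) le_add_self
  refine ⟨s', fun i hi => app_eq fun z => ?_, app_eq fun z => ?_⟩
  · simp [key, hi, hi.ne]
  · simp [key]

lemma exists_extend : ∃ e : M × M × M → M, Comp M e ∧
    ∀ z, (∀ i, i < z.2.1 → app (e z) i = app z.1 i) ∧ app (e z) z.2.1 = z.2.2 := by
  refine Comp.exists_fun (p := fun (z : M × M × M) s' => (∀ i, i < z.2.1 → app s' i = app z.1 i) ∧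
    app s' z.2.1 = z.2.2) ?_ fun z => exists_extension _ _ _
  refine Comp.and ?_ (by fun_prop)
  exact Comp.forall_lt (f := fun z : (M × M × M) × M => z.1.2.1)
    (p := fun z i => app z.2 i = app z.1.1 i) (by fun_prop) (by fun_prop)

/-! ### Recursion -/

/-- Codes of computations of length `n` exist by `Σ⁰₁` induction and are selected by minimization.
The codes selected for `n` and `n + 1` are unrelated as numbers, so an induction is needed to see
that they have the same values up to `n`. -/
theorem primitive_recursion {g : M × M → M} (hg : Comp M g) (a : M) :
    ∃ h : M → M, Comp M h ∧ h 0 = a ∧ ∀ n, h (n + 1) = g (n, h n) := by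
  have hc : Comp M fun z : M × M =>
      app z.2 0 = a ∧ ∀ i, i < z.1 → app z.2 (i + 1) = g (i, app z.2 i) :=
    Comp.and (by fun_prop) (Comp.forall_lt (f := fun z : M × M => z.1)
      (p := fun z i => app z.2 (i + 1) = g (i, app z.2 i)) (by fun_prop) (by fun_prop))
  have hex : ∀ n, ∃ s, app s 0 = a ∧ ∀ i, i < n → app s (i + 1) = g (i, app s i) := by
    intro n
    refine sigma_induction
      (p := fun n s => app s 0 = a ∧ ∀ i, i < n → app s (i + 1) = g (i, app s i)) hc ?_ ?_ n
    · obtain ⟨s, -, hs⟩ := exists_extension 0 0 a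
      exact ⟨s, hs, fun i hi => absurd hi (not_lt.2 zero_le)⟩
    · rintro n ⟨s, h0, hs⟩
      obtain ⟨s', h1, h2⟩ := exists_extension s (n + 1) (g (n, app s n))
      refine ⟨s', by rw [h1 0 (by positivity), h0], fun i hi => ?_⟩
      rw [h1 i hi]
      rcases (lt_succ_iff.1 hi).lt_or_eq with hi' | rfl
      · rw [h1 _ (by gcongr), hs i hi']
      · exact h2
  obtain ⟨σ, hσ, hσ'⟩ := Comp.exists_fun
    (p := fun n s => app s 0 = a ∧ ∀ i, i < n → app s (i + 1) = g (i, app s i)) hc hex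
  refine ⟨fun n => app (σ n) n, by fun_prop, (hσ' 0).1, fun n => ?_⟩
  have agree : ∀ i, i ≤ n → app (σ (n + 1)) i = app (σ n) i := by
    intro i
    refine simple_induction (p := fun i => i ≤ n → app (σ (n + 1)) i = app (σ n) i) (by fun_prop)
      ?_ ?_ i
    · intro _
      rw [(hσ' _).1, (hσ' _).1]
    · intro i ih hi
      have hi' := succ_le_iff.1 hi
      rw [(hσ' n).2 i hi', (hσ' (n + 1)).2 i (hi'.trans (lt_succ_iff.2 le_rfl)), ih hi'.le]
  dsimp only
  rw [(hσ' (n + 1)).2 n (lt_succ_iff.2 le_rfl), agree n le_rfl]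

/-- Course-of-values recursion: `g (n, s)` is the value at `n` when `s` codes the previous
values. -/
theorem course_of_values_recursion {g : M × M → M} (hg : Comp M g) :
    ∃ h : M → M, Comp M h ∧ ∀ n, ∃ s, h n = g (n, s) ∧ ∀ i, i < n → app s i = h i := by
  obtain ⟨e, he, he'⟩ := exists_extend (M := M)
  -- Here `t n` codes the sequence of the first `n` values, and each step appends the value that `g`
  -- computes from it.
  obtain ⟨t, ht, -, ht'⟩ := primitive_recursion (g := fun z => e (z.2, z.1, g z)) (by fun_prop) 0
  refine ⟨fun n => g (n, t n), by fun_prop, fun n => ⟨t n, rfl, ?_⟩⟩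
  refine simple_induction (p := fun n => ∀ i, i < n → app (t n) i = g (i, t i)) ?_ ?_ ?_ n
  · exact Comp.forall_lt (f := fun n => n) (p := fun n i => app (t n) i = g (i, t i))
      (by fun_prop) (by fun_prop)
  · exact fun i hi => absurd hi (not_lt.2 zero_le)
  · intro n ih i hi
    rw [ht']
    rcases (lt_succ_iff.1 hi).lt_or_eq with hi | rfl
    · rw [(he' _).1 i hi, ih i hi]
    · exact (he' _).2

/-! ### Decoding -/

open Classical in
/-- The element of `α` with code `n`, if there is one. -/
noncomputable def dec (α : Type*) [Coded M α] [Nonempty α] (n : M) : α :=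
  if h : ∃ a : α, enc a = n then h.choose else Classical.arbitrary α

@[simp]
lemma dec_enc [Nonempty α] (a : α) : dec α (enc a : M) = a := by
  have h : ∃ b : α, (enc b : M) = enc a := ⟨a, rfl⟩
  rw [dec, dif_pos h]
  exact enc_injective h.choose_spec

lemma comp_dec [Nonempty α] : Comp M (fun n : M => dec α n) := by
  rw [comp_iff_graph]
  have hr := comp_mem_iff.2 (range_mem (M := M) (α := α))
  have : Comp M fun z : M × α =>
      z.1 = enc z.2 ∨ (¬ z.1 ∈ Set.range (enc (M := M) (α := α)) ∧ z.2 = Classical.arbitrary α) :=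
    Comp.or (by fun_prop) (Comp.and (hr.comp (by fun_prop)).not (by fun_prop))
  refine this.of_iff ?_
  rintro ⟨n, a⟩
  by_cases h : ∃ b : α, enc b = n
  · obtain ⟨b, rfl⟩ := h
    simp [enc_eq_iff, eq_comm]
  · have h' : n ∉ Set.range (enc (M := M) (α := α)) := h
    have h'' : n ≠ enc a := fun e => h ⟨a, e.symm⟩
    have hd : dec α n = Classical.arbitrary α := dif_neg h
    simp [hd, h', h'', eq_comm]

@[fun_prop]
lemma Comp.dec [Nonempty β] {f : α → M} (hf : Comp M f) :
    Comp M (fun a => SecondOrder.dec β (f a)) :=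
  comp_dec.comp hf

/-- The value at `a` of the finite function `α → β` with code `c`. -/
noncomputable def look (β : Type*) [Coded M β] [Nonempty β] (c : M) (a : α) : β :=
  dec β (app c (enc a))

@[fun_prop]
lemma Comp.look [Nonempty β] {f : γ → M} {g : γ → α} (hf : Comp M f) (hg : Comp M g) :
    Comp M (fun a => SecondOrder.look β (f a) (g a)) := by
  unfold SecondOrder.look
  fun_prop

/-- Course-of-values recursion along the codes of the elements of `α`. -/
theorem coded_recursion [Nonempty α] [Nonempty β] {g : α → M → β}
    (hg : Comp M fun z : α × M => g z.1 z.2) :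
    ∃ h : α → β, Comp M h ∧
      ∀ a, ∃ c : M, h a = g a c ∧ ∀ b, (enc b : M) < enc a → look β c b = h b := by
  obtain ⟨H, hH, hH'⟩ := course_of_values_recursion (M := M)
    (g := fun z => enc (g (dec α z.1) z.2)) (by fun_prop)
  refine ⟨fun a => dec β (H (enc a)), by fun_prop, fun a => ?_⟩
  obtain ⟨s, h1, h2⟩ := hH' (enc a)
  refine ⟨s, by simp [h1], fun b hb => ?_⟩
  rw [look, h2 _ hb]

/-! ### Projections -/

/-- The first component of a pair. -/
noncomputable def fstN (n : M) : M := (dec (M × M) n).1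

/-- The second component of a pair. -/
noncomputable def sndN (n : M) : M := (dec (M × M) n).2

@[simp] lemma fstN_pair (a b : M) : fstN (pair a b) = a := by
  have : dec (M × M) (pair a b) = (a, b) := dec_enc (M := M) (a, b)
  rw [fstN, this]

@[simp] lemma sndN_pair (a b : M) : sndN (pair a b) = b := by
  have : dec (M × M) (pair a b) = (a, b) := dec_enc (M := M) (a, b)
  rw [sndN, this]

@[fun_prop]
lemma Comp.fstN {f : α → M} (hf : Comp M f) : Comp M (fun a => SecondOrder.fstN (f a)) := by
  unfold SecondOrder.fstN
  fun_prop

@[fun_prop]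
lemma Comp.sndN {f : α → M} (hf : Comp M f) : Comp M (fun a => SecondOrder.sndN (f a)) := by
  unfold SecondOrder.sndN
  fun_prop

end Sequences

end SecondOrder

namespace SecondOrder

open Model Coded

set_option linter.unusedSectionVars false

/-! ### Codes of terms -/

section Terms

variable {M : Type*} [CommSemiring M] [LinearOrder M] [IsStrictOrderedRing M] [Model M]
  {α : Type*} [Coded M α]

/-- Apart from `0`, terms carry a positive tag, so a term has a larger code than its subterms. This
justifies recursion and induction along codes of terms. -/
lemma right_lt_pair {c : M} (hc : 0 < c) (q : M) : q < pair c q :=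
  ((lt_add_of_pos_left q hc).trans_le (le_mul_self_of_model (c + q))).trans_le le_self_add

lemma zero_ne_two : (0 : M) ≠ 1 + 1 := ne_of_lt (by positivity)

lemma zero_ne_three : (0 : M) ≠ 1 + 1 + 1 := ne_of_lt (by positivity)

@[simp] lemma gammaT_inj {x y : M} : gammaT x = gammaT y ↔ x = y := by simp [gammaT, pair_inj]

@[simp] lemma phiT_inj {a b c d : M} : phiT a b = phiT c d ↔ a = c ∧ b = d := by
  simp [phiT, pair_inj]

@[simp] lemma sumT_inj {a b c d : M} : sumT a b = sumT c d ↔ a = c ∧ b = d := by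
  simp [sumT, pair_inj]

@[simp] lemma zeroT_ne_gammaT (x : M) : zeroT ≠ gammaT x := by simp [zeroT, gammaT, pair_inj]

@[simp] lemma zeroT_ne_phiT (a b : M) : zeroT ≠ phiT a b := by
  simp [zeroT, phiT, pair_inj, zero_ne_two]

@[simp] lemma zeroT_ne_sumT (a b : M) : zeroT ≠ sumT a b := by
  simp [zeroT, sumT, pair_inj, zero_ne_three]

@[simp] lemma gammaT_ne_zeroT (x : M) : gammaT x ≠ zeroT := (zeroT_ne_gammaT x).symm

@[simp] lemma phiT_ne_zeroT (a b : M) : phiT a b ≠ zeroT := (zeroT_ne_phiT a b).symm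

@[simp] lemma sumT_ne_zeroT (a b : M) : sumT a b ≠ zeroT := (zeroT_ne_sumT a b).symm

@[simp] lemma gammaT_ne_phiT (x a b : M) : gammaT x ≠ phiT a b := by
  simp [gammaT, phiT, pair_inj]

@[simp] lemma phiT_ne_gammaT (x a b : M) : phiT a b ≠ gammaT x := (gammaT_ne_phiT x a b).symm

@[simp] lemma gammaT_ne_sumT (x a b : M) : gammaT x ≠ sumT a b := by
  simp [gammaT, sumT, pair_inj]

@[simp] lemma sumT_ne_gammaT (x a b : M) : sumT a b ≠ gammaT x := (gammaT_ne_sumT x a b).symm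

@[simp] lemma phiT_ne_sumT (a b c d : M) : phiT a b ≠ sumT c d := by
  simp [phiT, sumT, pair_inj]

@[simp] lemma sumT_ne_phiT (a b c d : M) : sumT c d ≠ phiT a b := (phiT_ne_sumT a b c d).symm

lemma left_lt_phiT (a b : M) : a < phiT a b :=
  (left_le_pair a b).trans_lt (right_lt_pair (by positivity) _)

lemma right_lt_phiT (a b : M) : b < phiT a b :=
  (right_le_pair a b).trans_lt (right_lt_pair (by positivity) _)

lemma left_lt_sumT (a b : M) : a < sumT a b :=
  (left_le_pair a b).trans_lt (right_lt_pair (by positivity) _)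

lemma right_lt_sumT (a b : M) : b < sumT a b :=
  (right_le_pair a b).trans_lt (right_lt_pair (by positivity) _)

@[simp] lemma isPrincipal_gammaT (x : M) : IsPrincipal (gammaT x) := .gamma x

@[simp] lemma isPrincipal_phiT (a b : M) : IsPrincipal (phiT a b) := .phi a b

@[simp] lemma not_isPrincipal_zeroT : ¬ IsPrincipal (zeroT : M) := by
  intro h
  generalize hz : (zeroT : M) = z at h
  cases h <;> simp at hz

@[simp] lemma not_isPrincipal_sumT (a b : M) : ¬ IsPrincipal (sumT a b) := by
  intro h
  generalize hz : sumT a b = z at h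
  cases h <;> simp at hz

/-- The argument `x` of a term `Γ_x`. -/
noncomputable def argT (s : M) : M := sndN s

/-- The first argument of a term `φ_a b` or `a + b`. -/
noncomputable def leftT (s : M) : M := fstN (sndN s)

/-- The second argument of a term `φ_a b` or `a + b`. -/
noncomputable def rightT (s : M) : M := sndN (sndN s)

@[simp] lemma argT_gammaT (x : M) : argT (gammaT x) = x := by simp [argT, gammaT]

@[simp] lemma leftT_phiT (a b : M) : leftT (phiT a b) = a := by simp [leftT, phiT]

@[simp] lemma rightT_phiT (a b : M) : rightT (phiT a b) = b := by simp [rightT, phiT]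

@[simp] lemma leftT_sumT (a b : M) : leftT (sumT a b) = a := by simp [leftT, sumT]

@[simp] lemma rightT_sumT (a b : M) : rightT (sumT a b) = b := by simp [rightT, sumT]

@[fun_prop]
lemma Comp.argT {f : α → M} (hf : Comp M f) : Comp M (fun a => SecondOrder.argT (f a)) := by
  unfold SecondOrder.argT
  fun_prop

@[fun_prop]
lemma Comp.leftT {f : α → M} (hf : Comp M f) : Comp M (fun a => SecondOrder.leftT (f a)) := by
  unfold SecondOrder.leftT
  fun_prop

@[fun_prop]
lemma Comp.rightT {f : α → M} (hf : Comp M f) : Comp M (fun a => SecondOrder.rightT (f a)) := by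
  unfold SecondOrder.rightT
  fun_prop

@[fun_prop]
lemma Comp.gammaT {f : α → M} (hf : Comp M f) : Comp M (fun a => SecondOrder.gammaT (f a)) := by
  unfold SecondOrder.gammaT
  fun_prop

@[fun_prop]
lemma Comp.phiT {f g : α → M} (hf : Comp M f) (hg : Comp M g) :
    Comp M (fun a => SecondOrder.phiT (f a) (g a)) := by
  unfold SecondOrder.phiT
  fun_prop

@[fun_prop]
lemma Comp.sumT {f g : α → M} (hf : Comp M f) (hg : Comp M g) :
    Comp M (fun a => SecondOrder.sumT (f a) (g a)) := by
  unfold SecondOrder.sumT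
  fun_prop

/-- `s` has the form `Γ_x`. -/
def IsGam (s : M) : Prop := s = gammaT (argT s)

/-- `s` has the form `φ_a b`. -/
def IsPhi (s : M) : Prop := s = phiT (leftT s) (rightT s)

/-- `s` has the form `a + b`. -/
def IsSum (s : M) : Prop := s = sumT (leftT s) (rightT s)

@[fun_prop]
lemma Comp.isGam {f : α → M} (hf : Comp M f) : Comp M (fun a => IsGam (f a)) := by
  unfold IsGam
  fun_prop

@[fun_prop]
lemma Comp.isPhi {f : α → M} (hf : Comp M f) : Comp M (fun a => IsPhi (f a)) := by
  unfold IsPhi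
  fun_prop

@[fun_prop]
lemma Comp.isSum {f : α → M} (hf : Comp M f) : Comp M (fun a => IsSum (f a)) := by
  unfold IsSum
  fun_prop

@[simp] lemma isGam_gammaT (x : M) : IsGam (gammaT x) := by simp [IsGam]
@[simp] lemma isPhi_phiT (a b : M) : IsPhi (phiT a b) := by simp [IsPhi]
@[simp] lemma isSum_sumT (a b : M) : IsSum (sumT a b) := by simp [IsSum]
@[simp] lemma not_isGam_zeroT : ¬ IsGam (zeroT : M) := by simp [IsGam]
@[simp] lemma not_isGam_phiT (a b : M) : ¬ IsGam (phiT a b) := by simp [IsGam]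
@[simp] lemma not_isGam_sumT (a b : M) : ¬ IsGam (sumT a b) := by simp [IsGam]
@[simp] lemma not_isPhi_zeroT : ¬ IsPhi (zeroT : M) := by simp [IsPhi]
@[simp] lemma not_isPhi_gammaT (x : M) : ¬ IsPhi (gammaT x) := by simp [IsPhi]
@[simp] lemma not_isPhi_sumT (a b : M) : ¬ IsPhi (sumT a b) := by simp [IsPhi]
@[simp] lemma not_isSum_zeroT : ¬ IsSum (zeroT : M) := by simp [IsSum]
@[simp] lemma not_isSum_gammaT (x : M) : ¬ IsSum (gammaT x) := by simp [IsSum]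
@[simp] lemma not_isSum_phiT (a b : M) : ¬ IsSum (phiT a b) := by simp [IsSum]

lemma isPrincipal_iff {s : M} : IsPrincipal s ↔ IsGam s ∨ IsPhi s := by
  constructor
  · rintro (x | ⟨a, b⟩) <;> simp
  · rintro (h | h) <;> rw [h] <;> simp

@[fun_prop]
lemma Comp.isPrincipal {f : α → M} (hf : Comp M f) : Comp M (fun a => IsPrincipal (f a)) := by
  simp only [isPrincipal_iff]
  fun_prop

open Classical in
/-- The first summand of a term. -/
noncomputable def headT (s : M) : M := if IsSum s then leftT s else s

@[simp] lemma headT_sumT (a b : M) : headT (sumT a b) = a := by simp [headT]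
@[simp] lemma headT_gammaT (x : M) : headT (gammaT x) = gammaT x := by simp [headT]
@[simp] lemma headT_phiT (a b : M) : headT (phiT a b) = phiT a b := by simp [headT]
@[simp] lemma headT_zeroT : headT (zeroT : M) = zeroT := by simp [headT]

@[fun_prop]
lemma Comp.headT {f : α → M} (hf : Comp M f) : Comp M (fun a => SecondOrder.headT (f a)) := by
  unfold SecondOrder.headT
  fun_prop

lemma isHead_iff {s c : M} : IsHead s c ↔ (IsPrincipal s ∨ IsSum s) ∧ c = headT s := by
  constructor
  · rintro (⟨_, h⟩ | ⟨a, b⟩)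
    · rcases h with x | ⟨a, b⟩ <;> simp
    · simp
  · rintro ⟨h | h, rfl⟩
    · rcases h with x | ⟨a, b⟩
      · rw [headT_gammaT]; exact .principal _ (.gamma x)
      · rw [headT_phiT]; exact .principal _ (.phi a b)
    · rw [h, headT_sumT]; exact .sum _ _

open Classical in
/-- The function `h`. -/
noncomputable def hT (s : M) : M := if IsGam s then s else if IsPhi s then leftT s else zeroT

@[simp] lemma hT_zeroT : hT (zeroT : M) = zeroT := by simp [hT]
@[simp] lemma hT_gammaT (x : M) : hT (gammaT x) = gammaT x := by simp [hT]
@[simp] lemma hT_phiT (a b : M) : hT (phiT a b) = a := by simp [hT]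
@[simp] lemma hT_sumT (a b : M) : hT (sumT a b) = zeroT := by simp [hT]

@[fun_prop]
lemma Comp.hT {f : α → M} (hf : Comp M f) : Comp M (fun a => SecondOrder.hT (f a)) := by
  unfold SecondOrder.hT
  fun_prop

lemma hasH_iff {s r : M} :
    HasH s r ↔ (s = zeroT ∨ IsGam s ∨ IsPhi s ∨ IsSum s) ∧ r = hT s := by
  constructor
  · rintro (_ | ⟨x⟩ | ⟨a, b⟩ | ⟨a, b⟩) <;> simp
  · rintro ⟨rfl | h | h | h, rfl⟩
    · rw [hT_zeroT]; exact .zero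
    · rw [h, hT_gammaT]; exact .gamma _
    · rw [h, hT_phiT]; exact .phi _ _
    · rw [h, hT_sumT]; exact .sum _ _

/-! ### The clauses for membership and order are decidable -/

/-- The inductive clause quantifies over constituents. Expressing these by projections leaves a
Boolean combination of decidable statements, so that its decidability is a matter of composition. -/
lemma termClause_iff {X G : NOrder M} {s : M} : TermClause X G s ↔
    s = zeroT ∨ (IsGam s ∧ argT s ∈ X.carrier) ∨
    (IsPhi s ∧ leftT s ∈ G.carrier ∧ rightT s ∈ G.carrier ∧
      ((rightT s = zeroT ∨ IsGam (rightT s) ∨ IsPhi (rightT s) ∨ IsSum (rightT s)) ∧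
        (hT (rightT s) = leftT s ∨ G.lt (hT (rightT s)) (leftT s))) ∧
      (IsGam (leftT s) → rightT s ≠ zeroT)) ∨
    (IsSum s ∧ leftT s ∈ G.carrier ∧ rightT s ∈ G.carrier ∧ IsPrincipal (leftT s) ∧
      (IsPrincipal (rightT s) ∨ IsSum (rightT s)) ∧
      (headT (rightT s) = leftT s ∨ G.lt (headT (rightT s)) (leftT s))) := by
  constructor
  · rintro (_ | ⟨x, hx⟩ | ⟨a, b, ha, hb, ⟨r, hr, hra⟩, h⟩ | ⟨a, b, ha, hb, hp, ⟨c, hc, hca⟩⟩)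
    · exact Or.inl rfl
    · exact Or.inr (Or.inl ⟨by simp, by simpa using hx⟩)
    · rw [hasH_iff] at hr
      obtain ⟨hr, rfl⟩ := hr
      refine Or.inr (Or.inr (Or.inl ?_))
      simp only [isPhi_phiT, leftT_phiT, rightT_phiT]
      exact ⟨trivial, ha, hb, ⟨hr, hra⟩, fun hg => h ⟨_, hg⟩⟩
    · rw [isHead_iff] at hc
      obtain ⟨hc, rfl⟩ := hc
      refine Or.inr (Or.inr (Or.inr ?_))
      simp only [isSum_sumT, leftT_sumT, rightT_sumT]
      exact ⟨trivial, ha, hb, hp, hc, hca⟩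
  · rintro (rfl | ⟨hs, hx⟩ | ⟨hs, ha, hb, ⟨hr, hra⟩, h⟩ | ⟨hs, ha, hb, hp, hc, hca⟩)
    · exact .zero
    · rw [hs]; exact .gamma _ hx
    · rw [hs]
      refine .phi _ _ ha hb ⟨_, hasH_iff.2 ⟨hr, rfl⟩, hra⟩ ?_
      rintro ⟨x, hx⟩
      exact h (by rw [hx]; simp)
    · rw [hs]
      exact .sum _ _ ha hb hp ⟨_, isHead_iff.2 ⟨hc, rfl⟩, hca⟩

lemma ltClause_iff {X G : NOrder M} {s t : M} : LtClause X G s t ↔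
    (s = zeroT ∧ t ≠ zeroT) ∨ (IsGam s ∧ IsGam t ∧ X.lt (argT s) (argT t)) ∨
    (IsGam s ∧ IsPhi t ∧ ((s = leftT t ∨ G.lt s (leftT t)) ∨ (s = rightT t ∨ G.lt s (rightT t)))) ∨
    (IsPhi s ∧ IsGam t ∧ G.lt (leftT s) t ∧ G.lt (rightT s) t) ∨
    (IsPhi s ∧ IsPhi t ∧ ((G.lt (leftT s) (leftT t) ∧ G.lt (rightT s) t) ∨
      (leftT s = leftT t ∧ G.lt (rightT s) (rightT t)) ∨
      (G.lt (leftT t) (leftT s) ∧ G.lt s (rightT t)))) ∨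
    (IsPrincipal s ∧ IsSum t ∧ (s = leftT t ∨ G.lt s (leftT t))) ∨
    (IsSum s ∧ IsPrincipal t ∧ G.lt (leftT s) t) ∨
    (IsSum s ∧ IsSum t ∧ (G.lt (leftT s) (leftT t) ∨
      (leftT s = leftT t ∧ G.lt (rightT s) (rightT t)))) := by
  constructor
  · rintro (⟨_, h⟩ | ⟨x, y, h⟩ | ⟨x, a, b, h⟩ | ⟨a, b, x, h, h'⟩ | ⟨a, b, c, d, h⟩ |
      ⟨_, a, b, hp, h⟩ | ⟨a, b, _, hp, h⟩ | ⟨a, b, c, d, h⟩)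
    · exact Or.inl ⟨rfl, h⟩
    · simp [h]
    · simp only [NOrder.le] at h
      simp [h]
    · simp [h, h']
    · simp [h]
    · simp only [NOrder.le] at h
      simp [hp, h]
    · simp [hp, h]
    · simp [h]
  · rintro (⟨rfl, h⟩ | ⟨hs, ht, h⟩ | ⟨hs, ht, h⟩ | ⟨hs, ht, h, h'⟩ | ⟨hs, ht, h⟩ | ⟨hs, ht, h⟩ |
      ⟨hs, ht, h⟩ | ⟨hs, ht, h⟩)
    · exact .zero _ h
    · rw [hs, ht]; exact .gamma_gamma _ _ h
    · rw [hs] at h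
      rw [hs, ht]; exact .gamma_phi _ _ _ h
    · rw [ht] at h h'
      rw [hs, ht]; exact .phi_gamma _ _ _ h h'
    · rw [IsPhi] at hs ht
      rw [hs, ht]
      refine .phi_phi _ _ _ _ ?_
      rwa [← hs, ← ht]
    · rw [ht]; exact .principal_sum _ _ _ hs h
    · rw [hs]; exact .sum_principal _ _ _ ht h
    · rw [hs, ht]; exact .sum_sum _ _ _ _ h

/-- The system `Q a` may vary with `a`: in the recursion its role is played by the finite part of
`Γ_X` that is stored in a code of previous values. -/
lemma Comp.termClause {X : NOrder M} (hX : X.carrier ∈ sets) {Q : α → NOrder M} {s : α → M}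
    (hQ : Comp M fun z : α × M => z.2 ∈ (Q z.1).carrier)
    (hQ' : Comp M fun z : α × M × M => (Q z.1).lt z.2.1 z.2.2) (hs : Comp M s) :
    Comp M (fun a => TermClause X (Q a) (s a)) := by
  have h1 : ∀ {f : α → M}, Comp M f → Comp M fun a => f a ∈ (Q a).carrier := fun {f} hf =>
    hQ.comp (f := fun a => (a, f a)) (by fun_prop)
  have h2 : ∀ {f g : α → M}, Comp M f → Comp M g → Comp M fun a => (Q a).lt (f a) (g a) :=
    fun {f g} hf hg => hQ'.comp (f := fun a => (a, f a, g a)) (by fun_prop)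
  have h3 : ∀ {f : α → M}, Comp M f → Comp M fun a => f a ∈ X.carrier := Comp.mem hX
  have e1 := h1 hs.leftT
  have e2 := h1 hs.rightT
  have e3 := h3 hs.argT
  have e4 := h2 hs.rightT.hT hs.leftT
  have e5 := h2 hs.rightT.headT hs.leftT
  simp only [termClause_iff]
  fun_prop

lemma Comp.ltClause {X : NOrder M} (hX : Comp M fun z : M × M => X.lt z.1 z.2) {Q : α → NOrder M}
    {s t : α → M} (hQ : Comp M fun z : α × M × M => (Q z.1).lt z.2.1 z.2.2)
    (hs : Comp M s) (ht : Comp M t) : Comp M (fun a => LtClause X (Q a) (s a) (t a)) := by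
  have h2 : ∀ {f g : α → M}, Comp M f → Comp M g → Comp M fun a => (Q a).lt (f a) (g a) :=
    fun {f g} hf hg => hQ.comp (f := fun a => (a, f a, g a)) (by fun_prop)
  have e1 : Comp M fun a => X.lt (SecondOrder.argT (s a)) (SecondOrder.argT (t a)) :=
    hX.comp (hs.argT.prodMk ht.argT)
  have e2 := h2 hs ht.leftT
  have e3 := h2 hs ht.rightT
  have e4 := h2 hs.leftT ht
  have e5 := h2 hs.rightT ht
  have e6 := h2 hs.leftT ht.leftT
  have e7 := h2 hs.rightT ht.rightT
  have e8 := h2 ht.leftT hs.leftT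
  simp only [ltClause_iff]
  fun_prop

/-! ### Existence and uniqueness of the notation system -/

lemma NOrder.IsInner.comp_lt {X : NOrder M} (hX : X.IsInner sets) :
    Comp M fun z : M × M => X.lt z.1 z.2 := by
  rw [comp_prop_iff]
  convert hX.lt_mem using 1
  ext z
  simp [enc_prod, enc_id]

/-- The order clauses depend monotonically on the order of smaller terms. -/
lemma LtClause.mono {X G G' : NOrder M} (D : Set M)
    (hphi : ∀ a b, phiT a b ∈ D → a ∈ D ∧ b ∈ D) (hsum : ∀ a b, sumT a b ∈ D → a ∈ D ∧ b ∈ D)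
    {s t : M} (hs : s ∈ D) (ht : t ∈ D)
    (h : ∀ a b, a ∈ D → b ∈ D → a + b < s + t → G.lt a b → G'.lt a b)
    (hst : LtClause X G s t) : LtClause X G' s t := by
  have hle : ∀ a b, a ∈ D → b ∈ D → a + b < s + t → G.le a b → G'.le a b := by
    rintro a b ha hb hab (rfl | h')
    · exact Or.inl rfl
    · exact Or.inr (h a b ha hb hab h')
  rcases hst with ⟨_, h'⟩ | ⟨x, y, h'⟩ | ⟨x, a, b, h'⟩ | ⟨a, b, x, h1, h2⟩ | ⟨a, b, c, d, h'⟩ |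
      ⟨_, a, b, hp, h'⟩ | ⟨a, b, _, hp, h'⟩ | ⟨a, b, c, d, h'⟩
  · exact .zero _ h'
  · exact .gamma_gamma _ _ h'
  · have := left_lt_phiT a b
    have := right_lt_phiT a b
    refine .gamma_phi _ _ _ (h'.imp (hle _ _ hs (hphi _ _ ht).1 ?_) (hle _ _ hs (hphi _ _ ht).2 ?_))
      <;> gcongr
  · have := left_lt_phiT a b
    have := right_lt_phiT a b
    refine .phi_gamma _ _ _ (h _ _ (hphi _ _ hs).1 ht ?_ h1) (h _ _ (hphi _ _ hs).2 ht ?_ h2)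
      <;> gcongr
  · have := left_lt_phiT a b
    have := right_lt_phiT a b
    have := left_lt_phiT c d
    have := right_lt_phiT c d
    obtain ⟨ha, hb⟩ := hphi _ _ hs
    obtain ⟨hc, hd⟩ := hphi _ _ ht
    refine .phi_phi _ _ _ _ ?_
    rcases h' with ⟨h1, h2⟩ | ⟨h1, h2⟩ | ⟨h1, h2⟩
    · exact Or.inl ⟨h _ _ ha hc (by gcongr) h1, h _ _ hb ht (by gcongr) h2⟩
    · exact Or.inr (Or.inl ⟨h1, h _ _ hb hd (by gcongr) h2⟩)
    · exact Or.inr (Or.inr ⟨h _ _ hc ha (by rw [add_comm c]; gcongr) h1,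
        h _ _ hs hd (by gcongr) h2⟩)
  · have := left_lt_sumT a b
    exact .principal_sum _ _ _ hp (hle _ _ hs (hsum _ _ ht).1 (by gcongr) h')
  · have := left_lt_sumT a b
    exact .sum_principal _ _ _ hp (h _ _ (hsum _ _ hs).1 ht (by gcongr) h')
  · have := left_lt_sumT a b
    have := right_lt_sumT a b
    have := left_lt_sumT c d
    have := right_lt_sumT c d
    obtain ⟨ha, hb⟩ := hsum _ _ hs
    obtain ⟨hc, hd⟩ := hsum _ _ ht
    refine .sum_sum _ _ _ _ ?_
    rcases h' with h1 | ⟨h1, h2⟩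
    · exact Or.inl (h _ _ ha hc (by gcongr) h1)
    · exact Or.inr ⟨h1, h _ _ hb hd (by gcongr) h2⟩

/-- The clauses for the order make sense for arbitrary numbers and lead from `s`, `t` to pairs with
a smaller sum. So the order can be defined before the set of terms, which removes the simultaneity
of the recursion. -/
lemma exists_rawLt {X : NOrder M} (hX : X.IsInner sets) : ∃ R : M → M → Prop,
    Comp M (fun z : M × M => R z.1 z.2) ∧ ∀ s t, R s t ↔ LtClause X ⟨Set.univ, R⟩ s t := by
  obtain ⟨H, hH, hH'⟩ := coded_recursion (M := M) (α := M × M) (β := Prop)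
    (g := fun z c => LtClause X ⟨Set.univ, fun a b => look Prop c (a, b)⟩ z.1 z.2)
    (Comp.ltClause hX.comp_lt (by fun_prop) (by fun_prop) (by fun_prop))
  refine ⟨fun a b => H (a, b), by fun_prop, fun s t => ?_⟩
  obtain ⟨c, h1, h2⟩ := hH' (s, t)
  have h2' : ∀ a b, a + b < s + t → look Prop c (a, b) = H (a, b) := fun a b hab =>
    h2 (a, b) (pair_lt_pair_of_add_lt hab)
  change H (s, t) ↔ _
  rw [h1]
  constructor <;>
    refine LtClause.mono Set.univ (by simp) (by simp) (Set.mem_univ _) (Set.mem_univ _) ?_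
  · intro a b _ _ hab h
    exact (h2' a b hab).mp h
  · intro a b _ _ hab h
    exact (h2' a b hab).mpr h

/-- The membership clauses depend monotonically on smaller terms. -/
lemma TermClause.mono {X G G' : NOrder M} (D : Set M) (hzero : zeroT ∈ D)
    (hphi : ∀ a b, phiT a b ∈ D → a ∈ D ∧ b ∈ D) (hsum : ∀ a b, sumT a b ∈ D → a ∈ D ∧ b ∈ D)
    {s : M} (h : ∀ a, a < s → a ∈ G.carrier → a ∈ D ∧ a ∈ G'.carrier)
    (h' : ∀ a b, a < s → b < s → a ∈ D → b ∈ D → G.lt a b → G'.lt a b)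
    (hs : TermClause X G s) : TermClause X G' s := by
  rcases hs with _ | ⟨x, hx⟩ | ⟨a, b, ha, hb, ⟨r, hr, hra⟩, hne⟩ | ⟨a, b, ha, hb, hp, ⟨c, hc, hca⟩⟩
  · exact .zero
  · exact .gamma _ hx
  · have hla := left_lt_phiT a b
    have hlb := right_lt_phiT a b
    obtain ⟨ha, ha'⟩ := h _ hla ha
    obtain ⟨hb, hb'⟩ := h _ hlb hb
    refine .phi _ _ ha' hb' ⟨r, hr, ?_⟩ hne
    rcases hra with rfl | hra
    · exact Or.inl rfl
    · refine Or.inr ?_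
      -- The value `h(b)` is `b` itself, the subscript of `b`, or `0`; in each case it lies in `D`
      -- and has a smaller code than the whole term.
      rcases hr with _ | ⟨x⟩ | ⟨_, d⟩ | ⟨c, d⟩
      · exact h' _ _ hlb hla hb ha hra
      · exact h' _ _ hlb hla hb ha hra
      · exact h' _ _ ((left_lt_phiT _ d).trans hlb) hla (hphi _ _ hb).1 ha hra
      · exact h' _ _ (lt_of_le_of_lt (by simp [zeroT, pair]) hla) hla hzero ha hra
  · have hla := left_lt_sumT a b
    have hlb := right_lt_sumT a b
    obtain ⟨ha, ha'⟩ := h _ hla ha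
    obtain ⟨hb, hb'⟩ := h _ hlb hb
    refine .sum _ _ ha' hb' hp ⟨c, hc, ?_⟩
    rcases hca with rfl | hca
    · exact Or.inl rfl
    · refine Or.inr ?_
      rcases hc with ⟨_, hc⟩ | ⟨_, d⟩
      · exact h' _ _ hlb hla hb ha hca
      · exact h' _ _ ((left_lt_sumT _ d).trans hlb) hla (hsum _ _ hb).1 ha hca

lemma TermClause.of_phiT {X G : NOrder M} {a b : M} (h : TermClause X G (phiT a b)) :
    a ∈ G.carrier ∧ b ∈ G.carrier ∧ (hT b = a ∨ G.lt (hT b) a) ∧ (IsGam a → b ≠ zeroT) := by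
  rw [termClause_iff] at h
  simp only [phiT_ne_zeroT, not_isGam_phiT, isPhi_phiT, not_isSum_phiT, leftT_phiT, rightT_phiT,
    false_and, false_or, or_false, true_and] at h
  exact ⟨h.1, h.2.1, h.2.2.1.2, h.2.2.2⟩

lemma TermClause.of_sumT {X G : NOrder M} {a b : M} (h : TermClause X G (sumT a b)) :
    a ∈ G.carrier ∧ b ∈ G.carrier ∧ IsPrincipal a ∧ (IsPrincipal b ∨ IsSum b) ∧
      (headT b = a ∨ G.lt (headT b) a) := by
  rw [termClause_iff] at h
  simpa using h

lemma TermClause.of_gammaT {X G : NOrder M} {x : M} (h : TermClause X G (gammaT x)) :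
    x ∈ X.carrier := by
  rw [termClause_iff] at h
  simpa using h

/-- Membership is defined by recursion with the unrestricted order in place of `G.lt`. Afterwards
the order is restricted to terms; since the clauses refer only to `0` and to subterms of terms,
which are terms again, the restriction does not affect them. -/
theorem exists_isGammaSystem {X : NOrder M} (hX : X.IsInner sets) :
    ∃ G : NOrder M, IsGammaSystem sets X G := by
  obtain ⟨R, hR, hR'⟩ := exists_rawLt hX
  obtain ⟨H, hH, hH'⟩ := coded_recursion (M := M) (α := M) (β := Prop)
    (g := fun s c => TermClause X ⟨{i | look Prop c i}, R⟩ s) (by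
      refine Comp.termClause hX.carrier_mem ?_ ?_ (by fun_prop)
      · simp only [Set.mem_ofPred_eq]
        fun_prop
      · exact hR.comp (by fun_prop))
  have hmem : ∀ s, H s ↔ TermClause X ⟨{i | H i}, R⟩ s := by
    intro s
    obtain ⟨c, h1, h2⟩ := hH' s
    rw [h1]
    constructor
    · refine TermClause.mono Set.univ trivial (by simp) (by simp) ?_ (fun _ _ _ _ _ _ h => h)
      intro a ha h
      exact ⟨trivial, (h2 a ha).mp h⟩
    · refine TermClause.mono Set.univ trivial (by simp) (by simp) ?_ (fun _ _ _ _ _ _ h => h)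
      intro a ha h
      exact ⟨trivial, (h2 a ha).mpr h⟩
  have hzero : H zeroT := (hmem _).2 .zero
  have hphi : ∀ a b, H (phiT a b) → H a ∧ H b := fun a b h =>
    ⟨((hmem _).1 h).of_phiT.1, ((hmem _).1 h).of_phiT.2.1⟩
  have hsum : ∀ a b, H (sumT a b) → H a ∧ H b := fun a b h =>
    ⟨((hmem _).1 h).of_sumT.1, ((hmem _).1 h).of_sumT.2.1⟩
  refine ⟨⟨{i | H i}, fun a b => H a ∧ H b ∧ R a b⟩, ⟨⟨?_, ?_, ?_⟩, ?_, ?_⟩⟩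
  · rw [← comp_mem_iff]
    exact hH
  · have : Comp M fun z : M × M => H z.1 ∧ H z.2 ∧ R z.1 z.2 := by fun_prop
    rw [comp_prop_iff] at this
    convert this using 1
    ext z
    simp [enc_prod, enc_id]
  · exact fun a b h => ⟨h.1, h.2.1⟩
  · intro s
    refine (hmem s).trans ⟨?_, ?_⟩
    · exact TermClause.mono {i | H i} hzero hphi hsum (fun a _ h => ⟨h, h⟩)
        (fun a b _ _ ha hb h => ⟨ha, hb, h⟩)
    · exact TermClause.mono {i | H i} hzero hphi hsum (fun a _ h => ⟨h, h⟩)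
        (fun a b _ _ _ _ h => h.2.2)
  · intro s t
    refine and_congr_right fun hs => and_congr_right fun ht => (hR' s t).trans ⟨?_, ?_⟩
    · exact LtClause.mono {i | H i} hphi hsum hs ht (fun a b ha hb _ h => ⟨ha, hb, h⟩)
    · exact LtClause.mono {i | H i} hphi hsum hs ht (fun a b _ _ _ h => h.2.2)

section Unique

variable {X G G' : NOrder M}

lemma IsGammaSystem.zero_mem (hG : IsGammaSystem sets X G) : zeroT ∈ G.carrier :=
  (hG.mem_iff _).2 .zero

lemma IsGammaSystem.of_phiT (hG : IsGammaSystem sets X G) {a b : M} (h : phiT a b ∈ G.carrier) :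
    a ∈ G.carrier ∧ b ∈ G.carrier :=
  ⟨((hG.mem_iff _).1 h).of_phiT.1, ((hG.mem_iff _).1 h).of_phiT.2.1⟩

lemma IsGammaSystem.of_sumT (hG : IsGammaSystem sets X G) {a b : M} (h : sumT a b ∈ G.carrier) :
    a ∈ G.carrier ∧ b ∈ G.carrier :=
  ⟨((hG.mem_iff _).1 h).of_sumT.1, ((hG.mem_iff _).1 h).of_sumT.2.1⟩

lemma NOrder.IsInner.comp_mem (hX : X.IsInner sets) : Comp M fun a : M => a ∈ X.carrier :=
  comp_mem_iff.2 hX.carrier_mem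

/-- The orders are first compared on the intersection `D` of the two sets, by induction on the sum
of codes. This is what the induction for membership needs, because `h(b) ≤ a` is a statement about
smaller terms that already lie in both sets. -/
theorem IsGammaSystem.unique (hG : IsGammaSystem sets X G) (hG' : IsGammaSystem sets X G') :
    G' = G := by
  have c1 := hG.comp_mem
  have c2 := hG'.comp_mem
  have c3 := hG.comp_lt
  have c4 := hG'.comp_lt
  let D : Set M := G.carrier ∩ G'.carrier
  have hphi : ∀ a b, phiT a b ∈ D → a ∈ D ∧ b ∈ D := fun a b h =>
    ⟨⟨(hG.of_phiT h.1).1, (hG'.of_phiT h.2).1⟩, ⟨(hG.of_phiT h.1).2, (hG'.of_phiT h.2).2⟩⟩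
  have hsum : ∀ a b, sumT a b ∈ D → a ∈ D ∧ b ∈ D := fun a b h =>
    ⟨⟨(hG.of_sumT h.1).1, (hG'.of_sumT h.2).1⟩, ⟨(hG.of_sumT h.1).2, (hG'.of_sumT h.2).2⟩⟩
  have hlt : ∀ z : M × M, z.1 ∈ D → z.2 ∈ D → (G.lt z.1 z.2 ↔ G'.lt z.1 z.2) := by
    refine measure_induction (M := M) (m := fun z : M × M => z.1 + z.2) (by fun_prop) ?_ ?_
    · have : Comp M fun z : M × M => (z.1 ∈ G.carrier ∧ z.1 ∈ G'.carrier) →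
          (z.2 ∈ G.carrier ∧ z.2 ∈ G'.carrier) → (G.lt z.1 z.2 ↔ G'.lt z.1 z.2) := by fun_prop
      exact this
    · rintro ⟨s, t⟩ ih hs ht
      rw [hG.lt_iff, hG'.lt_iff]
      simp only [hs.1, hs.2, ht.1, ht.2, true_and]
      constructor
      · exact LtClause.mono D hphi hsum hs ht fun a b ha hb hab h => (ih (a, b) hab ha hb).1 h
      · exact LtClause.mono D hphi hsum hs ht fun a b ha hb hab h => (ih (a, b) hab ha hb).2 h
  have hmem : ∀ s, s ∈ G.carrier ↔ s ∈ G'.carrier := by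
    refine strong_induction (by fun_prop) fun s ih => ?_
    rw [hG.mem_iff, hG'.mem_iff]
    constructor
    · exact TermClause.mono D ⟨hG.zero_mem, hG'.zero_mem⟩ hphi hsum
        (fun a ha h => ⟨⟨h, (ih a ha).1 h⟩, (ih a ha).1 h⟩)
        (fun a b _ _ ha hb h => (hlt (a, b) ha hb).1 h)
    · exact TermClause.mono D ⟨hG.zero_mem, hG'.zero_mem⟩ hphi hsum
        (fun a ha h => ⟨⟨(ih a ha).2 h, h⟩, (ih a ha).2 h⟩)
        (fun a b _ _ ha hb h => (hlt (a, b) ha hb).2 h)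
  refine NOrder.ext (Set.ext fun s => (hmem s).symm) (funext fun s => funext fun t => propext ?_)
  constructor
  · intro h
    obtain ⟨hs, ht⟩ := hG'.lt_field _ _ h
    exact (hlt (s, t) ⟨(hmem s).2 hs, hs⟩ ⟨(hmem t).2 ht, ht⟩).2 h
  · intro h
    obtain ⟨hs, ht⟩ := hG.lt_field _ _ h
    exact (hlt (s, t) ⟨hs, (hmem s).1 hs⟩ ⟨ht, (hmem t).1 ht⟩).1 h

end Unique

end Terms

end SecondOrder

namespace SecondOrder

open Model Coded

set_option linter.unusedSectionVars false

/-! ### The notation system is a linear order -/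

section Linear

variable {M : Type*} [CommSemiring M] [LinearOrder M] [IsStrictOrderedRing M] [Model M]
  {X G : NOrder M}

namespace IsGammaSystem

lemma cases (hG : IsGammaSystem sets X G) {s : M} (hs : s ∈ G.carrier) :
    s = zeroT ∨ (∃ x, s = gammaT x) ∨ (∃ a b, s = phiT a b) ∨ ∃ a b, s = sumT a b := by
  rcases (hG.mem_iff _).1 hs with _ | ⟨x, -⟩ | ⟨a, b, -⟩ | ⟨a, b, -⟩
  · exact Or.inl rfl
  · exact Or.inr (Or.inl ⟨x, rfl⟩)
  · exact Or.inr (Or.inr (Or.inl ⟨a, b, rfl⟩))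
  · exact Or.inr (Or.inr (Or.inr ⟨a, b, rfl⟩))

variable (hG : IsGammaSystem sets X G) {s t : M}
include hG

lemma lt_iff_of_mem (hs : s ∈ G.carrier) (ht : t ∈ G.carrier) : G.lt s t ↔ LtClause X G s t := by
  rw [hG.lt_iff]; simp [hs, ht]

lemma not_lt_zero : ¬ G.lt s zeroT := by
  rw [hG.lt_iff, ltClause_iff]
  simp

lemma zero_lt_iff (hs : s ∈ G.carrier) : G.lt zeroT s ↔ s ≠ zeroT := by
  rw [hG.lt_iff_of_mem hG.zero_mem hs, ltClause_iff]
  simp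

variable {x y a b c d p : M}

lemma gamma_lt_gamma_iff (hs : gammaT x ∈ G.carrier) (ht : gammaT y ∈ G.carrier) :
    G.lt (gammaT x) (gammaT y) ↔ X.lt x y := by
  rw [hG.lt_iff_of_mem hs ht, ltClause_iff]
  simp

lemma gamma_lt_phi_iff (hs : gammaT x ∈ G.carrier) (ht : phiT a b ∈ G.carrier) :
    G.lt (gammaT x) (phiT a b) ↔
      (gammaT x = a ∨ G.lt (gammaT x) a) ∨ (gammaT x = b ∨ G.lt (gammaT x) b) := by
  rw [hG.lt_iff_of_mem hs ht, ltClause_iff]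
  simp

lemma phi_lt_gamma_iff (hs : phiT a b ∈ G.carrier) (ht : gammaT x ∈ G.carrier) :
    G.lt (phiT a b) (gammaT x) ↔ G.lt a (gammaT x) ∧ G.lt b (gammaT x) := by
  rw [hG.lt_iff_of_mem hs ht, ltClause_iff]
  simp

lemma phi_lt_phi_iff (hs : phiT a b ∈ G.carrier) (ht : phiT c d ∈ G.carrier) :
    G.lt (phiT a b) (phiT c d) ↔ (G.lt a c ∧ G.lt b (phiT c d)) ∨ (a = c ∧ G.lt b d) ∨
      (G.lt c a ∧ G.lt (phiT a b) d) := by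
  rw [hG.lt_iff_of_mem hs ht, ltClause_iff]
  simp

lemma principal_lt_sum_iff (hp : IsPrincipal p) (hs : p ∈ G.carrier) (ht : sumT a b ∈ G.carrier) :
    G.lt p (sumT a b) ↔ p = a ∨ G.lt p a := by
  rw [hG.lt_iff_of_mem hs ht, ltClause_iff]
  rcases hp with x | ⟨c, d⟩ <;> simp

lemma sum_lt_principal_iff (hp : IsPrincipal p) (hs : sumT a b ∈ G.carrier) (ht : p ∈ G.carrier) :
    G.lt (sumT a b) p ↔ G.lt a p := by
  rw [hG.lt_iff_of_mem hs ht, ltClause_iff]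
  rcases hp with x | ⟨c, d⟩ <;> simp

lemma sum_lt_sum_iff (hs : sumT a b ∈ G.carrier) (ht : sumT c d ∈ G.carrier) :
    G.lt (sumT a b) (sumT c d) ↔ G.lt a c ∨ (a = c ∧ G.lt b d) := by
  rw [hG.lt_iff_of_mem hs ht, ltClause_iff]
  simp

lemma zero_or_principal_or_sum (hs : s ∈ G.carrier) :
    s = zeroT ∨ IsPrincipal s ∨ ∃ a b, s = sumT a b := by
  rcases hG.cases hs with h | ⟨x, rfl⟩ | ⟨a, b, rfl⟩ | h
  · exact Or.inl h
  · simp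
  · simp
  · exact Or.inr (Or.inr h)

lemma irrefl (hX : X.IsLinear sets) (s : M) : ¬ G.lt s s := by
  have c1 := hG.comp_lt
  refine strong_induction (M := M) (p := fun s => ¬ G.lt s s) (by fun_prop) (fun s ih h => ?_) s
  have hs := (hG.lt_field _ _ h).1
  rcases hG.cases hs with rfl | ⟨x, rfl⟩ | ⟨a, b, rfl⟩ | ⟨a, b, rfl⟩
  · exact hG.not_lt_zero h
  · exact hX.irrefl _ ((hG.gamma_lt_gamma_iff hs hs).1 h)
  · have := ih a (left_lt_phiT a b)
    have := ih b (right_lt_phiT a b)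
    have := hG.phi_lt_phi_iff hs hs
    tauto
  · have := ih a (left_lt_sumT a b)
    have := ih b (right_lt_sumT a b)
    have := hG.sum_lt_sum_iff hs hs
    tauto

/-- Asymmetry cannot be read off from transitivity at this stage: totality will use asymmetry, and
transitivity will use totality. -/
lemma asymm (hX : X.IsLinear sets) {s t : M} (hst : G.lt s t) : ¬ G.lt t s := by
  have c1 := hG.comp_lt
  refine measure_induction (M := M) (α := M × M) (m := fun z => z.1 + z.2)
    (p := fun z => G.lt z.1 z.2 → ¬ G.lt z.2 z.1) (by fun_prop) (by fun_prop) ?_ (s, t) hst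
  clear hst s t
  rintro ⟨s, t⟩ ih hst hts
  dsimp only at ih hst hts
  replace ih : ∀ a b, a + b < s + t → G.lt a b → ¬ G.lt b a := fun a b => ih (a, b)
  obtain ⟨hs, ht⟩ := hG.lt_field _ _ hst
  rcases hG.cases hs with rfl | ⟨x, rfl⟩ | ⟨a, b, rfl⟩ | ⟨a, b, rfl⟩
  · exact hG.not_lt_zero hts
  · rcases hG.cases ht with rfl | ⟨y, rfl⟩ | ⟨c, d, rfl⟩ | ⟨c, d, rfl⟩
    · exact hG.not_lt_zero hst
    · rw [hG.gamma_lt_gamma_iff hs ht] at hst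
      rw [hG.gamma_lt_gamma_iff ht hs] at hts
      exact hX.irrefl _ (hX.trans _ _ _ hst hts)
    · have := left_lt_phiT c d
      have := right_lt_phiT c d
      have := ih (gammaT x) c (by gcongr)
      have := ih (gammaT x) d (by gcongr)
      have := hG.irrefl hX (gammaT x)
      have := hG.gamma_lt_phi_iff hs ht
      have := hG.phi_lt_gamma_iff ht hs
      grind
    · have := left_lt_sumT c d
      have := ih (gammaT x) c (by gcongr)
      have := hG.irrefl hX (gammaT x)
      have := hG.principal_lt_sum_iff (isPrincipal_gammaT x) hs ht
      have := hG.sum_lt_principal_iff (isPrincipal_gammaT x) ht hs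
      grind
  · have := left_lt_phiT a b
    have := right_lt_phiT a b
    rcases hG.cases ht with rfl | ⟨y, rfl⟩ | ⟨c, d, rfl⟩ | ⟨c, d, rfl⟩
    · exact hG.not_lt_zero hst
    · have := ih a (gammaT y) (by gcongr)
      have := ih b (gammaT y) (by gcongr)
      have := hG.irrefl hX (gammaT y)
      have := hG.gamma_lt_phi_iff ht hs
      have := hG.phi_lt_gamma_iff hs ht
      grind
    · have := left_lt_phiT c d
      have := right_lt_phiT c d
      have := ih a c (by gcongr)
      have := ih b d (by gcongr)
      have := ih (phiT a b) d (by gcongr)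
      have := ih b (phiT c d) (by gcongr)
      have := hG.irrefl hX a
      have := hG.phi_lt_phi_iff hs ht
      have := hG.phi_lt_phi_iff ht hs
      grind
    · have := left_lt_sumT c d
      have := ih (phiT a b) c (by gcongr)
      have := hG.irrefl hX (phiT a b)
      have := hG.principal_lt_sum_iff (isPrincipal_phiT a b) hs ht
      have := hG.sum_lt_principal_iff (isPrincipal_phiT a b) ht hs
      grind
  · have := left_lt_sumT a b
    have := right_lt_sumT a b
    rcases hG.zero_or_principal_or_sum ht with rfl | hp | ⟨c, d, rfl⟩
    · exact hG.not_lt_zero hst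
    · have := ih a t (by gcongr)
      have := hG.irrefl hX t
      have := hG.principal_lt_sum_iff hp ht hs
      have := hG.sum_lt_principal_iff hp hs ht
      grind
    · have := left_lt_sumT c d
      have := right_lt_sumT c d
      have := ih a c (by gcongr)
      have := ih b d (by gcongr)
      have := hG.irrefl hX a
      have := hG.sum_lt_sum_iff hs ht
      have := hG.sum_lt_sum_iff ht hs
      grind

lemma hT_le (h : phiT a b ∈ G.carrier) : hT b = a ∨ G.lt (hT b) a :=
  ((hG.mem_iff _).1 h).of_phiT.2.2.1

/-- The normal form condition is indispensable here. The clauses for `φ_a b` and `φ_c d` leave a gap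
if `c < a` and `φ_a b = d`, but then `h(d) = a ≤ c` holds by normality of `φ_c d`. -/
lemma total (hX : X.IsLinear sets) {s t : M} (hs : s ∈ G.carrier) (ht : t ∈ G.carrier) :
    G.lt s t ∨ s = t ∨ G.lt t s := by
  have c1 := hG.comp_lt
  have c2 := hG.comp_mem
  refine measure_induction (M := M) (α := M × M) (m := fun z => z.1 + z.2)
    (p := fun z => z.1 ∈ G.carrier → z.2 ∈ G.carrier →
      G.lt z.1 z.2 ∨ z.1 = z.2 ∨ G.lt z.2 z.1) (by fun_prop) (by fun_prop) ?_ (s, t) hs ht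
  clear hs ht s t
  rintro ⟨s, t⟩ ih hs ht
  dsimp only at ih hs ht ⊢
  replace ih : ∀ a b, a + b < s + t → a ∈ G.carrier → b ∈ G.carrier →
    G.lt a b ∨ a = b ∨ G.lt b a := fun a b => ih (a, b)
  rcases hG.cases hs with rfl | ⟨x, rfl⟩ | ⟨a, b, rfl⟩ | ⟨a, b, rfl⟩
  · rw [hG.zero_lt_iff ht]
    tauto
  · rcases hG.cases ht with rfl | ⟨y, rfl⟩ | ⟨c, d, rfl⟩ | ⟨c, d, rfl⟩
    · rw [hG.zero_lt_iff hs]; simp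
    · rw [hG.gamma_lt_gamma_iff hs ht, hG.gamma_lt_gamma_iff ht hs, gammaT_inj]
      exact hX.total _ ((hG.mem_iff _).1 hs).of_gammaT _ ((hG.mem_iff _).1 ht).of_gammaT
    · rw [hG.gamma_lt_phi_iff hs ht, hG.phi_lt_gamma_iff ht hs]
      have := left_lt_phiT c d
      have := right_lt_phiT c d
      obtain ⟨hc, hd⟩ := hG.of_phiT ht
      have := ih (gammaT x) c (by gcongr) hs hc
      have := ih (gammaT x) d (by gcongr) hs hd
      tauto
    · rw [hG.principal_lt_sum_iff (by simp) hs ht, hG.sum_lt_principal_iff (by simp) ht hs]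
      have := left_lt_sumT c d
      have := ih (gammaT x) c (by gcongr) hs (hG.of_sumT ht).1
      tauto
  · obtain ⟨ha, hb⟩ := hG.of_phiT hs
    have := left_lt_phiT a b
    have := right_lt_phiT a b
    rcases hG.cases ht with rfl | ⟨y, rfl⟩ | ⟨c, d, rfl⟩ | ⟨c, d, rfl⟩
    · rw [hG.zero_lt_iff hs]; simp
    · rw [hG.gamma_lt_phi_iff ht hs, hG.phi_lt_gamma_iff hs ht]
      have := ih a (gammaT y) (by gcongr) ha ht
      have := ih b (gammaT y) (by gcongr) hb ht
      have h1 : ∀ z, gammaT y = z ↔ z = gammaT y := fun _ => eq_comm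
      simp only [h1]
      tauto
    · have := left_lt_phiT c d
      have := right_lt_phiT c d
      obtain ⟨hc, hd⟩ := hG.of_phiT ht
      rw [hG.phi_lt_phi_iff hs ht, hG.phi_lt_phi_iff ht hs, phiT_inj]
      have h1 := ih a c (by gcongr) ha hc
      have h2 := ih b d (by gcongr) hb hd
      have h3 := ih (phiT a b) d (by gcongr) hs hd
      have h4 := ih b (phiT c d) (by gcongr) hb ht
      have h5 : phiT a b = d → ¬ G.lt c a := by
        rintro rfl h
        rcases hG.hT_le ht with h' | h' <;> rw [hT_phiT] at h'
        · exact hG.irrefl hX _ (h' ▸ h)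
        · exact hG.asymm hX h h'
      have h6 : b = phiT c d → ¬ G.lt a c := by
        rintro rfl h
        rcases hG.hT_le hs with h' | h' <;> rw [hT_phiT] at h'
        · exact hG.irrefl hX _ (h' ▸ h)
        · exact hG.asymm hX h h'
      grind
    · rw [hG.principal_lt_sum_iff (by simp) hs ht, hG.sum_lt_principal_iff (by simp) ht hs]
      have := left_lt_sumT c d
      have := ih (phiT a b) c (by gcongr) hs (hG.of_sumT ht).1
      tauto
  · obtain ⟨ha, hb⟩ := hG.of_sumT hs
    have := left_lt_sumT a b
    have := right_lt_sumT a b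
    rcases hG.zero_or_principal_or_sum ht with rfl | hp | ⟨c, d, rfl⟩
    · rw [hG.zero_lt_iff hs]; simp
    · rw [hG.principal_lt_sum_iff hp ht hs, hG.sum_lt_principal_iff hp hs ht]
      have := ih a t (by gcongr) ha ht
      have h1 : t = a ↔ a = t := eq_comm
      tauto
    · have := left_lt_sumT c d
      have := right_lt_sumT c d
      obtain ⟨hc, hd⟩ := hG.of_sumT ht
      rw [hG.sum_lt_sum_iff hs ht, hG.sum_lt_sum_iff ht hs, sumT_inj]
      have := ih a c (by gcongr) ha hc
      have := ih b d (by gcongr) hb hd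
      grind

/-- The induction is on the sum of three codes. Totality enters where the middle term hides the
relation between the outer subscripts: from `a < c` and `e < c` nothing follows about `a` and `e`,
so all three possibilities are considered. -/
lemma trans (hX : X.IsLinear sets) {s t u : M} (hst : G.lt s t) (htu : G.lt t u) : G.lt s u := by
  have c1 := hG.comp_lt
  refine measure_induction (M := M) (α := M × M × M) (m := fun z => z.1 + z.2.1 + z.2.2)
    (p := fun z => G.lt z.1 z.2.1 → G.lt z.2.1 z.2.2 → G.lt z.1 z.2.2)
    (by fun_prop) (by fun_prop) ?_ (s, t, u) hst htu
  clear hst htu s t u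
  rintro ⟨s, t, u⟩ ih hst htu
  dsimp only at ih hst htu ⊢
  replace ih : ∀ a b c, a + b + c < s + t + u → G.lt a b → G.lt b c → G.lt a c :=
    fun a b c => ih (a, b, c)
  obtain ⟨hs, ht⟩ := hG.lt_field _ _ hst
  obtain ⟨-, hu⟩ := hG.lt_field _ _ htu
  have hu0 : u ≠ zeroT := by
    rintro rfl
    exact hG.not_lt_zero htu
  have ht0 : t ≠ zeroT := by
    rintro rfl
    exact hG.not_lt_zero hst
  rcases hG.zero_or_principal_or_sum hs with rfl | hps | ⟨a, b, rfl⟩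
  · rwa [hG.zero_lt_iff hu]
  · rcases hG.zero_or_principal_or_sum ht with rfl | hpt | ⟨c, d, rfl⟩
    · exact absurd rfl ht0
    · rcases hG.zero_or_principal_or_sum hu with rfl | hpu | ⟨e, f, rfl⟩
      · exact absurd rfl hu0
      · rcases hps with x | ⟨a, b⟩
        · rcases hpt with y | ⟨c, d⟩
          · rcases hpu with z | ⟨e, f⟩
            · rw [hG.gamma_lt_gamma_iff] at * <;> try assumption
              exact hX.trans _ _ _ hst htu
            · have := left_lt_phiT e f
              have := right_lt_phiT e f
              have := ih (gammaT x) (gammaT y) e (by gcongr)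
              have := ih (gammaT x) (gammaT y) f (by gcongr)
              rw [hG.gamma_lt_phi_iff ‹_› ‹_›] at *
              grind
          · have := left_lt_phiT c d
            have := right_lt_phiT c d
            rcases hpu with z | ⟨e, f⟩
            · have := ih (gammaT x) c (gammaT z) (by gcongr)
              have := ih (gammaT x) d (gammaT z) (by gcongr)
              rw [hG.gamma_lt_phi_iff hs ht] at hst
              rw [hG.phi_lt_gamma_iff ht hu] at htu
              grind
            · have := left_lt_phiT e f
              have := right_lt_phiT e f
              have := ih (gammaT x) c e (by gcongr)
              have := ih (gammaT x) d f (by gcongr)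
              have := ih (gammaT x) d (phiT e f) (by gcongr)
              have := ih (gammaT x) (phiT c d) f (by gcongr)
              have := hG.gamma_lt_phi_iff hs ht
              have := hG.gamma_lt_phi_iff hs hu
              have := hG.phi_lt_phi_iff ht hu
              grind
        · have := left_lt_phiT a b
          have := right_lt_phiT a b
          obtain ⟨ha, hb⟩ := hG.of_phiT hs
          rcases hpt with y | ⟨c, d⟩
          · rcases hpu with z | ⟨e, f⟩
            · have := ih a (gammaT y) (gammaT z) (by gcongr)
              have := ih b (gammaT y) (gammaT z) (by gcongr)
              have := hG.phi_lt_gamma_iff hs ht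
              have := hG.phi_lt_gamma_iff hs hu
              grind
            · have := left_lt_phiT e f
              have := right_lt_phiT e f
              have := ih a (gammaT y) e (by gcongr)
              have := ih b (gammaT y) f (by gcongr)
              have := ih b (gammaT y) (phiT e f) (by gcongr)
              have := ih (phiT a b) (gammaT y) f (by gcongr)
              have := hG.phi_lt_gamma_iff hs ht
              have := hG.gamma_lt_phi_iff ht hu
              have := hG.phi_lt_phi_iff hs hu
              have := hG.total hX ha (hG.of_phiT hu).1
              grind
          · have := left_lt_phiT c d
            have := right_lt_phiT c d
            rcases hpu with z | ⟨e, f⟩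
            · have := ih a c (gammaT z) (by gcongr)
              have := ih b d (gammaT z) (by gcongr)
              have := ih b (phiT c d) (gammaT z) (by gcongr)
              have := ih (phiT a b) d (gammaT z) (by gcongr)
              have := hG.phi_lt_phi_iff hs ht
              have := hG.phi_lt_gamma_iff ht hu
              have := hG.phi_lt_gamma_iff hs hu
              grind
            · have := left_lt_phiT e f
              have := right_lt_phiT e f
              have i1 := ih a c e (by gcongr)
              have i2 := ih b (phiT c d) (phiT e f) (by gcongr)
              have i3 := ih (phiT a b) (phiT c d) f (by gcongr)
              have i4 := ih b (phiT c d) f (by gcongr)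
              have i5 := ih b d (phiT e f) (by gcongr)
              have i6 := ih b d f (by gcongr)
              have i7 := ih (phiT a b) d (phiT e f) (by gcongr)
              have i8 := ih (phiT a b) d f (by gcongr)
              have i9 := ih e c a (by
                calc e + c + a = a + c + e := by ring
                  _ < _ := by gcongr)
              have i10 := hG.total hX ha (hG.of_phiT hu).1
              have := hG.phi_lt_phi_iff hs ht
              have := hG.phi_lt_phi_iff ht hu
              have := hG.phi_lt_phi_iff hs hu
              grind
      · have := left_lt_sumT e f
        have := ih s t e (by gcongr)
        have := hG.principal_lt_sum_iff hpt ht hu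
        have := hG.principal_lt_sum_iff hps hs hu
        grind
    · have := left_lt_sumT c d
      rcases hG.zero_or_principal_or_sum hu with rfl | hpu | ⟨e, f, rfl⟩
      · exact absurd rfl hu0
      · have := ih s c u (by gcongr)
        have := hG.principal_lt_sum_iff hps hs ht
        have := hG.sum_lt_principal_iff hpu ht hu
        grind
      · have := left_lt_sumT e f
        have := ih s c e (by gcongr)
        have := hG.principal_lt_sum_iff hps hs ht
        have := hG.principal_lt_sum_iff hps hs hu
        have := hG.sum_lt_sum_iff ht hu
        grind
  · have := left_lt_sumT a b
    have := right_lt_sumT a b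
    rcases hG.zero_or_principal_or_sum ht with rfl | hpt | ⟨c, d, rfl⟩
    · exact absurd rfl ht0
    · have := hG.sum_lt_principal_iff hpt hs ht
      rcases hG.zero_or_principal_or_sum hu with rfl | hpu | ⟨e, f, rfl⟩
      · exact absurd rfl hu0
      · have := ih a t u (by gcongr)
        have := hG.sum_lt_principal_iff hpu hs hu
        grind
      · have := left_lt_sumT e f
        have := ih a t e (by gcongr)
        have := hG.principal_lt_sum_iff hpt ht hu
        have := hG.sum_lt_sum_iff hs hu
        grind
    · have := left_lt_sumT c d
      have := right_lt_sumT c d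
      have := hG.sum_lt_sum_iff hs ht
      rcases hG.zero_or_principal_or_sum hu with rfl | hpu | ⟨e, f, rfl⟩
      · exact absurd rfl hu0
      · have := ih a c u (by gcongr)
        have := hG.sum_lt_principal_iff hpu hs hu
        have := hG.sum_lt_principal_iff hpu ht hu
        grind
      · have := left_lt_sumT e f
        have := right_lt_sumT e f
        have := ih a c e (by gcongr)
        have := ih b d f (by gcongr)
        have := hG.sum_lt_sum_iff ht hu
        have := hG.sum_lt_sum_iff hs hu
        grind

theorem isLinear (hX : X.IsLinear sets) : G.IsLinear sets where
  toIsInner := hG.toIsInner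
  irrefl := hG.irrefl hX
  trans _ _ _ := hG.trans hX
  total _ hs _ ht := hG.total hX hs ht

end IsGammaSystem

end Linear

end SecondOrder

namespace SecondOrder

open Model Coded

set_option linter.unusedSectionVars false

/-! ### Linear orders of the model as types -/

section LinOrd

variable (M : Type*) [CommSemiring M] [LinearOrder M] [IsStrictOrderedRing M] [Model M]

/-- A linear order that belongs to the model. -/
structure LinOrd extends NOrder M where
  isLinear : toNOrder.IsLinear (sets (M := M))

variable {M}

/-- The elements of a linear order of the model. -/
@[ext] structure LinOrd.El (X : LinOrd M) where
  val : M
  mem : val ∈ X.carrier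

variable {α : Type*} [Coded M α] {X : LinOrd M}

instance : Coded M X.El where
  enc := LinOrd.El.val
  enc_injective _ _ h := LinOrd.El.ext h
  range_mem := by
    convert X.isLinear.carrier_mem using 1
    ext a
    exact ⟨by rintro ⟨b, rfl⟩; exact b.mem, fun h => ⟨⟨a, h⟩, rfl⟩⟩

open Classical in
noncomputable instance : LinearOrder X.El where
  le a b := a = b ∨ X.lt a.val b.val
  lt a b := X.lt a.val b.val
  le_refl a := Or.inl rfl
  le_trans a b c := by
    rintro (rfl | h) (rfl | h')
    · exact Or.inl rfl
    · exact Or.inr h'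
    · exact Or.inr h
    · exact Or.inr (X.isLinear.trans _ _ _ h h')
  lt_iff_le_not_ge a b := by
    constructor
    · intro h
      refine ⟨Or.inr h, ?_⟩
      rintro (rfl | h')
      · exact X.isLinear.irrefl _ h
      · exact X.isLinear.irrefl _ (X.isLinear.trans _ _ _ h h')
    · rintro ⟨rfl | h, h'⟩
      · exact absurd (Or.inl rfl) h'
      · exact h
  le_antisymm a b := by
    rintro (rfl | h) (h' | h')
    · rfl
    · rfl
    · exact h'.symm
    · exact absurd (X.isLinear.trans _ _ _ h h') (X.isLinear.irrefl _)
  le_total a b := by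
    rcases X.isLinear.total _ a.mem _ b.mem with h | h | h
    · exact Or.inl (Or.inr h)
    · exact Or.inl (Or.inl (LinOrd.El.ext h))
    · exact Or.inr (Or.inr h)
  toDecidableLE := Classical.decRel _
  toDecidableEq := Classical.decEq _
  toDecidableLT := Classical.decRel _

lemma LinOrd.lt_def {a b : X.El} : a < b ↔ X.lt a.val b.val := Iff.rfl

lemma LinOrd.enc_val (a : X.El) : (enc a : M) = a.val := rfl

@[fun_prop]
lemma Comp.val {f : α → X.El} (hf : Comp M f) : Comp M (fun a => (f a).val) := hf.enc

lemma Comp.of_val {f : α → X.El} (hf : Comp M fun a => (f a).val) : Comp M f := hf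

@[fun_prop]
lemma Comp.lt_el {f g : α → X.El} (hf : Comp M f) (hg : Comp M g) :
    Comp M (fun a => f a < g a) :=
  X.isLinear.comp_lt.comp (hf.val.prodMk hg.val)

@[fun_prop]
lemma Comp.le_el {f g : α → X.El} (hf : Comp M f) (hg : Comp M g) :
    Comp M (fun a => f a ≤ g a) :=
  (hg.lt_el hf).not.of_iff fun _ => not_lt.symm

/-! ### The type of terms -/

variable (X)

/-- The notation system as a linear order of the model. -/
noncomputable def gammaOrd : LinOrd M where
  toNOrder := Classical.choose (exists_isGammaSystem X.isLinear.toIsInner)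
  isLinear := (Classical.choose_spec (exists_isGammaSystem X.isLinear.toIsInner)).isLinear
    X.isLinear

lemma gammaOrd_isGammaSystem : IsGammaSystem sets X.toNOrder (gammaOrd X).toNOrder :=
  Classical.choose_spec (exists_isGammaSystem X.isLinear.toIsInner)

/-- The terms of the notation system. -/
abbrev GT := (gammaOrd X).El

namespace GT

variable {X}

instance : Zero (GT X) := ⟨⟨zeroT, (gammaOrd_isGammaSystem X).zero_mem⟩⟩

lemma val_zero : (0 : GT X).val = zeroT := rfl

lemma val_inj {a b : GT X} : a.val = b.val ↔ a = b := ⟨LinOrd.El.ext, fun h => h ▸ rfl⟩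

open Classical in
/-- The term with code `n`, or `0` if there is none. -/
noncomputable def ofCode (X : LinOrd M) (n : M) : GT X :=
  if h : n ∈ (gammaOrd X).carrier then ⟨n, h⟩ else 0

lemma val_ofCode {n : M} (h : n ∈ (gammaOrd X).carrier) : (ofCode X n).val = n := by
  simp [ofCode, h]

@[simp] lemma ofCode_val (a : GT X) : ofCode X a.val = a := by
  simp [ofCode, a.mem]

@[fun_prop]
lemma comp_ofCode {f : α → M} (hf : Comp M f) : Comp M (fun a => ofCode X (f a)) := by
  classical
  have hm := (gammaOrd X).isLinear.comp_mem
  have : Comp M fun a => if f a ∈ (gammaOrd X).carrier then f a else zeroT := by fun_prop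
  refine Comp.of_val (this.of_eq fun a => ?_)
  unfold ofCode
  split_ifs <;> rfl

/-- The term `Γ_x`. -/
def gam (x : X.El) : GT X :=
  ⟨gammaT x.val, ((gammaOrd_isGammaSystem X).mem_iff _).2 (.gamma _ x.mem)⟩

/-- `φ_a b` is a term. -/
def PhiOK (a b : GT X) : Prop := phiT a.val b.val ∈ (gammaOrd X).carrier

/-- `a + b` is a term. -/
def SumOK (a b : GT X) : Prop := sumT a.val b.val ∈ (gammaOrd X).carrier

/-- The term `φ_a b`, provided that it is one. -/
noncomputable def phi (a b : GT X) : GT X := ofCode X (phiT a.val b.val)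

/-- The term `a + b`, provided that it is one. -/
noncomputable def sum (a b : GT X) : GT X := ofCode X (sumT a.val b.val)

/-- `s` is additively principal. -/
def Prin (s : GT X) : Prop := IsPrincipal s.val

/-- `s` represents an `ε`-number. -/
def Eps (s : GT X) : Prop := IsEps s.val

/-- The first summand. -/
noncomputable def hd (s : GT X) : GT X := ofCode X (headT s.val)

/-- The function `h`. -/
noncomputable def hh (s : GT X) : GT X := ofCode X (hT s.val)

/-- The first argument of `φ_a b` or `a + b`. -/
noncomputable def lft (s : GT X) : GT X := ofCode X (leftT s.val)

/-- The second argument of `φ_a b` or `a + b`. -/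
noncomputable def rgt (s : GT X) : GT X := ofCode X (rightT s.val)

section Comp

variable {f g : α → GT X} (hf : Comp M f) (hg : Comp M g)
include hf

@[fun_prop] lemma comp_lft : Comp M (fun a => lft (f a)) := by unfold lft; fun_prop
@[fun_prop] lemma comp_rgt : Comp M (fun a => rgt (f a)) := by unfold rgt; fun_prop
@[fun_prop] lemma comp_hd : Comp M (fun a => hd (f a)) := by unfold hd; fun_prop
@[fun_prop] lemma comp_prin : Comp M (fun a => Prin (f a)) := by unfold Prin; fun_prop

@[fun_prop] lemma comp_eps : Comp M (fun a => Eps (f a)) := by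
  have : Comp M fun a => IsGam (f a).val ∨ (IsPhi (f a).val ∧ leftT (f a).val ≠ zeroT) := by
    fun_prop
  refine this.of_iff fun a => ?_
  unfold Eps
  constructor
  · intro h
    generalize (f a).val = s at h
    rcases h with x | ⟨c, d, h⟩
    · simp
    · simp [h]
  · rintro (h | ⟨h, h'⟩)
    · rw [h]; exact .gamma _
    · rw [h]; exact .phi _ _ h'

include hg

@[fun_prop] lemma comp_phi : Comp M (fun a => phi (f a) (g a)) := by unfold phi; fun_prop
@[fun_prop] lemma comp_sum : Comp M (fun a => sum (f a) (g a)) := by unfold sum; fun_prop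

@[fun_prop] lemma comp_phiOK : Comp M (fun a => PhiOK (f a) (g a)) :=
  Comp.mem (gammaOrd X).isLinear.carrier_mem (by fun_prop)

end Comp

/-! ### Constructors of terms and their constituents -/

lemma val_gam (x : X.El) : (gam x).val = gammaT x.val := rfl

variable {a b c d s t p q : GT X} {x y : X.El}

lemma PhiOK.val (h : PhiOK a b) : (phi a b).val = phiT a.val b.val := val_ofCode h

lemma SumOK.val (h : SumOK a b) : (sum a b).val = sumT a.val b.val := val_ofCode h

@[simp] lemma gam_ne_zero : gam x ≠ 0 := by rw [Ne, ← val_inj, val_gam, val_zero]; simp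

lemma PhiOK.ne_zero (h : PhiOK a b) : phi a b ≠ 0 := by rw [Ne, ← val_inj, h.val, val_zero]; simp

lemma SumOK.ne_zero (h : SumOK a b) : sum a b ≠ 0 := by rw [Ne, ← val_inj, h.val, val_zero]; simp

@[simp] lemma not_prin_zero : ¬ Prin (0 : GT X) := by simp [Prin, val_zero]

@[simp] lemma prin_gam : Prin (gam x) := by simp [Prin, val_gam]

lemma PhiOK.prin (h : PhiOK a b) : Prin (phi a b) := by simp [Prin, h.val]

lemma SumOK.not_prin (h : SumOK a b) : ¬ Prin (sum a b) := by simp [Prin, h.val]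

lemma Prin.ne_zero (h : Prin p) : p ≠ 0 := by
  rintro rfl
  exact not_prin_zero h

@[simp] lemma hd_zero : hd (0 : GT X) = 0 := by
  rw [hd, val_zero, headT_zeroT, ← val_zero, ofCode_val]

lemma Prin.hd_eq (h : Prin p) : hd p = p := by
  have : headT p.val = p.val := by
    unfold Prin at h
    generalize p.val = n at h
    rcases h with x | ⟨a, b⟩ <;> simp
  rw [hd, this, ofCode_val]

lemma SumOK.hd_eq (h : SumOK a b) : hd (sum a b) = a := by
  rw [hd, h.val, headT_sumT, ofCode_val]

@[simp] lemma hh_zero : hh (0 : GT X) = 0 := by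
  rw [hh, val_zero, hT_zeroT, ← val_zero, ofCode_val]

@[simp] lemma hh_gam : hh (gam x) = gam x := by
  rw [hh, val_gam, hT_gammaT, ← val_gam, ofCode_val]

lemma PhiOK.hh_eq (h : PhiOK a b) : hh (phi a b) = a := by
  rw [hh, h.val, hT_phiT, ofCode_val]

lemma SumOK.hh_eq (h : SumOK a b) : hh (sum a b) = 0 := by
  rw [hh, h.val, hT_sumT, ← val_zero, ofCode_val]

lemma PhiOK.lft_eq (h : PhiOK a b) : lft (phi a b) = a := by
  rw [lft, h.val, leftT_phiT, ofCode_val]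

lemma PhiOK.rgt_eq (h : PhiOK a b) : rgt (phi a b) = b := by
  rw [rgt, h.val, rightT_phiT, ofCode_val]

lemma SumOK.lft_eq (h : SumOK a b) : lft (sum a b) = a := by
  rw [lft, h.val, leftT_sumT, ofCode_val]

lemma SumOK.rgt_eq (h : SumOK a b) : rgt (sum a b) = b := by
  rw [rgt, h.val, rightT_sumT, ofCode_val]

lemma PhiOK.enc_left (h : PhiOK a b) : (enc a : M) < enc (phi a b) := by
  rw [LinOrd.enc_val, LinOrd.enc_val, h.val]; exact left_lt_phiT _ _

lemma PhiOK.enc_right (h : PhiOK a b) : (enc b : M) < enc (phi a b) := by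
  rw [LinOrd.enc_val, LinOrd.enc_val, h.val]; exact right_lt_phiT _ _

lemma SumOK.enc_left (h : SumOK a b) : (enc a : M) < enc (sum a b) := by
  rw [LinOrd.enc_val, LinOrd.enc_val, h.val]; exact left_lt_sumT _ _

lemma SumOK.enc_right (h : SumOK a b) : (enc b : M) < enc (sum a b) := by
  rw [LinOrd.enc_val, LinOrd.enc_val, h.val]; exact right_lt_sumT _ _

theorem cases (s : GT X) : s = 0 ∨ (∃ x, s = gam x) ∨ (∃ a b, PhiOK a b ∧ s = phi a b) ∨
    ∃ a b, SumOK a b ∧ s = sum a b := by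
  obtain ⟨n, hn⟩ := s
  have hG := gammaOrd_isGammaSystem X
  rcases hG.cases hn with rfl | ⟨x, rfl⟩ | ⟨a, b, rfl⟩ | ⟨a, b, rfl⟩
  · exact Or.inl rfl
  · exact Or.inr (Or.inl ⟨⟨x, ((hG.mem_iff _).1 hn).of_gammaT⟩, rfl⟩)
  · have ha := (hG.of_phiT hn)
    refine Or.inr (Or.inr (Or.inl ⟨⟨a, ha.1⟩, ⟨b, ha.2⟩, hn, ?_⟩))
    exact val_inj.1 (val_ofCode (X := X) hn).symm
  · have ha := (hG.of_sumT hn)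
    refine Or.inr (Or.inr (Or.inr ⟨⟨a, ha.1⟩, ⟨b, ha.2⟩, hn, ?_⟩))
    exact val_inj.1 (val_ofCode (X := X) hn).symm

lemma zero_le (s : GT X) : 0 ≤ s := by
  by_contra h
  exact (gammaOrd_isGammaSystem X).not_lt_zero (LinOrd.lt_def.1 (not_le.1 h))

lemma pos_iff : 0 < s ↔ s ≠ 0 :=
  ⟨fun h => h.ne', fun h => lt_of_le_of_ne (zero_le s) h.symm⟩

lemma not_lt_zero : ¬ s < 0 := not_lt.2 (zero_le s)

lemma phiOK_iff : PhiOK a b ↔ hh b ≤ a ∧ ((∃ x, a = gam x) → b ≠ 0) := by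
  have hG := gammaOrd_isGammaSystem X
  have hb : (hh b).val = hT b.val := by
    rcases cases b with rfl | ⟨x, rfl⟩ | ⟨c, d, h, rfl⟩ | ⟨c, d, h, rfl⟩
    · rw [hh_zero, val_zero, hT_zeroT]
    · rw [hh_gam, val_gam, hT_gammaT]
    · rw [h.hh_eq, h.val, hT_phiT]
    · rw [h.hh_eq, h.val, hT_sumT, val_zero]
  constructor
  · intro h
    obtain ⟨-, -, h1, h2⟩ := ((hG.mem_iff _).1 h).of_phiT
    constructor
    · rw [← hb] at h1
      exact h1.imp LinOrd.El.ext id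
    · rintro ⟨x, rfl⟩ rfl
      exact h2 (by rw [val_gam]; simp) rfl
  · rintro ⟨h1, h2⟩
    refine (hG.mem_iff _).2 (.phi _ _ a.mem b.mem ⟨(hh b).val, hasH_iff.2 ⟨?_, hb⟩, ?_⟩ ?_)
    · rcases cases b with rfl | ⟨x, rfl⟩ | ⟨c, d, h, rfl⟩ | ⟨c, d, h, rfl⟩
      · simp [val_zero]
      · simp [val_gam]
      · simp [h.val]
      · simp [h.val]
    · exact h1.imp (congrArg LinOrd.El.val) id
    · rintro ⟨x, hx⟩ hb0
      have ha := a.mem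
      rw [hx, hG.mem_iff] at ha
      exact h2 ⟨⟨x, ha.of_gammaT⟩, val_inj.1 hx⟩ (val_inj.1 hb0)

lemma sumOK_iff : SumOK p q ↔ Prin p ∧ q ≠ 0 ∧ hd q ≤ p := by
  have hG := gammaOrd_isGammaSystem X
  have hq : (hd q).val = headT q.val := by
    rcases cases q with rfl | ⟨x, rfl⟩ | ⟨c, d, h, rfl⟩ | ⟨c, d, h, rfl⟩
    · rw [hd_zero, val_zero, headT_zeroT]
    · rw [prin_gam.hd_eq, val_gam, headT_gammaT]
    · rw [h.prin.hd_eq, h.val, headT_phiT]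
    · rw [h.hd_eq, h.val, headT_sumT]
  have hq0 : q ≠ 0 ↔ IsPrincipal q.val ∨ IsSum q.val := by
    rcases cases q with rfl | ⟨x, rfl⟩ | ⟨c, d, h, rfl⟩ | ⟨c, d, h, rfl⟩
    · simp [val_zero]
    · simp [val_gam]
    · simp [h.val, h.ne_zero]
    · simp [h.val, h.ne_zero]
  constructor
  · intro h
    obtain ⟨-, -, h1, h2, h3⟩ := ((hG.mem_iff _).1 h).of_sumT
    rw [← hq] at h3
    exact ⟨h1, hq0.2 h2, h3.imp LinOrd.El.ext id⟩
  · rintro ⟨h1, h2, h3⟩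
    exact (hG.mem_iff _).2 (.sum _ _ p.mem q.mem h1
      ⟨(hd q).val, isHead_iff.2 ⟨hq0.1 h2, hq⟩, h3.imp (congrArg LinOrd.El.val) id⟩)

/-! ### The order on terms -/

lemma gam_lt_gam : gam x < gam y ↔ x < y :=
  (gammaOrd_isGammaSystem X).gamma_lt_gamma_iff (gam x).mem (gam y).mem

lemma PhiOK.gam_lt (h : PhiOK a b) : gam x < phi a b ↔ gam x ≤ a ∨ gam x ≤ b := by
  rw [LinOrd.lt_def, h.val, val_gam,
    (gammaOrd_isGammaSystem X).gamma_lt_phi_iff (gam x).mem h, ← val_gam, val_inj, val_inj]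
  rfl

lemma PhiOK.lt_gam (h : PhiOK a b) : phi a b < gam x ↔ a < gam x ∧ b < gam x := by
  rw [LinOrd.lt_def, h.val, val_gam, (gammaOrd_isGammaSystem X).phi_lt_gamma_iff h (gam x).mem]
  rfl

lemma PhiOK.lt (h : PhiOK a b) (h' : PhiOK c d) : phi a b < phi c d ↔
    (a < c ∧ b < phi c d) ∨ (a = c ∧ b < d) ∨ (c < a ∧ phi a b < d) := by
  rw [LinOrd.lt_def, h.val, h'.val, (gammaOrd_isGammaSystem X).phi_lt_phi_iff h h', val_inj,
    ← h.val, ← h'.val]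
  rfl

lemma SumOK.prin_lt (h : SumOK a b) (hp : Prin p) : p < sum a b ↔ p ≤ a := by
  rw [LinOrd.lt_def, h.val, (gammaOrd_isGammaSystem X).principal_lt_sum_iff hp p.mem h, val_inj]
  rfl

lemma SumOK.lt_prin (h : SumOK a b) (hp : Prin p) : sum a b < p ↔ a < p := by
  rw [LinOrd.lt_def, h.val, (gammaOrd_isGammaSystem X).sum_lt_principal_iff hp h p.mem]
  rfl

lemma SumOK.lt (h : SumOK a b) (h' : SumOK c d) :
    sum a b < sum c d ↔ a < c ∨ (a = c ∧ b < d) := by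
  rw [LinOrd.lt_def, h.val, h'.val, (gammaOrd_isGammaSystem X).sum_lt_sum_iff h h', val_inj]
  rfl

end GT

end LinOrd

end SecondOrder

namespace SecondOrder

open Model Coded

set_option linter.unusedSectionVars false

namespace GT

section Arithmetic

variable {M : Type*} [CommSemiring M] [LinearOrder M] [IsStrictOrderedRing M] [Model M]
  {α : Type*} [Coded M α] {X : LinOrd M} {a b c d s t u p q e : GT X} {x y : X.El}

/-! ### Powers of `ω` -/

@[simp] lemma eps_gam : Eps (gam x) := .gamma _

lemma PhiOK.eps_iff (h : PhiOK a b) : Eps (phi a b) ↔ a ≠ 0 := by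
  unfold Eps
  rw [h.val]
  constructor
  · intro h' ha
    generalize hn : phiT a.val b.val = n at h'
    rcases h' with x | ⟨c, d, h'⟩
    · simp at hn
    · rw [phiT_inj] at hn
      exact h' (hn.1 ▸ ha ▸ rfl)
  · exact fun ha => .phi _ _ fun h' => ha (val_inj.1 h')

lemma Eps.prin (h : Eps s) : Prin s := by
  unfold Eps at h
  unfold Prin
  generalize s.val = n at h
  rcases h with x | ⟨a, b, -⟩ <;> simp

@[simp] lemma not_eps_zero : ¬ Eps (0 : GT X) := fun h => not_prin_zero h.prin

lemma SumOK.not_eps (h : SumOK a b) : ¬ Eps (sum a b) := fun h' => h.not_prin h'.prin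

/-- The condition `h(s) ≤ 0` fails exactly for `ε`-numbers. Hence `ω^s` is always represented by a
term, namely by `s` itself when `φ_0 s` is not in normal form. -/
lemma phiOK_zero_iff : PhiOK 0 s ↔ ¬ Eps s := by
  have h0 : ¬ ∃ x : X.El, (0 : GT X) = gam x := by
    rintro ⟨x, hx⟩
    exact gam_ne_zero hx.symm
  rw [phiOK_iff]
  simp only [h0, false_imp_iff, and_true]
  rcases cases s with rfl | ⟨x, rfl⟩ | ⟨a, b, h, rfl⟩ | ⟨a, b, h, rfl⟩
  · simp
  · simp [pos_iff]
  · rw [h.hh_eq, h.eps_iff, not_ne_iff]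
    exact ⟨fun h' => le_antisymm h' (zero_le _), fun h' => h'.le⟩
  · simp [h.hh_eq, h.not_eps]

open Classical in
/-- The power `ω ^ s`. -/
noncomputable def om (s : GT X) : GT X := if Eps s then s else phi 0 s

open Classical in
/-- The logarithm to the base `ω` of a principal term. -/
noncomputable def lg (s : GT X) : GT X := if Eps s then s else rgt s

@[fun_prop] lemma comp_om {f : α → GT X} (hf : Comp M f) : Comp M (fun a => om (f a)) := by
  unfold om; fun_prop

@[fun_prop] lemma comp_lg {f : α → GT X} (hf : Comp M f) : Comp M (fun a => lg (f a)) := by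
  unfold lg; fun_prop

lemma Eps.om_eq (h : Eps s) : om s = s := if_pos h

lemma om_of_not_eps (h : ¬ Eps s) : om s = phi 0 s := if_neg h

lemma prin_om (s : GT X) : Prin (om s) := by
  by_cases h : Eps s
  · rw [h.om_eq]; exact h.prin
  · rw [om_of_not_eps h]
    exact (phiOK_zero_iff.2 h).prin

@[simp] lemma lg_om (s : GT X) : lg (om s) = s := by
  by_cases h : Eps s
  · rw [h.om_eq, lg, if_pos h]
  · have h' := phiOK_zero_iff.2 h
    have : ¬ Eps (phi 0 s) := by rw [h'.eps_iff]; simp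
    rw [om_of_not_eps h, lg, if_neg this, h'.rgt_eq]

lemma Prin.om_lg (h : Prin p) : om (lg p) = p := by
  by_cases he : Eps p
  · rw [lg, if_pos he, he.om_eq]
  · rcases cases p with rfl | ⟨x, rfl⟩ | ⟨a, b, h', rfl⟩ | ⟨a, b, h', rfl⟩
    · exact absurd h not_prin_zero
    · exact absurd eps_gam he
    · rw [h'.eps_iff, not_ne_iff] at he
      subst he
      have hb := phiOK_zero_iff.1 h'
      have : ¬ Eps (phi 0 b) := by rw [h'.eps_iff]; simp
      rw [lg, if_neg this, h'.rgt_eq, om_of_not_eps hb]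
    · exact absurd h h'.not_prin

/-- If exactly one of the two is an `ε`-number, the order clauses reduce a comparison with `φ_0` to
one with its argument, since the subscript `0` lies below every `Γ_x` and every nonzero subscript.
-/
lemma om_lt_om : om s < om t ↔ s < t := by
  by_cases hs : Eps s
  · rw [hs.om_eq]
    by_cases ht : Eps t
    · rw [ht.om_eq]
    · have ht' := phiOK_zero_iff.2 ht
      rw [om_of_not_eps ht]
      rcases cases s with rfl | ⟨x, rfl⟩ | ⟨a, b, h, rfl⟩ | ⟨a, b, h, rfl⟩
      · exact absurd hs not_eps_zero
      · rw [ht'.gam_lt]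
        have h1 : ¬ gam x ≤ 0 := not_le.2 (pos_iff.2 gam_ne_zero)
        have h2 : gam x ≠ t := by
          rintro rfl
          exact ht eps_gam
        rw [or_iff_right h1]
        exact ⟨fun h => lt_of_le_of_ne h h2, le_of_lt⟩
      · rw [h.lt ht']
        rw [h.eps_iff] at hs
        have : 0 < a := pos_iff.2 hs
        simp [hs, this, not_lt_zero]
      · exact absurd hs h.not_eps
  · have hs' := phiOK_zero_iff.2 hs
    rw [om_of_not_eps hs]
    by_cases ht : Eps t
    · rw [ht.om_eq]
      rcases cases t with rfl | ⟨x, rfl⟩ | ⟨a, b, h, rfl⟩ | ⟨a, b, h, rfl⟩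
      · exact absurd ht not_eps_zero
      · rw [hs'.lt_gam]
        simp [pos_iff]
      · rw [hs'.lt h]
        rw [h.eps_iff] at ht
        have : 0 < a := pos_iff.2 ht
        simp [ht.symm, this, not_lt_zero]
      · exact absurd ht h.not_eps
    · have ht' := phiOK_zero_iff.2 ht
      rw [om_of_not_eps ht, hs'.lt ht']
      simp

lemma om_strictMono : StrictMono (om : GT X → GT X) := fun _ _ h => om_lt_om.2 h

lemma Prin.lg_lt_lg (hp : Prin p) (hq : Prin q) : lg p < lg q ↔ p < q := by
  rw [← om_lt_om, hp.om_lg, hq.om_lg]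

/-! ### Cantor normal forms -/

lemma zero_or_prin_or_sum (s : GT X) : s = 0 ∨ Prin s ∨ ∃ a b, SumOK a b ∧ s = sum a b := by
  rcases cases s with rfl | ⟨x, rfl⟩ | ⟨a, b, h, rfl⟩ | h
  · exact Or.inl rfl
  · exact Or.inr (Or.inl prin_gam)
  · exact Or.inr (Or.inl h.prin)
  · exact Or.inr (Or.inr h)

/-- `p` and `q` are the first summand and the remainder of a Cantor normal form. -/
def ConsOK (p q : GT X) : Prop := Prin p ∧ hd q ≤ p

open Classical in
/-- The Cantor normal form with first summand `p` and remainder `q`. -/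
noncomputable def cons (p q : GT X) : GT X := if q = 0 then p else sum p q

@[fun_prop] lemma comp_cons {f g : α → GT X} (hf : Comp M f) (hg : Comp M g) :
    Comp M (fun a => cons (f a) (g a)) := by
  unfold cons; fun_prop

@[simp] lemma cons_zero (p : GT X) : cons p 0 = p := if_pos rfl

lemma cons_of_ne (h : q ≠ 0) : cons p q = sum p q := if_neg h

lemma Prin.consOK_zero (h : Prin p) : ConsOK p 0 := ⟨h, by simpa using zero_le p⟩

lemma ConsOK.sumOK (h : ConsOK p q) (hq : q ≠ 0) : SumOK p q := sumOK_iff.2 ⟨h.1, hq, h.2⟩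

lemma SumOK.consOK (h : SumOK p q) : ConsOK p q := ⟨(sumOK_iff.1 h).1, (sumOK_iff.1 h).2.2⟩

lemma SumOK.cons_eq (h : SumOK p q) : cons p q = sum p q := cons_of_ne (sumOK_iff.1 h).2.1

lemma ConsOK.hd_eq (h : ConsOK p q) : hd (cons p q) = p := by
  by_cases hq : q = 0
  · rw [hq, cons_zero, h.1.hd_eq]
  · rw [cons_of_ne hq, (h.sumOK hq).hd_eq]

lemma ConsOK.ne_zero (h : ConsOK p q) : cons p q ≠ 0 := by
  by_cases hq : q = 0
  · rw [hq, cons_zero]; exact h.1.ne_zero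
  · rw [cons_of_ne hq]; exact (h.sumOK hq).ne_zero

/-- Since the remainder may be `0`, the four clauses for principal terms and sums merge into one
lexicographic rule. -/
lemma ConsOK.lt (h : ConsOK p q) (h' : ConsOK a b) :
    cons p q < cons a b ↔ p < a ∨ (p = a ∧ q < b) := by
  by_cases hq : q = 0
  · subst hq
    by_cases hb : b = 0
    · subst hb
      simp
    · rw [cons_zero, cons_of_ne hb, (h'.sumOK hb).prin_lt h.1, le_iff_lt_or_eq]
      simp [pos_iff, hb]
  · by_cases hb : b = 0
    · subst hb
      rw [cons_zero, cons_of_ne hq, (h.sumOK hq).lt_prin h'.1]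
      simp [not_lt_zero]
    · rw [cons_of_ne hq, cons_of_ne hb, (h.sumOK hq).lt (h'.sumOK hb)]

/-- Only the remainder is guaranteed to have a smaller code: if it is `0`, the first summand is `s`
itself. -/
theorem zero_or_cons (s : GT X) :
    s = 0 ∨ ∃ p q, ConsOK p q ∧ (enc q : M) < enc s ∧ s = cons p q := by
  rcases zero_or_prin_or_sum s with rfl | h | ⟨p, q, h, rfl⟩
  · exact Or.inl rfl
  · refine Or.inr ⟨s, 0, h.consOK_zero, ?_, (cons_zero s).symm⟩
    rw [LinOrd.enc_val, LinOrd.enc_val, val_zero]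
    refine lt_of_le_of_ne (by simp [zeroT, pair]) fun h' => h.ne_zero (val_inj.1 h'.symm)
  · exact Or.inr ⟨p, q, h.consOK, h.enc_right, h.cons_eq.symm⟩

theorem cons_induction {P : GT X → Prop} (hP : Comp M P) (h0 : P 0)
    (hc : ∀ p q, ConsOK p q → P q → P (cons p q)) (s : GT X) : P s := by
  refine measure_induction (M := M) (m := fun s : GT X => (enc s : M)) (by fun_prop) hP
    (fun s ih => ?_) s
  rcases zero_or_cons s with rfl | ⟨p, q, h, hq, rfl⟩
  · exact h0
  · exact hc p q h (ih q hq)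

/-- Induction along a Cantor normal form for a property with a parameter. -/
theorem cons_induction_param {P : GT X → GT X → Prop} (hP : Comp M fun z : GT X × GT X => P z.1 z.2)
    (h0 : ∀ t, P 0 t) (hc : ∀ p q, ConsOK p q → (∀ t, P q t) → ∀ t, P (cons p q) t) (s t : GT X) :
    P s t := by
  -- The measure ignores the second component, so the induction hypothesis holds for all parameters
  -- although the induction predicate contains no quantifier over them, which could destroy
  -- decidability.
  refine measure_induction (M := M) (α := GT X × GT X) (m := fun z => (enc z.1 : M)) (by fun_prop)
    (p := fun z => P z.1 z.2) hP (fun z ih => ?_) (s, t)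
  obtain ⟨s, t⟩ := z
  rcases zero_or_cons s with rfl | ⟨p, q, h, hq, rfl⟩
  · exact h0 t
  · exact hc p q h (fun t => ih (q, t) hq) t

lemma ConsOK.prin_le (h : ConsOK p q) : p ≤ cons p q := by
  rcases eq_or_ne q 0 with rfl | hq
  · simp
  · have := (h.1.consOK_zero.lt h).2 (Or.inr ⟨rfl, pos_iff.2 hq⟩)
    simpa using this.le

/-- Comparison with a principal term depends on the first summand alone. Closure of principal terms
under addition and absorption are consequences. -/
lemma Prin.le_iff (hp : Prin p) (t : GT X) : p ≤ t ↔ p ≤ hd t := by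
  rcases zero_or_cons t with rfl | ⟨a, b, h, -, rfl⟩
  · simp
  · rw [h.hd_eq]
    refine ⟨fun h' => ?_, fun h' => h'.trans h.prin_le⟩
    by_contra hc
    have := (h.lt hp.consOK_zero).2 (Or.inl (not_le.1 hc))
    rw [cons_zero] at this
    exact absurd h' (not_le.2 this)

lemma Prin.lt_iff (hp : Prin p) (t : GT X) : t < p ↔ hd t < p := by
  rw [← not_le, hp.le_iff, not_le]

lemma hd_le (s : GT X) : hd s ≤ s := by
  rcases zero_or_cons s with rfl | ⟨p, q, h, -, rfl⟩
  · simp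
  · rw [h.hd_eq]; exact h.prin_le

lemma hd_mono (h : s ≤ t) : hd s ≤ hd t := by
  rcases zero_or_cons s with rfl | ⟨p, q, h', -, rfl⟩
  · simpa using zero_le _
  · rw [h'.hd_eq, ← h'.1.le_iff]
    exact h'.prin_le.trans h

lemma prin_hd (h : s ≠ 0) : Prin (hd s) := by
  rcases zero_or_cons s with rfl | ⟨p, q, h', -, rfl⟩
  · exact absurd rfl h
  · rw [h'.hd_eq]; exact h'.1

/-! ### Addition -/

open Classical in
/-- The sum `p + t` for principal `p`. -/
noncomputable def padd (p t : GT X) : GT X := if p < hd t then t else cons p t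

@[fun_prop] lemma comp_padd {f g : α → GT X} (hf : Comp M f) (hg : Comp M g) :
    Comp M (fun a => padd (f a) (g a)) := by
  unfold padd; fun_prop

lemma padd_of_lt (h : p < hd t) : padd p t = t := if_pos h

lemma padd_of_le (h : hd t ≤ p) : padd p t = cons p t := if_neg (not_lt.2 h)

lemma ConsOK.padd_eq (h : ConsOK p q) : padd p q = cons p q := padd_of_le h.2

lemma Prin.padd_zero (h : Prin p) : padd p 0 = p := by
  rw [h.consOK_zero.padd_eq, cons_zero]

lemma Prin.hd_padd (hp : Prin p) (t : GT X) : hd (padd p t) = max p (hd t) := by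
  by_cases h : p < hd t
  · rw [padd_of_lt h, max_eq_right h.le]
  · rw [not_lt] at h
    have hc : ConsOK p t := ⟨hp, h⟩
    rw [padd_of_le h, max_eq_left h, hc.hd_eq]

lemma Prin.padd_lt_padd (hp : Prin p) (h : s < t) : padd p s < padd p t := by
  have hst := hd_mono h.le
  by_cases h1 : p < hd s
  · rwa [padd_of_lt h1, padd_of_lt (h1.trans_le hst)]
  · have h1 := not_lt.1 h1
    have hs : ConsOK p s := ⟨hp, h1⟩
    rw [padd_of_le h1]
    by_cases h2 : p < hd t
    · rw [padd_of_lt h2]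
      rcases zero_or_cons t with rfl | ⟨a, b, h', -, rfl⟩
      · exact absurd h not_lt_zero
      · rw [h'.hd_eq] at h2
        exact (hs.lt h').2 (Or.inl h2)
    · have h2 := not_lt.1 h2
      have ht : ConsOK p t := ⟨hp, h2⟩
      rw [padd_of_le h2]
      exact (hs.lt ht).2 (Or.inr ⟨rfl, h⟩)

lemma Prin.padd_le_padd (hp : Prin p) (h : s ≤ t) : padd p s ≤ padd p t := by
  rcases h.lt_or_eq with h | rfl
  · exact (hp.padd_lt_padd h).le
  · exact le_rfl

-- The recursion removes the first summand of the left argument while the right one is fixed, so the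
-- sum of codes decreases. A principal left argument is treated separately, as its remainder `0` is
-- not stored in it.
open Classical in
lemma exists_add : ∃ f : GT X × GT X → GT X, Comp M f ∧ (∀ t, f (0, t) = t) ∧
    ∀ p q t, ConsOK p q → f (cons p q, t) = padd p (f (q, t)) := by
  obtain ⟨f, hf, hf'⟩ := coded_recursion (M := M) (α := GT X × GT X) (β := GT X)
    (g := fun z c => if z.1 = 0 then z.2 else if Prin z.1 then padd z.1 z.2
      else padd (lft z.1) (look (GT X) c (rgt z.1, z.2))) (by fun_prop)
  have h0 : ∀ t, f (0, t) = t := fun t => by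
    obtain ⟨c, h, -⟩ := hf' (0, t)
    simpa using h
  refine ⟨f, hf, h0, fun p q t hpq => ?_⟩
  obtain ⟨c, h, h'⟩ := hf' (cons p q, t)
  rw [h]
  by_cases hq : q = 0
  · subst hq
    simp [hpq.1, hpq.1.ne_zero, h0]
  · have hs := hpq.sumOK hq
    rw [cons_of_ne hq] at h' ⊢
    simp only [hs.ne_zero, hs.not_prin, if_false, hs.lft_eq, hs.rgt_eq]
    rw [h' (q, t)]
    rw [enc_prod, enc_prod]
    apply pair_lt_pair_of_add_lt
    have := hs.enc_right
    gcongr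

noncomputable instance : Add (GT X) := ⟨fun s t => Classical.choose (exists_add (X := X)) (s, t)⟩

@[fun_prop] lemma comp_add {f g : α → GT X} (hf : Comp M f) (hg : Comp M g) :
    Comp M (fun a => f a + g a) :=
  (Classical.choose_spec (exists_add (X := X))).1.comp (hf.prodMk hg)

lemma zero_add (t : GT X) : 0 + t = t := (Classical.choose_spec (exists_add (X := X))).2.1 t

lemma ConsOK.add_eq (h : ConsOK p q) (t : GT X) : cons p q + t = padd p (q + t) :=
  (Classical.choose_spec (exists_add (X := X))).2.2 p q t h

lemma Prin.add_eq (h : Prin p) (t : GT X) : p + t = padd p t := by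
  have := h.consOK_zero.add_eq t
  rwa [cons_zero, zero_add] at this

lemma add_zero (s : GT X) : s + 0 = s := by
  refine cons_induction (P := fun s => s + 0 = s) (by fun_prop) (zero_add 0) (fun p q h ih => ?_) s
  rw [h.add_eq, ih, h.padd_eq]

lemma hd_add (s t : GT X) : hd (s + t) = max (hd s) (hd t) := by
  refine cons_induction (P := fun s => hd (s + t) = max (hd s) (hd t)) ?_ ?_
    (fun p q h ih => ?_) s
  · have : Comp M fun s => (hd s ≤ hd t ∧ hd (s + t) = hd t) ∨ (hd t ≤ hd s ∧ hd (s + t) = hd s) := by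
      fun_prop
    refine this.of_iff fun s => ?_
    rcases le_total (hd s) (hd t) with h | h
    · rw [max_eq_right h]
      grind
    · rw [max_eq_left h]
      grind
  · rw [zero_add, hd_zero, max_eq_right (zero_le _)]
  · rw [h.add_eq, h.1.hd_padd, ih, h.hd_eq, ← max_assoc, max_eq_left h.2]

lemma Prin.padd_add (hp : Prin p) (s t : GT X) : padd p s + t = padd p (s + t) := by
  by_cases h : p < hd s
  · rw [padd_of_lt h, padd_of_lt]
    rw [hd_add]
    exact h.trans_le (le_max_left _ _)
  · have h := not_lt.1 h
    have hs : ConsOK p s := ⟨hp, h⟩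
    rw [padd_of_le h, hs.add_eq]

lemma add_assoc (s t u : GT X) : s + t + u = s + (t + u) := by
  refine cons_induction (P := fun s => s + t + u = s + (t + u)) (by fun_prop) ?_
    (fun p q h ih => ?_) s
  · rw [zero_add, zero_add]
  · rw [h.add_eq, h.add_eq, h.1.padd_add, ih]

lemma add_lt_add_left (s : GT X) (h : t < u) : s + t < s + u := by
  refine cons_induction (P := fun s => s + t < s + u) (by fun_prop) ?_ (fun p q h' ih => ?_) s
  · rwa [zero_add, zero_add]
  · rw [h'.add_eq, h'.add_eq]
    exact h'.1.padd_lt_padd ih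

lemma le_add_right (s t : GT X) : s ≤ s + t := by
  rcases eq_or_ne t 0 with rfl | h
  · rw [add_zero]
  · have := add_lt_add_left s (pos_iff.2 h)
    rw [add_zero] at this
    exact this.le

/-- Iterating on the remainder: either its first summand is smaller than `p`, or both agree and the
claim passes to the next remainder, with this summand in the role of `p`. -/
lemma ConsOK.lt_cons (h : ConsOK p q) : q < cons p q := by
  refine cons_induction_param (P := fun q p => ConsOK p q → q < cons p q) ?_ ?_ ?_ q p h
  · unfold ConsOK
    fun_prop
  · intro p h
    exact pos_iff.2 h.ne_zero
  · intro a b hab ih p h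
    rw [hab.lt h]
    have h2 := h.2
    rw [hab.hd_eq] at h2
    rcases h2.lt_or_eq with h2 | rfl
    · exact Or.inl h2
    · exact Or.inr ⟨rfl, ih a hab⟩

lemma le_add_left (s t : GT X) : t ≤ s + t := by
  refine cons_induction (P := fun s => t ≤ s + t) (by fun_prop) ?_ (fun p q h ih => ?_) s
  · rw [zero_add]
  · rw [h.add_eq]
    refine ih.trans ?_
    by_cases hlt : p < hd (q + t)
    · rw [padd_of_lt hlt]
    · have hc : ConsOK p (q + t) := ⟨h.1, not_lt.1 hlt⟩
      rw [hc.padd_eq]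
      exact hc.lt_cons.le

lemma add_eq_right (h : hd s < hd t) : s + t = t := by
  refine cons_induction (P := fun s => hd s < hd t → s + t = t) (by fun_prop) ?_
    (fun p q h ih h' => ?_) s h
  · exact fun _ => zero_add t
  · rw [h.hd_eq] at h'
    rw [h.add_eq, ih (h.2.trans_lt h'), padd_of_lt h']

lemma Prin.add_lt (hp : Prin p) (hs : s < p) (ht : t < p) : s + t < p := by
  rw [hp.lt_iff] at hs ht ⊢
  rw [hd_add]
  exact max_lt hs ht

/-! ### Successors -/

noncomputable instance : One (GT X) := ⟨om 0⟩

lemma one_def : (1 : GT X) = om 0 := rfl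

lemma prin_one : Prin (1 : GT X) := prin_om 0

lemma Prin.one_le (hp : Prin p) : 1 ≤ p := by
  rw [← hp.om_lg, one_def]
  exact om_strictMono.monotone (zero_le _)

lemma one_le_iff : 1 ≤ s ↔ s ≠ 0 := by
  constructor
  · rintro h rfl
    exact absurd h (not_le.2 (pos_iff.2 prin_one.ne_zero))
  · intro h
    exact (prin_hd h).one_le.trans (hd_le s)

lemma lt_add_one (s : GT X) : s < s + 1 := by
  have := add_lt_add_left s (pos_iff.2 (prin_one (X := X)).ne_zero)
  rwa [add_zero] at this

lemma add_one_ne_zero (s : GT X) : s + 1 ≠ 0 := pos_iff.1 ((zero_le s).trans_lt (lt_add_one s))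

lemma add_one_le (h : s < t) : s + 1 ≤ t := by
  refine cons_induction_param (P := fun s t => s < t → s + 1 ≤ t) (by fun_prop) ?_ ?_ s t h
  · intro t ht
    rw [zero_add]
    exact one_le_iff.2 ht.ne'
  · intro p q h ih t ht
    rcases zero_or_cons t with rfl | ⟨a, b, h', -, rfl⟩
    · exact absurd ht not_lt_zero
    · rcases (h.lt h').1 ht with hpa | ⟨rfl, hqb⟩
      · refine le_trans (le_of_lt ?_) h'.prin_le
        refine h'.1.add_lt ?_ (h.1.one_le.trans_lt hpa)
        rwa [h'.1.lt_iff, h.hd_eq]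
      · rw [h.add_eq, ← h'.padd_eq]
        exact h.1.padd_le_padd (ih b hqb)

lemma add_one_lt_add_one (h : s < t) : s + 1 < t + 1 := (add_one_le h).trans_lt (lt_add_one t)

/-- The last summand of `u + p` is `p > 1`, so the term is a limit and closed under successors. -/
lemma add_one_lt_of_limit (hp : Prin p) (h1 : 1 < p) (h : s < u + p) : s + 1 < u + p := by
  refine cons_induction_param (P := fun u s => s < u + p → s + 1 < u + p) (by fun_prop) ?_ ?_ u s h
  · intro s hs
    rw [zero_add] at hs ⊢
    exact hp.add_lt hs h1
  · intro a b h ih s hs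
    rw [h.add_eq] at hs ⊢
    by_cases hlt : a < hd (b + p)
    · rw [padd_of_lt hlt] at hs ⊢
      exact ih s hs
    · have hle := not_lt.1 hlt
      have hc : ConsOK a (b + p) := ⟨h.1, hle⟩
      have ha1 : 1 < a := by
        rw [hd_add, hp.hd_eq] at hle
        exact h1.trans_le ((le_max_right _ _).trans hle)
      rw [hc.padd_eq] at hs ⊢
      -- If `s` stays below the first summand, closure of `a` under addition suffices. Otherwise `s`
      -- has the same first summand and the claim passes to the remainders.
      have key : s < a → s + 1 < cons a (b + p) := fun hsa =>
        (h.1.add_lt hsa ha1).trans_le hc.prin_le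
      rcases zero_or_cons s with rfl | ⟨c, d, h', -, rfl⟩
      · exact key (pos_iff.2 h.1.ne_zero)
      · rcases (h'.lt hc).1 hs with hca | ⟨rfl, hd'⟩
        · refine key ?_
          rwa [h.1.lt_iff, h'.hd_eq]
        · rw [h'.add_eq, ← hc.padd_eq]
          exact h'.1.padd_lt_padd (ih d hd')

/-! ### Multiplication by powers of `ω` -/

-- Distributivity reduces `ω^e·t` to the summands `ω^c` of `t`, where `ω^e·ω^c = ω^(e + c)` and the
-- exponent `c` is found by `lg`.
open Classical in
lemma exists_mul : ∃ f : GT X × GT X → GT X, Comp M f ∧ (∀ e, f (e, 0) = 0) ∧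
    ∀ e p q, ConsOK p q → f (e, cons p q) = padd (om (e + lg p)) (f (e, q)) := by
  obtain ⟨f, hf, hf'⟩ := coded_recursion (M := M) (α := GT X × GT X) (β := GT X)
    (g := fun z c => if z.2 = 0 then 0 else if Prin z.2 then om (z.1 + lg z.2)
      else padd (om (z.1 + lg (lft z.2))) (look (GT X) c (z.1, rgt z.2))) (by fun_prop)
  have h0 : ∀ e, f (e, 0) = 0 := fun e => by
    obtain ⟨c, h, -⟩ := hf' (e, 0)
    simpa using h
  refine ⟨f, hf, h0, fun e p q hpq => ?_⟩
  obtain ⟨c, h, h'⟩ := hf' (e, cons p q)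
  rw [h]
  by_cases hq : q = 0
  · subst hq
    simp [hpq.1, hpq.1.ne_zero, h0, (prin_om _).padd_zero]
  · have hs := hpq.sumOK hq
    rw [cons_of_ne hq] at h' ⊢
    simp only [hs.ne_zero, hs.not_prin, if_false, hs.lft_eq, hs.rgt_eq]
    rw [h' (e, q)]
    rw [enc_prod, enc_prod]
    apply pair_lt_pair_of_add_lt
    have := hs.enc_right
    gcongr

/-- The product `ω ^ e · t`. -/
noncomputable def omul (e t : GT X) : GT X := Classical.choose (exists_mul (X := X)) (e, t)

@[fun_prop] lemma comp_omul {f g : α → GT X} (hf : Comp M f) (hg : Comp M g) :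
    Comp M (fun a => omul (f a) (g a)) :=
  (Classical.choose_spec (exists_mul (X := X))).1.comp (hf.prodMk hg)

@[simp] lemma omul_zero (e : GT X) : omul e 0 = 0 :=
  (Classical.choose_spec (exists_mul (X := X))).2.1 e

lemma ConsOK.omul_eq (h : ConsOK p q) (e : GT X) :
    omul e (cons p q) = padd (om (e + lg p)) (omul e q) :=
  (Classical.choose_spec (exists_mul (X := X))).2.2 e p q h

lemma Prin.omul_eq (h : Prin p) (e : GT X) : omul e p = om (e + lg p) := by
  have := h.consOK_zero.omul_eq e
  rwa [cons_zero, omul_zero, (prin_om _).padd_zero] at this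

lemma omul_om (e c : GT X) : omul e (om c) = om (e + c) := by
  rw [(prin_om c).omul_eq, lg_om]

lemma Prin.om_add_lg_lt (hp : Prin p) (hq : Prin q) (e : GT X) (h : p < q) :
    om (e + lg p) < om (e + lg q) :=
  om_lt_om.2 (add_lt_add_left e ((hp.lg_lt_lg hq).2 h))

lemma Prin.om_add_lg_le (hp : Prin p) (hq : Prin q) (e : GT X) (h : p ≤ q) :
    om (e + lg p) ≤ om (e + lg q) := by
  rcases h.lt_or_eq with h | rfl
  · exact (hp.om_add_lg_lt hq e h).le
  · exact le_rfl

lemma hd_omul (e : GT X) (ht : t ≠ 0) : hd (omul e t) = om (e + lg (hd t)) := by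
  refine cons_induction (P := fun t => t ≠ 0 → hd (omul e t) = om (e + lg (hd t))) (by fun_prop)
    (fun h => absurd rfl h) (fun p q h ih _ => ?_) t ht
  rw [h.omul_eq, (prin_om _).hd_padd, h.hd_eq]
  refine max_eq_left ?_
  rcases eq_or_ne q 0 with rfl | hq
  · rw [omul_zero, hd_zero]
    exact zero_le _
  · rw [ih hq]
    exact (prin_hd hq).om_add_lg_le h.1 e h.2

lemma ConsOK.omul (h : ConsOK p q) (e : GT X) : ConsOK (om (e + lg p)) (GT.omul e q) := by
  refine ⟨prin_om _, ?_⟩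
  rcases eq_or_ne q 0 with rfl | hq
  · rw [omul_zero, hd_zero]
    exact zero_le _
  · rw [hd_omul e hq]
    exact (prin_hd hq).om_add_lg_le h.1 e h.2

lemma omul_lt_omul (e : GT X) (h : s < t) : omul e s < omul e t := by
  refine cons_induction_param (P := fun s t => s < t → omul e s < omul e t) (by fun_prop) ?_ ?_ s t h
  · intro t ht
    rcases zero_or_cons t with rfl | ⟨a, b, h, -, rfl⟩
    · exact absurd ht not_lt_zero
    · rw [omul_zero, h.omul_eq, (h.omul e).padd_eq]
      exact pos_iff.2 (h.omul e).ne_zero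
  · intro p q h ih t ht
    rcases zero_or_cons t with rfl | ⟨a, b, h', -, rfl⟩
    · exact absurd ht not_lt_zero
    · rw [h.omul_eq, h'.omul_eq, (h.omul e).padd_eq, (h'.omul e).padd_eq,
        (h.omul e).lt (h'.omul e)]
      rcases (h.lt h').1 ht with hpa | ⟨rfl, hqb⟩
      · exact Or.inl (h.1.om_add_lg_lt h'.1 e hpa)
      · exact Or.inr ⟨rfl, ih b hqb⟩

lemma omul_le_omul (e : GT X) (h : s ≤ t) : omul e s ≤ omul e t := by
  rcases h.lt_or_eq with h | rfl
  · exact (omul_lt_omul e h).le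
  · exact le_rfl

lemma Prin.omul_padd (hp : Prin p) (e t : GT X) :
    omul e (padd p t) = padd (om (e + lg p)) (omul e t) := by
  by_cases h : p < hd t
  · have ht : t ≠ 0 := by
      rintro rfl
      rw [hd_zero] at h
      exact not_lt_zero h
    rw [padd_of_lt h, padd_of_lt]
    rw [hd_omul e ht]
    exact hp.om_add_lg_lt (prin_hd ht) e h
  · have hc : ConsOK p t := ⟨hp, not_lt.1 h⟩
    rw [hc.padd_eq, hc.omul_eq]

lemma omul_add (e s t : GT X) : omul e (s + t) = omul e s + omul e t := by
  refine cons_induction (P := fun s => omul e (s + t) = omul e s + omul e t) (by fun_prop) ?_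
    (fun p q h ih => ?_) s
  · rw [zero_add, omul_zero, zero_add]
  · rw [h.add_eq, h.1.omul_padd, ih, h.omul_eq, (prin_om _).padd_add]

lemma omul_omul (e c t : GT X) : omul e (omul c t) = omul (e + c) t := by
  refine cons_induction (P := fun t => omul e (omul c t) = omul (e + c) t) (by fun_prop) ?_
    (fun p q h ih => ?_) t
  · simp
  · rw [h.omul_eq, (prin_om _).omul_padd, ih, lg_om, h.omul_eq, add_assoc]

/-! ### Values of `φ` -/

/-- For an `ε`-number `e` above `s` and `t` one has `ω^s·t < ω^s·ω^e = ω^(s + e) = ω^e = e`, by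
absorption of `s`. -/
lemma Eps.omul_lt (he : Eps e) (hs : s < e) (ht : t < e) : omul s t < e := by
  have h1 : s + e = e := add_eq_right (by rwa [he.prin.hd_eq, ← he.prin.lt_iff])
  calc omul s t < omul s e := omul_lt_omul s ht
    _ = omul s (om e) := by rw [he.om_eq]
    _ = e := by rw [omul_om, h1, he.om_eq]

lemma Eps.om_lt (he : Eps e) (hs : s < e) : om s < e := by
  have := om_lt_om.2 hs
  rwa [he.om_eq] at this

lemma Eps.add_one_lt (he : Eps e) (hs : s < e) : s + 1 < e := by
  refine he.prin.add_lt hs ?_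
  rw [one_def]
  exact he.om_lt (pos_iff.2 he.prin.ne_zero)

/-- The main induction is on the code of `φ_a b`. In order to descend into `a` and `b`, the claims
are strengthened to all terms that lie below `a` or `b` and have no larger code; a side induction on
these terms then goes through. -/
lemma PhiOK.lt_phi (h : PhiOK a b) : a < phi a b ∧ b < phi a b := by
  refine measure_induction (M := M) (α := GT X × GT X) (m := fun z => (enc (phi z.1 z.2) : M))
    (p := fun z => PhiOK z.1 z.2 → z.1 < phi z.1 z.2 ∧ z.2 < phi z.1 z.2)
    (by fun_prop) (by fun_prop) ?_ (a, b) h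
  clear h
  rintro ⟨a, b⟩ ih h
  replace ih : ∀ c d, PhiOK c d → (enc (phi c d) : M) < enc (phi a b) →
    c < phi c d ∧ d < phi c d := fun c d h h' => ih (c, d) h' h
  have hsub : ∀ c d : GT X, SumOK c d → c < sum c d := fun c d h =>
    (h.prin_lt (sumOK_iff.1 h).1).2 le_rfl
  have ha : ∀ t : GT X, (enc t : M) ≤ enc a → t ≤ a → t < phi a b := by
    refine measure_induction (M := M) (m := fun t : GT X => (enc t : M)) (by fun_prop)
      (by fun_prop) ?_
    intro t iht ht hta
    rcases cases t with rfl | ⟨x, rfl⟩ | ⟨c, d, h', rfl⟩ | ⟨c, d, h', rfl⟩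
    · exact pos_iff.2 h.ne_zero
    · exact h.gam_lt.2 (Or.inl hta)
    · obtain ⟨h1, h2⟩ := ih c d h' (ht.trans_lt h.enc_left)
      rw [h'.lt h]
      exact Or.inl ⟨h1.trans_le hta,
        iht d h'.enc_right (h'.enc_right.le.trans ht) (h2.le.trans hta)⟩
    · rw [h'.lt_prin h.prin]
      exact iht c h'.enc_left (h'.enc_left.le.trans ht) ((hsub c d h').le.trans hta)
  have hb : ∀ t : GT X, (enc t : M) ≤ enc b → t ≤ b → t < phi a b := by
    refine measure_induction (M := M) (m := fun t : GT X => (enc t : M)) (by fun_prop)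
      (by fun_prop) ?_
    intro t iht ht htb
    rcases cases t with rfl | ⟨x, rfl⟩ | ⟨c, d, h', rfl⟩ | ⟨c, d, h', rfl⟩
    · exact pos_iff.2 h.ne_zero
    · exact h.gam_lt.2 (Or.inr htb)
    · obtain ⟨h1, h2⟩ := ih c d h' (ht.trans_lt h.enc_right)
      have h3 := iht d h'.enc_right (h'.enc_right.le.trans ht) (h2.le.trans htb)
      rw [h'.lt h]
      rcases lt_trichotomy c a with hca | rfl | hca
      · exact Or.inl ⟨hca, h3⟩
      · exact Or.inr (Or.inl ⟨rfl, h2.trans_le htb⟩)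
      -- For `a < c` the clause requires `φ_c d < b` rather than `≤`. Equality would mean `h(b) = c
      -- > a`, against the normal form of `φ_a b`.
      · refine Or.inr (Or.inr ⟨hca, lt_of_le_of_ne htb ?_⟩)
        rintro rfl
        have := (phiOK_iff.1 h).1
        rw [h'.hh_eq] at this
        exact absurd hca (not_lt.2 this)
    · rw [h'.lt_prin h.prin]
      exact iht c h'.enc_left (h'.enc_left.le.trans ht) ((hsub c d h').le.trans htb)
  exact ⟨ha a le_rfl le_rfl, hb b le_rfl le_rfl⟩

lemma le_om (s : GT X) : s ≤ om s := by
  by_cases h : Eps s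
  · rw [h.om_eq]
  · rw [om_of_not_eps h]
    exact (phiOK_zero_iff.2 h).lt_phi.2.le

end Arithmetic

end GT

end SecondOrder

namespace SecondOrder

open Model Coded

set_option linter.unusedSectionVars false

/-! ### The transformation `1 + 2 × Y² + X` -/

section Transformation

variable {M : Type*} [CommSemiring M] [LinearOrder M] [IsStrictOrderedRing M] [Model M]
  {X Y : NOrder M} {i j a b c d x y σ τ : M}

@[simp] lemma tMid_inj : tMid i a b = tMid j c d ↔ i = j ∧ a = c ∧ b = d := by
  simp [tMid, pair_inj]

@[simp] lemma tBot_ne_tMid : tBot ≠ tMid i a b := by simp [tBot, tMid, pair_inj]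

@[simp] lemma tBot_ne_tTop : tBot ≠ tTop x := by simp [tBot, tTop, pair_inj]

@[simp] lemma tMid_ne_tTop : tMid i a b ≠ tTop x := by simp [tMid, tTop, pair_inj]

@[simp] lemma tTop_ne_tBot : tTop x ≠ tBot := tBot_ne_tTop.symm

@[simp] lemma tMid_ne_tBot : tMid i a b ≠ tBot := tBot_ne_tMid.symm

lemma mem_gammaTrans : σ ∈ (gammaTrans X Y).carrier ↔
    σ = tBot ∨ (∃ i a b, (i = 0 ∨ i = 1) ∧ a ∈ Y.carrier ∧ b ∈ Y.carrier ∧ σ = tMid i a b) ∨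
      ∃ x ∈ X.carrier, σ = tTop x := by
  constructor
  · rintro (⟨a, ha, rfl⟩ | ⟨b, ⟨q, ⟨i, hi, q, ⟨a, ha, b, hb, rfl⟩, rfl⟩, rfl⟩ | ⟨x, hx, rfl⟩, rfl⟩)
    · have : a = 0 := ha
      subst this
      exact Or.inl rfl
    · exact Or.inr (Or.inl ⟨i, a, b, hi, ha, hb, rfl⟩)
    · exact Or.inr (Or.inr ⟨x, hx, rfl⟩)
  · rintro (rfl | ⟨i, a, b, hi, ha, hb, rfl⟩ | ⟨x, hx, rfl⟩)
    · exact Or.inl ⟨0, rfl, rfl⟩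
    · exact Or.inr ⟨_, Or.inl ⟨_, ⟨i, hi, _, ⟨a, ha, b, hb, rfl⟩, rfl⟩, rfl⟩, rfl⟩
    · exact Or.inr ⟨_, Or.inr ⟨x, hx, rfl⟩, rfl⟩

lemma tBot_mem : tBot ∈ (gammaTrans X Y).carrier := mem_gammaTrans.2 (Or.inl rfl)

lemma tMid_mem : tMid i a b ∈ (gammaTrans X Y).carrier ↔
    (i = 0 ∨ i = 1) ∧ a ∈ Y.carrier ∧ b ∈ Y.carrier := by
  rw [mem_gammaTrans]
  constructor
  · rintro (h | ⟨j, c, d, hj, hc, hd, h⟩ | ⟨x, hx, h⟩)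
    · exact absurd h tMid_ne_tBot
    · obtain ⟨rfl, rfl, rfl⟩ := tMid_inj.1 h
      exact ⟨hj, hc, hd⟩
    · exact absurd h tMid_ne_tTop
  · rintro ⟨hi, ha, hb⟩
    exact Or.inr (Or.inl ⟨i, a, b, hi, ha, hb, rfl⟩)

lemma tTop_mem (hx : x ∈ X.carrier) : tTop x ∈ (gammaTrans X Y).carrier :=
  mem_gammaTrans.2 (Or.inr (Or.inr ⟨x, hx, rfl⟩))

lemma tBot_lt_tMid (hi : i = 0 ∨ i = 1) (ha : a ∈ Y.carrier) (hb : b ∈ Y.carrier) :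
    (gammaTrans X Y).lt tBot (tMid i a b) :=
  Or.inr (Or.inr ⟨0, rfl, _, Or.inl ⟨_, ⟨i, hi, _, ⟨a, ha, b, hb, rfl⟩, rfl⟩, rfl⟩, rfl, rfl⟩)

lemma tBot_lt_tTop (hx : x ∈ X.carrier) : (gammaTrans X Y).lt tBot (tTop x) :=
  Or.inr (Or.inr ⟨0, rfl, _, Or.inr ⟨x, hx, rfl⟩, rfl, rfl⟩)

lemma tMid_lt_tTop (hi : i = 0 ∨ i = 1) (ha : a ∈ Y.carrier) (hb : b ∈ Y.carrier)
    (hx : x ∈ X.carrier) : (gammaTrans X Y).lt (tMid i a b) (tTop x) :=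
  Or.inr (Or.inl ⟨_, _,
    Or.inr (Or.inr ⟨_, ⟨i, hi, _, ⟨a, ha, b, hb, rfl⟩, rfl⟩, x, hx, rfl, rfl⟩), rfl, rfl⟩)

lemma tTop_lt_tTop (h : X.lt x y) : (gammaTrans X Y).lt (tTop x) (tTop y) :=
  Or.inr (Or.inl ⟨_, _, Or.inr (Or.inl ⟨x, y, h, rfl, rfl⟩), rfl, rfl⟩)

lemma tMid_lt_tMid (hi : i = 0 ∨ i = 1) (hj : j = 0 ∨ j = 1) (ha : a ∈ Y.carrier)
    (hb : b ∈ Y.carrier) (hc : c ∈ Y.carrier) (hd : d ∈ Y.carrier)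
    (h : (i = 0 ∧ j = 1) ∨ (i = j ∧ (Y.lt a c ∨ (a = c ∧ Y.lt b d)))) :
    (gammaTrans X Y).lt (tMid i a b) (tMid j c d) := by
  refine Or.inr (Or.inl ⟨_, _, Or.inl ⟨_, _, ⟨i, hi, j, hj, _, ⟨a, ha, b, hb, rfl⟩, _,
    ⟨c, hc, d, hd, rfl⟩, rfl, rfl, ?_⟩, rfl, rfl⟩, rfl, rfl⟩)
  rcases h with h | ⟨h, h'⟩
  · exact Or.inl h
  · exact Or.inr ⟨h, a, ha, c, hc, b, hb, d, hd, rfl, rfl, h'⟩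

/-- The cases of the order on `1 + 2 × Y² + X`. -/
lemma gammaTrans_lt_cases (h : (gammaTrans X Y).lt σ τ) :
    (σ = tBot ∧ ((∃ i a b, (i = 0 ∨ i = 1) ∧ a ∈ Y.carrier ∧ b ∈ Y.carrier ∧ τ = tMid i a b) ∨
      ∃ x ∈ X.carrier, τ = tTop x)) ∨
    (∃ i a b x, (i = 0 ∨ i = 1) ∧ a ∈ Y.carrier ∧ b ∈ Y.carrier ∧ x ∈ X.carrier ∧
      σ = tMid i a b ∧ τ = tTop x) ∨
    (∃ x y, X.lt x y ∧ σ = tTop x ∧ τ = tTop y) ∨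
    ∃ i j a b c d, (i = 0 ∨ i = 1) ∧ (j = 0 ∨ j = 1) ∧ a ∈ Y.carrier ∧ b ∈ Y.carrier ∧
      c ∈ Y.carrier ∧ d ∈ Y.carrier ∧ σ = tMid i a b ∧ τ = tMid j c d ∧
      ((i = 0 ∧ j = 1) ∨ (i = j ∧ (Y.lt a c ∨ (a = c ∧ Y.lt b d)))) := by
  rcases h with ⟨a, a', h, -⟩ | ⟨b, b', h, rfl, rfl⟩ | ⟨a, ha, b, hb, rfl, rfl⟩
  · exact absurd h id
  · rcases h with ⟨q, q', h, rfl, rfl⟩ | ⟨x, y, h, rfl, rfl⟩ | ⟨q, hq, x, hx, rfl, rfl⟩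
    · obtain ⟨i, hi, j, hj, _, ⟨a, ha, b, hb, rfl⟩, _, ⟨c, hc, d, hd, rfl⟩, rfl, rfl, h⟩ := h
      refine Or.inr (Or.inr (Or.inr ⟨i, j, a, b, c, d, hi, hj, ha, hb, hc, hd, rfl, rfl, ?_⟩))
      rcases h with h | ⟨h, a', -, c', -, b', -, d', -, h1, h2, h3⟩
      · exact Or.inl h
      · obtain ⟨rfl, rfl⟩ := pair_inj.1 h1
        obtain ⟨rfl, rfl⟩ := pair_inj.1 h2
        exact Or.inr ⟨h, h3⟩
    · exact Or.inr (Or.inr (Or.inl ⟨x, y, h, rfl, rfl⟩))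
    · obtain ⟨i, hi, _, ⟨a, ha, b, hb, rfl⟩, rfl⟩ := hq
      exact Or.inr (Or.inl ⟨i, a, b, x, hi, ha, hb, hx, rfl, rfl⟩)
  · have : a = 0 := ha
    subst this
    refine Or.inl ⟨rfl, ?_⟩
    rcases hb with ⟨q, ⟨i, hi, _, ⟨a, ha, b, hb, rfl⟩, rfl⟩, rfl⟩ | ⟨x, hx, rfl⟩
    · exact Or.inl ⟨i, a, b, hi, ha, hb, rfl⟩
    · exact Or.inr ⟨x, hx, rfl⟩

lemma supp_tBot : supp sets (gammaTrans X) Y tBot = ∅ := by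
  ext y
  simp only [Set.mem_empty_iff_false, iff_false]
  rintro ⟨-, h⟩
  exact h ∅ (Set.finite_empty.mem_sets) (Set.empty_subset _) tBot_mem

lemma supp_tTop (hx : x ∈ X.carrier) : supp sets (gammaTrans X) Y (tTop x) = ∅ := by
  ext y
  simp only [Set.mem_empty_iff_false, iff_false]
  rintro ⟨-, h⟩
  exact h ∅ (Set.finite_empty.mem_sets) (Set.empty_subset _) (tTop_mem hx)

/-- The intersection ranges over subsets in the model only; the minimal one, `{a, b}`, is among them
because it is finite. -/
lemma supp_tMid (hi : i = 0 ∨ i = 1) (ha : a ∈ Y.carrier) (hb : b ∈ Y.carrier) :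
    supp sets (gammaTrans X) Y (tMid i a b) = {a, b} := by
  ext y
  constructor
  · rintro ⟨-, h⟩
    refine h {a, b} (Set.toFinite _).mem_sets ?_ ?_
    · rintro z (rfl | rfl)
      · exact ha
      · exact hb
    · exact tMid_mem.2 ⟨hi, Or.inl rfl, Or.inr rfl⟩
  · rintro (rfl | rfl)
    · exact ⟨ha, fun Y₀ _ _ h => (tMid_mem.1 h).2.1⟩
    · exact ⟨hb, fun Y₀ _ _ h => (tMid_mem.1 h).2.2⟩

end Transformation

/-! ### Collapsing functions on types -/

section Collapse

variable {M : Type*} [CommSemiring M] [LinearOrder M] [IsStrictOrderedRing M] [Model M]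

/-- A Bachmann–Howard collapse of `1 + 2 × Y² + X`, in terms of its values on `⊥`, on the elements
`⟨0, a, b⟩` and `⟨1, a, b⟩`, and on the elements of `X`. -/
structure Collapse (X Y : LinOrd M) where
  bot : Y.El
  lo : Y.El → Y.El → Y.El
  hi : Y.El → Y.El → Y.El
  top : X.El → Y.El
  comp_lo : Comp M fun z : Y.El × Y.El => lo z.1 z.2
  comp_hi : Comp M fun z : Y.El × Y.El => hi z.1 z.2
  comp_top : Comp M top
  lt_lo : ∀ a b, a < lo a b ∧ b < lo a b
  lt_hi : ∀ a b, a < hi a b ∧ b < hi a b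
  bot_lt_lo : ∀ a b, bot < lo a b
  bot_lt_hi : ∀ a b, bot < hi a b
  bot_lt_top : ∀ x, bot < top x
  lo_lt_lo : ∀ a b c d, a < c ∨ (a = c ∧ b < d) → a < lo c d → b < lo c d → lo a b < lo c d
  lo_lt_hi : ∀ a b c d, a < hi c d → b < hi c d → lo a b < hi c d
  hi_lt_hi : ∀ a b c d, a < c ∨ (a = c ∧ b < d) → a < hi c d → b < hi c d → hi a b < hi c d
  lo_lt_top : ∀ a b x, a < top x → b < top x → lo a b < top x
  hi_lt_top : ∀ a b x, a < top x → b < top x → hi a b < top x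
  top_lt_top : ∀ x y, x < y → top x < top y

variable {X Y : LinOrd M}

lemma comp_of_isInnerFun {α : Type*} [Coded M α] {A : Set M} {θ : M → M}
    (hθ : IsInnerFun sets A Y.carrier θ) {f : α → M} (hf : Comp M f) (hA : ∀ a, f a ∈ A) :
    Comp M (fun a => (⟨θ (f a), hθ.1 _ (hA a)⟩ : Y.El)) := by
  rw [comp_iff_graph]
  have : Comp M fun z : α × Y.El => pair (f z.1) z.2.val ∈ {p : M | ∃ a ∈ A, p = pair a (θ a)} :=
    Comp.mem hθ.2 (by fun_prop)
  refine this.of_iff fun z => ?_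
  constructor
  · intro h
    exact ⟨_, hA z.1, by rw [← h]⟩
  · rintro ⟨a, -, h⟩
    obtain ⟨rfl, h⟩ := pair_inj.1 h
    exact LinOrd.El.ext h.symm

/-- The supports of all elements are known, so the condition on the support turns into one
inequality for each component, and almost monotonicity splits according to the summands of the
transformation. -/
theorem IsCollapse.nonempty_collapse {θ : M → M}
    (hθ : IsCollapse sets (gammaTrans X.toNOrder) Y.toNOrder θ) : Nonempty (Collapse X Y) := by
  have h01 : (0 : M) = 0 ∨ (0 : M) = 1 := Or.inl rfl
  have h11 : (1 : M) = 0 ∨ (1 : M) = 1 := Or.inr rfl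
  have hmid : ∀ {i : M}, (i = 0 ∨ i = 1) → ∀ a b : Y.El,
      tMid i a.val b.val ∈ (gammaTrans X.toNOrder Y.toNOrder).carrier :=
    fun hi a b => tMid_mem.2 ⟨hi, a.mem, b.mem⟩
  have htop : ∀ x : X.El, tTop x.val ∈ (gammaTrans X.toNOrder Y.toNOrder).carrier :=
    fun x => tTop_mem x.mem
  have hsupp : ∀ {i : M}, (i = 0 ∨ i = 1) → ∀ (a b : Y.El) {u : M}, Y.lt a.val u → Y.lt b.val u →
      ∀ y ∈ supp sets (gammaTrans X.toNOrder) Y.toNOrder (tMid i a.val b.val), Y.lt y u := by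
    intro i hi a b u h1 h2 y hy
    rw [supp_tMid hi a.mem b.mem] at hy
    rcases hy with rfl | rfl
    · exact h1
    · exact h2
  have hlt : ∀ {i : M}, (i = 0 ∨ i = 1) → ∀ a b : Y.El,
      Y.lt a.val (θ (tMid i a.val b.val)) ∧ Y.lt b.val (θ (tMid i a.val b.val)) := by
    intro i hi a b
    have := hθ.supp_lt _ (hmid hi a b)
    rw [supp_tMid hi a.mem b.mem] at this
    exact ⟨this _ (Or.inl rfl), this _ (Or.inr rfl)⟩
  have hlex : ∀ {a b c d : Y.El}, a < c ∨ (a = c ∧ b < d) →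
      Y.lt a.val c.val ∨ (a.val = c.val ∧ Y.lt b.val d.val) := by
    rintro a b c d (h | ⟨rfl, h⟩)
    · exact Or.inl h
    · exact Or.inr ⟨rfl, h⟩
  have hmono : ∀ {i j : M}, (i = 0 ∨ i = 1) → (j = 0 ∨ j = 1) → ∀ a b c d : Y.El,
      (i = 0 ∧ j = 1) ∨ (i = j ∧ (Y.lt a.val c.val ∨ (a.val = c.val ∧ Y.lt b.val d.val))) →
      Y.lt a.val (θ (tMid j c.val d.val)) → Y.lt b.val (θ (tMid j c.val d.val)) →
      Y.lt (θ (tMid i a.val b.val)) (θ (tMid j c.val d.val)) := by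
    intro i j hi hj a b c d h h1 h2
    exact hθ.almost_mono _ (hmid hi a b) _ (hmid hj c d)
      (tMid_lt_tMid hi hj a.mem b.mem c.mem d.mem h) (hsupp hi a b h1 h2)
  refine ⟨{
    bot := ⟨θ tBot, hθ.inner.1 _ tBot_mem⟩
    lo := fun a b => ⟨θ (tMid 0 a.val b.val), hθ.inner.1 _ (hmid h01 a b)⟩
    hi := fun a b => ⟨θ (tMid 1 a.val b.val), hθ.inner.1 _ (hmid h11 a b)⟩
    top := fun x => ⟨θ (tTop x.val), hθ.inner.1 _ (htop x)⟩
    comp_lo := comp_of_isInnerFun hθ.inner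
      (f := fun z : Y.El × Y.El => tMid 0 z.1.val z.2.val) (by unfold tMid; fun_prop)
      fun z => hmid h01 z.1 z.2
    comp_hi := comp_of_isInnerFun hθ.inner
      (f := fun z : Y.El × Y.El => tMid 1 z.1.val z.2.val) (by unfold tMid; fun_prop)
      fun z => hmid h11 z.1 z.2
    comp_top := comp_of_isInnerFun hθ.inner
      (f := fun x : X.El => tTop x.val) (by unfold tTop; fun_prop) htop
    lt_lo := hlt h01
    lt_hi := hlt h11
    bot_lt_lo := fun a b => hθ.almost_mono _ tBot_mem _ (hmid h01 a b)
      (tBot_lt_tMid h01 a.mem b.mem) (by simp [supp_tBot])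
    bot_lt_hi := fun a b => hθ.almost_mono _ tBot_mem _ (hmid h11 a b)
      (tBot_lt_tMid h11 a.mem b.mem) (by simp [supp_tBot])
    bot_lt_top := fun x => hθ.almost_mono _ tBot_mem _ (htop x)
      (tBot_lt_tTop x.mem) (by simp [supp_tBot])
    lo_lt_lo := fun a b c d h => hmono h01 h01 a b c d (Or.inr ⟨rfl, hlex h⟩)
    lo_lt_hi := fun a b c d => hmono h01 h11 a b c d (Or.inl ⟨rfl, rfl⟩)
    hi_lt_hi := fun a b c d h => hmono h11 h11 a b c d (Or.inr ⟨rfl, hlex h⟩)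
    lo_lt_top := fun a b x h1 h2 => hθ.almost_mono _ (hmid h01 a b) _ (htop x)
      (tMid_lt_tTop h01 a.mem b.mem x.mem) (hsupp h01 a b h1 h2)
    hi_lt_top := fun a b x h1 h2 => hθ.almost_mono _ (hmid h11 a b) _ (htop x)
      (tMid_lt_tTop h11 a.mem b.mem x.mem) (hsupp h11 a b h1 h2)
    top_lt_top := fun x y h => hθ.almost_mono _ (htop x) _ (htop y)
      (tTop_lt_tTop h) (by simp [supp_tTop x.mem]) }⟩

/-- The order `X` may be empty, in which case its codes cannot be decoded; a default value in the
target serves instead. -/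
lemma exists_extension_to_codes {α β : Type*} [Coded M α] [Coded M β] [Nonempty β] {f : α → β}
    (hf : Comp M f) : ∃ F : M → β, Comp M F ∧ ∀ a, F (enc a) = f a := by
  rcases isEmpty_or_nonempty α with h | h
  · exact ⟨fun _ => Classical.arbitrary β, by fun_prop, fun a => (h.false a).elim⟩
  · exact ⟨fun n => f (dec α n), by fun_prop, fun a => by simp⟩

lemma isInner_gammaTrans_carrier :
    (gammaTrans X.toNOrder Y.toNOrder).carrier ∈ sets := by
  have hX := X.isLinear.comp_mem
  have hY := Y.isLinear.comp_mem
  rw [← comp_mem_iff]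
  have : Comp M fun σ : M => σ = tBot ∨
      ((fstN (sndN (sndN σ)) = 0 ∨ fstN (sndN (sndN σ)) = 1) ∧
        fstN (sndN (sndN (sndN σ))) ∈ Y.carrier ∧ sndN (sndN (sndN (sndN σ))) ∈ Y.carrier ∧
        σ = pair 1 (pair 0 (pair (fstN (sndN (sndN σ)))
          (pair (fstN (sndN (sndN (sndN σ)))) (sndN (sndN (sndN (sndN σ)))))))) ∨
      (sndN (sndN σ) ∈ X.carrier ∧ σ = pair 1 (pair 1 (sndN (sndN σ)))) := by
    fun_prop
  refine this.of_iff fun σ => ?_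
  rw [mem_gammaTrans]
  refine or_congr Iff.rfl (or_congr ?_ ?_)
  · constructor
    · rintro ⟨i, a, b, hi, ha, hb, rfl⟩
      simp [tMid, hi, ha, hb]
    · rintro ⟨hi, ha, hb, h⟩
      exact ⟨_, _, _, hi, ha, hb, h⟩
  · constructor
    · rintro ⟨x, hx, rfl⟩
      simp [tTop, hx]
    · rintro ⟨hx, h⟩
      exact ⟨_, hx, h⟩

open Classical in
theorem Collapse.exists_isCollapse (D : Collapse X Y) : ∃ θ : M → M,
    IsCollapse sets (gammaTrans X.toNOrder) Y.toNOrder θ ∧ θ tBot = D.bot.val ∧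
    (∀ a b : Y.El, θ (tMid 0 a.val b.val) = (D.lo a b).val) ∧
    (∀ a b : Y.El, θ (tMid 1 a.val b.val) = (D.hi a b).val) ∧
    ∀ x : X.El, θ (tTop x.val) = (D.top x).val := by
  have : Nonempty Y.El := ⟨D.bot⟩
  obtain ⟨L, hL, hL'⟩ := exists_extension_to_codes D.comp_lo
  obtain ⟨H, hH, hH'⟩ := exists_extension_to_codes D.comp_hi
  obtain ⟨T, hT, hT'⟩ := exists_extension_to_codes D.comp_top
  -- After `⊥` has been excluded, the first tag that is left separates `X` from the product, and the
  -- next one is the index `i`. The pair of the two arguments is passed on undivided, since it is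
  -- already the code of an element of the product type.
  let θ : M → M := fun σ => if σ = tBot then D.bot.val else
    if fstN (sndN σ) = 1 then (T (sndN (sndN σ))).val else
    if fstN (sndN (sndN σ)) = 0 then (L (sndN (sndN (sndN σ)))).val else
      (H (sndN (sndN (sndN σ)))).val
  have hθ : Comp M θ := by
    unfold θ
    fun_prop
  have h0 : θ tBot = D.bot.val := by simp [θ]
  have hlo : ∀ a b : Y.El, θ (tMid 0 a.val b.val) = (D.lo a b).val := by
    intro a b
    have h1 : θ (tMid 0 a.val b.val) = (L (pair a.val b.val)).val := by simp [θ]; simp [tMid]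
    rw [h1, ← hL' (a, b)]
    rfl
  have hhi : ∀ a b : Y.El, θ (tMid 1 a.val b.val) = (D.hi a b).val := by
    intro a b
    have h1 : θ (tMid 1 a.val b.val) = (H (pair a.val b.val)).val := by simp [θ]; simp [tMid]
    rw [h1, ← hH' (a, b)]
    rfl
  have htop : ∀ x : X.El, θ (tTop x.val) = (D.top x).val := by
    intro x
    have h1 : θ (tTop x.val) = (T x.val).val := by simp [θ]; simp [tTop]
    rw [h1, ← hT' x]
    rfl
  refine ⟨θ, ⟨⟨?_, ?_⟩, ?_, ?_⟩, h0, hlo, hhi, htop⟩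
  · intro σ hσ
    rcases mem_gammaTrans.1 hσ with rfl | ⟨i, a, b, rfl | rfl, ha, hb, rfl⟩ | ⟨x, hx, rfl⟩
    · rw [h0]; exact D.bot.mem
    · rw [hlo ⟨a, ha⟩ ⟨b, hb⟩]; exact LinOrd.El.mem _
    · rw [hhi ⟨a, ha⟩ ⟨b, hb⟩]; exact LinOrd.El.mem _
    · rw [htop ⟨x, hx⟩]; exact LinOrd.El.mem _
  · have hc := comp_mem_iff.2 (isInner_gammaTrans_carrier (X := X) (Y := Y))
    have : Comp M fun z : M × M =>
        z.1 ∈ (gammaTrans X.toNOrder Y.toNOrder).carrier ∧ z.2 = θ z.1 := by fun_prop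
    rw [comp_prop_iff] at this
    convert this using 1
    ext p
    simp only [Set.mem_ofPred_eq, Prod.exists, enc_prod, enc_id]
    constructor
    · rintro ⟨σ, hσ, rfl⟩
      exact ⟨σ, _, rfl, hσ, rfl⟩
    · rintro ⟨σ, _, rfl, hσ, rfl⟩
      exact ⟨σ, hσ, rfl⟩
  · intro σ _ τ _ hστ hsupp
    have hs : ∀ {i a b : M}, (i = 0 ∨ i = 1) → ∀ (ha : a ∈ Y.carrier) (hb : b ∈ Y.carrier) {u : M},
        (∀ y ∈ supp sets (gammaTrans X.toNOrder) Y.toNOrder (tMid i a b), Y.lt y u) →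
        Y.lt a u ∧ Y.lt b u := by
      intro i a b hi ha hb u h
      rw [supp_tMid hi ha hb] at h
      exact ⟨h _ (Or.inl rfl), h _ (Or.inr rfl)⟩
    rcases gammaTrans_lt_cases hστ with ⟨rfl, ⟨i, a, b, hi, ha, hb, rfl⟩ | ⟨x, hx, rfl⟩⟩ |
      ⟨i, a, b, x, hi, ha, hb, hx, rfl, rfl⟩ | ⟨x, y, h, rfl, rfl⟩ |
      ⟨i, j, a, b, c, d, hi, hj, ha, hb, hc, hd, rfl, rfl, h⟩
    · rcases hi with rfl | rfl
      · rw [h0, hlo ⟨a, ha⟩ ⟨b, hb⟩]; exact D.bot_lt_lo _ _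
      · rw [h0, hhi ⟨a, ha⟩ ⟨b, hb⟩]; exact D.bot_lt_hi _ _
    · rw [h0, htop ⟨x, hx⟩]; exact D.bot_lt_top _
    · obtain ⟨h1, h2⟩ := hs hi ha hb hsupp
      rw [htop ⟨x, hx⟩] at h1 h2 ⊢
      rcases hi with rfl | rfl
      · rw [hlo ⟨a, ha⟩ ⟨b, hb⟩]; exact D.lo_lt_top _ _ _ h1 h2
      · rw [hhi ⟨a, ha⟩ ⟨b, hb⟩]; exact D.hi_lt_top _ _ _ h1 h2
    · obtain ⟨hx, hy⟩ := X.isLinear.lt_field _ _ h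
      rw [htop ⟨x, hx⟩, htop ⟨y, hy⟩]
      exact D.top_lt_top _ _ h
    · obtain ⟨h1, h2⟩ := hs hi ha hb hsupp
      have hlex : (Y.lt a c ∨ (a = c ∧ Y.lt b d)) → (⟨a, ha⟩ : Y.El) < ⟨c, hc⟩ ∨
          ((⟨a, ha⟩ : Y.El) = ⟨c, hc⟩ ∧ (⟨b, hb⟩ : Y.El) < ⟨d, hd⟩) := by
        rintro (h' | ⟨rfl, h'⟩)
        · exact Or.inl h'
        · exact Or.inr ⟨rfl, h'⟩
      rcases hi with rfl | rfl
      · rcases hj with rfl | rfl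
        · rw [hlo ⟨c, hc⟩ ⟨d, hd⟩] at h1 h2 ⊢
          rw [hlo ⟨a, ha⟩ ⟨b, hb⟩]
          refine D.lo_lt_lo _ _ _ _ (hlex ?_) h1 h2
          rcases h with h | h
          · exact absurd h.2 zero_ne_one
          · exact h.2
        · rw [hhi ⟨c, hc⟩ ⟨d, hd⟩] at h1 h2 ⊢
          rw [hlo ⟨a, ha⟩ ⟨b, hb⟩]
          exact D.lo_lt_hi _ _ _ _ h1 h2
      · rcases hj with rfl | rfl
        · rcases h with h | h
          · exact absurd h.2 zero_ne_one
          · exact absurd h.1 one_ne_zero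
        · rw [hhi ⟨c, hc⟩ ⟨d, hd⟩] at h1 h2 ⊢
          rw [hhi ⟨a, ha⟩ ⟨b, hb⟩]
          refine D.hi_lt_hi _ _ _ _ (hlex ?_) h1 h2
          rcases h with h | h
          · exact absurd h.1 one_ne_zero
          · exact h.2
  · intro σ hσ
    rcases mem_gammaTrans.1 hσ with rfl | ⟨i, a, b, rfl | rfl, ha, hb, rfl⟩ | ⟨x, hx, rfl⟩
    · simp [supp_tBot]
    · rw [supp_tMid (Or.inl rfl) ha hb, hlo ⟨a, ha⟩ ⟨b, hb⟩]
      rintro y (rfl | rfl)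
      · exact (D.lt_lo ⟨y, ha⟩ ⟨b, hb⟩).1
      · exact (D.lt_lo ⟨a, ha⟩ ⟨y, hb⟩).2
    · rw [supp_tMid (Or.inr rfl) ha hb, hhi ⟨a, ha⟩ ⟨b, hb⟩]
      rintro y (rfl | rfl)
      · exact (D.lt_hi ⟨y, ha⟩ ⟨b, hb⟩).1
      · exact (D.lt_hi ⟨a, ha⟩ ⟨y, hb⟩).2
    · simp [supp_tTop hx]

end Collapse

end SecondOrder

namespace SecondOrder

open Model Coded

set_option linter.unusedSectionVars false

section Main

variable {M : Type*} [CommSemiring M] [LinearOrder M] [IsStrictOrderedRing M] [Model M]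
  {X : LinOrd M}

/-! ### The collapse of the notation system -/

namespace GT

variable {a b c d s t e : GT X}

/-- A successor is `1 = φ_0 0` or a proper sum. Therefore `φ_a (b + 1)` is a normal form for all `a`
and `b`, which is the purpose of the successor in the definition of the collapse. -/
lemma hh_add_one (s : GT X) : hh (s + 1) = 0 := by
  rcases zero_or_cons s with rfl | ⟨p, q, h, -, rfl⟩
  · have h0 : PhiOK (0 : GT X) 0 := phiOK_zero_iff.2 not_eps_zero
    rw [zero_add, one_def, om_of_not_eps not_eps_zero, h0.hh_eq]
  · have hle : hd (q + 1) ≤ p := by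
      rw [hd_add, prin_one.hd_eq]
      exact max_le h.2 h.1.one_le
    have hc : ConsOK p (q + 1) := ⟨h.1, hle⟩
    have hq := add_one_ne_zero q
    rw [h.add_eq, hc.padd_eq, cons_of_ne hq, (hc.sumOK hq).hh_eq]

lemma phiOK_add_one (a b : GT X) : PhiOK a (b + 1) :=
  phiOK_iff.2 ⟨by rw [hh_add_one]; exact zero_le a, fun _ => add_one_ne_zero b⟩

lemma one_add_ne_zero (a : GT X) : 1 + a ≠ 0 := one_le_iff.1 (le_add_right 1 a)

/-- The summand `1` in the subscript excludes the powers `φ_0 (b + 1)`, which are no `ε`-numbers and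
would not be closed under the values with index `0`. -/
lemma eps_phi_one_add (a b : GT X) : Eps (phi (1 + a) (b + 1)) :=
  (phiOK_add_one _ b).eps_iff.2 (one_add_ne_zero a)

lemma omul_one (e : GT X) : omul e 1 = om e := by
  rw [one_def, omul_om, add_zero]

lemma le_omul (e t : GT X) : t ≤ omul e t := by
  refine cons_induction (P := fun t => t ≤ omul e t) (by fun_prop) (zero_le _)
    (fun p q h ih => ?_) t
  rw [h.omul_eq, (h.omul e).padd_eq, ← not_lt, (h.omul e).lt h]
  have hp : p ≤ om (e + lg p) := by
    conv_lhs => rw [← h.1.om_lg]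
    exact om_strictMono.monotone (le_add_left _ _)
  rintro (h' | ⟨-, h'⟩)
  · exact absurd hp (not_le.2 h')
  · exact absurd ih (not_le.2 h')

/-- Multiplication by `ω^ω^a` takes `s` below `ω^(ω^a + ω^c)·t`, and `ω^a` is absorbed by `ω^c`. -/
lemma omul_om_lt_omul_om (hac : a < c) (h : s < omul (om c) t) :
    omul (om a) s < omul (om c) t := by
  have hlt := om_lt_om.2 hac
  have h1 : om a + om c = om c :=
    add_eq_right (by rwa [(prin_om a).hd_eq, (prin_om c).hd_eq])
  calc omul (om a) s < omul (om a) (omul (om c) t) := omul_lt_omul _ h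
    _ = omul (om c) t := by rw [omul_omul, h1]

/-- The product is `ω^e·t + ω^e` with `ω^e > 1`, hence a limit. -/
lemma add_one_lt_omul (he : e ≠ 0) (h : s < omul e (t + 1)) : s + 1 < omul e (t + 1) := by
  rw [omul_add, omul_one] at h ⊢
  exact add_one_lt_of_limit (prin_om e) (om_lt_om.2 (pos_iff.2 he)) h

lemma Eps.lo_lt (he : Eps e) (ha : a < e) (hb : b < e) : omul (om (a + 1)) (b + 1) < e :=
  he.omul_lt (he.om_lt (he.add_one_lt ha)) (he.add_one_lt hb)

/-- The collapse with values `0`, `ω ^ ω ^ (α + 1) · (β + 1)`, `φ_(1 + α) (β + 1)` and `Γ_x`. -/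
noncomputable def collapse (X : LinOrd M) : Collapse X (gammaOrd X) where
  bot := (0 : GT X)
  lo a b := omul (om (a + 1)) (b + 1)
  hi a b := phi (1 + a) (b + 1)
  top := gam
  comp_lo := by fun_prop
  comp_hi := by fun_prop
  comp_top := Comp.of_val (by
    change Comp M fun x : X.El => gammaT x.val
    fun_prop)
  lt_lo a b := by
    constructor
    · calc a < a + 1 := lt_add_one a
        _ ≤ om (a + 1) := le_om _
        _ ≤ om (om (a + 1)) := le_om _
        _ = omul (om (a + 1)) 1 := (omul_one _).symm
        _ ≤ omul (om (a + 1)) (b + 1) := omul_le_omul _ (le_add_left b 1)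
    · exact (lt_add_one b).trans_le (le_omul _ _)
  lt_hi a b := by
    have h := (phiOK_add_one (1 + a) b).lt_phi
    exact ⟨(le_add_left 1 a).trans_lt h.1, (lt_add_one b).trans h.2⟩
  bot_lt_lo a b := (zero_le b).trans_lt ((lt_add_one b).trans_le (le_omul _ _))
  bot_lt_hi a b := pos_iff.2 (phiOK_add_one _ b).ne_zero
  bot_lt_top x := pos_iff.2 gam_ne_zero
  lo_lt_lo a b c d h _ h2 := by
    rcases h with h | ⟨rfl, h⟩
    -- The hypothesis bounds `b`, but the factor is `b + 1`; the difference is harmless because the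
    -- bound is a limit.
    · exact omul_om_lt_omul_om (add_one_lt_add_one h) (add_one_lt_omul (prin_om _).ne_zero h2)
    · exact omul_lt_omul _ (add_one_lt_add_one h)
  lo_lt_hi a b c d h1 h2 := (eps_phi_one_add c d).lo_lt h1 h2
  hi_lt_hi a b c d h h1 h2 := by
    rw [(phiOK_add_one _ b).lt (phiOK_add_one _ d)]
    rcases h with h | ⟨rfl, h⟩
    · exact Or.inl ⟨add_lt_add_left 1 h, (eps_phi_one_add c d).add_one_lt h2⟩
    · exact Or.inr (Or.inl ⟨rfl, add_one_lt_add_one h⟩)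
  lo_lt_top a b x h1 h2 := eps_gam.lo_lt h1 h2
  hi_lt_top a b x h1 h2 := by
    rw [(phiOK_add_one _ b).lt_gam]
    refine ⟨eps_gam.prin.add_lt ?_ h1, eps_gam.add_one_lt h2⟩
    exact eps_gam.om_lt (pos_iff.2 gam_ne_zero)
  top_lt_top x y h := gam_lt_gam.2 h

/-! ### The embedding into a Bachmann–Howard fixed point -/

lemma Prin.enc_lg_le {p : GT X} (hp : Prin p) : (enc (lg p) : M) ≤ enc p := by
  by_cases he : Eps p
  · rw [lg, if_pos he]
  · rcases cases p with rfl | ⟨x, rfl⟩ | ⟨a, b, h, rfl⟩ | ⟨a, b, h, rfl⟩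
    · exact absurd hp not_prin_zero
    · exact absurd eps_gam he
    · rw [lg, if_neg he, h.rgt_eq]
      exact h.enc_right.le
    · exact absurd hp h.not_prin

/-- Every nonzero term that is no `ε`-number has the form `ω ^ a + q` with smaller `a` and `q`. -/
lemma zero_or_eps_or_cons (s : GT X) : s = 0 ∨ (∃ x, s = gam x) ∨
    (∃ a b, PhiOK a b ∧ a ≠ 0 ∧ s = phi a b) ∨
    (s ≠ 0 ∧ ¬ Eps s ∧ ∃ a q, ConsOK (om a) q ∧ (enc a : M) < enc s ∧ (enc q : M) < enc s ∧
      s = cons (om a) q ∧ a = lg (hd s)) := by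
  by_cases hs : Eps s
  · rcases cases s with h | h | ⟨a, b, h, rfl⟩ | ⟨a, b, h, rfl⟩
    · exact Or.inl h
    · exact Or.inr (Or.inl h)
    · exact Or.inr (Or.inr (Or.inl ⟨a, b, h, h.eps_iff.1 hs, rfl⟩))
    · exact absurd hs h.not_eps
  · rcases zero_or_cons s with rfl | ⟨p, q, h, hq, rfl⟩
    · exact Or.inl rfl
    · refine Or.inr (Or.inr (Or.inr ⟨h.ne_zero, hs, lg p, q, ?_, ?_, hq, ?_, ?_⟩))
      · rwa [h.1.om_lg]
      · rcases eq_or_ne q 0 with rfl | hq0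
        -- The term equals the power `ω^a` and is no `ε`-number, so it is `φ_0 a` and `a` is a
        -- proper subterm. This strict decrease fails for `ε`-numbers, which explains their separate
        -- treatment.
        · rw [cons_zero] at hs ⊢
          rcases cases p with rfl | ⟨x, rfl⟩ | ⟨a, b, h', rfl⟩ | ⟨a, b, h', rfl⟩
          · exact absurd h.1 not_prin_zero
          · exact absurd eps_gam hs
          · rw [lg, if_neg hs, h'.rgt_eq]
            exact h'.enc_right
          · exact absurd h.1 h'.not_prin
        · rw [cons_of_ne hq0]
          exact h.1.enc_lg_le.trans_lt (h.sumOK hq0).enc_left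
      · rw [h.1.om_lg]
      · rw [h.hd_eq]

-- The values of the embedding. A term that is no `ε`-number is mapped by its leading exponent and
-- its remainder: the lexicographic order of Cantor normal forms matches that of the elements with
-- index `0`. The inequalities between codes guarantee that the previous values are available.
open Classical in
lemma exists_embedding_values {Z : LinOrd M} (D : Collapse X Z) : ∃ f : GT X → Z.El, Comp M f ∧
    f 0 = D.bot ∧ (∀ x, f (gam x) = D.top x) ∧
    (∀ a b, PhiOK a b → a ≠ 0 → f (phi a b) = D.hi (f a) (f b)) ∧
    ∀ a q, ConsOK (om a) q → ¬ Eps (cons (om a) q) → (enc a : M) < enc (cons (om a) q) →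
      (enc q : M) < enc (cons (om a) q) → f (cons (om a) q) = D.lo (f a) (f q) := by
  have : Nonempty Z.El := ⟨D.bot⟩
  obtain ⟨T, hT, hT'⟩ := exists_extension_to_codes D.comp_top
  have hlo : ∀ {α : Type _} [Coded M α] {f g : α → Z.El}, Comp M f → Comp M g →
      Comp M fun a => D.lo (f a) (g a) := fun hf hg => D.comp_lo.comp (hf.prodMk hg)
  have hhi : ∀ {α : Type _} [Coded M α] {f g : α → Z.El}, Comp M f → Comp M g →
      Comp M fun a => D.hi (f a) (g a) := fun hf hg => D.comp_hi.comp (hf.prodMk hg)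
  obtain ⟨f, hf, hf'⟩ := coded_recursion (M := M) (α := GT X) (β := Z.El)
    (g := fun s c => if s = 0 then D.bot else if IsGam s.val then T (argT s.val)
      else if Eps s then D.hi (look Z.El c (lft s)) (look Z.El c (rgt s))
      -- For a power of `ω` the remainder is `0`; its value is known in advance, so no lookup is
      -- needed.
      else if Prin s then D.lo (look Z.El c (lg s)) D.bot
      else D.lo (look Z.El c (lg (hd s))) (look Z.El c (rgt s))) (by
        have h1 : Comp M fun z : GT X × M =>
          D.hi (look Z.El z.2 (lft z.1)) (look Z.El z.2 (rgt z.1)) :=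
            hhi (by fun_prop) (by fun_prop)
        have h2 : Comp M fun z : GT X × M => D.lo (look Z.El z.2 (lg z.1)) D.bot :=
          hlo (by fun_prop) (by fun_prop)
        have h3 : Comp M fun z : GT X × M =>
          D.lo (look Z.El z.2 (lg (hd z.1))) (look Z.El z.2 (rgt z.1)) :=
            hlo (by fun_prop) (by fun_prop)
        fun_prop)
  have h0 : f 0 = D.bot := by
    obtain ⟨c, h, -⟩ := hf' 0
    simpa using h
  refine ⟨f, hf, h0, fun x => ?_, fun a b h ha => ?_, fun a q h he h1 h2 => ?_⟩
  · obtain ⟨c, h, -⟩ := hf' (gam x)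
    rw [h, if_neg gam_ne_zero, if_pos (by rw [val_gam]; simp), val_gam, argT_gammaT]
    exact hT' x
  · obtain ⟨c, h', h''⟩ := hf' (phi a b)
    rw [h', if_neg h.ne_zero, if_neg (by rw [h.val]; simp), if_pos (h.eps_iff.2 ha), h.lft_eq,
      h.rgt_eq, h'' _ h.enc_left, h'' _ h.enc_right]
  · obtain ⟨c, h', h''⟩ := hf' (cons (om a) q)
    have hg : ¬ IsGam (cons (om a) q).val := fun hg => he (by
      unfold Eps
      rw [hg]
      exact .gamma _)
    rw [h', if_neg h.ne_zero, if_neg hg, if_neg he]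
    rcases eq_or_ne q 0 with rfl | hq
    · rw [cons_zero] at h1 h'' ⊢
      rw [if_pos h.1, lg_om, h'' _ h1, h0]
    · have hs := h.sumOK hq
      rw [cons_of_ne hq] at h1 h2 h'' ⊢
      rw [if_neg hs.not_prin, hs.hd_eq, hs.rgt_eq, lg_om, h'' _ h1, h'' _ h2]

/-- Each clause of the order corresponds to a property of the collapse. If `s` is at most a
constituent of `t`, then `f s` lies below `f t` by the bound on supports. Otherwise almost
monotonicity applies, its premises being the induction hypothesis for constituents of `s` in
comparison with `t` or with constituents of `t`. -/
theorem exists_strictMono {Z : LinOrd M} (D : Collapse X Z) :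
    ∃ f : GT X → Z.El, Comp M f ∧ StrictMono f := by
  obtain ⟨f, hf, h0, hgam, hphi, hcons⟩ := exists_embedding_values D
  refine ⟨f, hf, fun s t hst => ?_⟩
  refine measure_induction (M := M) (α := GT X × GT X) (m := fun z => enc z.1 + enc z.2)
    (p := fun z => z.1 < z.2 → f z.1 < f z.2) (by fun_prop) (by fun_prop) ?_ (s, t) hst
  clear hst s t
  rintro ⟨s, t⟩ ih hst
  dsimp only at ih hst ⊢
  replace ih : ∀ a b : GT X, (enc a : M) + enc b < enc s + enc t → a < b → f a < f b :=
    fun a b => ih (a, b)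
  have ih' : ∀ a b : GT X, (enc a : M) + enc b < enc s + enc t → a ≤ b → f a ≤ f b := by
    intro a b hab h
    rcases h.lt_or_eq with h | rfl
    · exact (ih a b hab h).le
    · exact le_rfl
  rcases zero_or_eps_or_cons t with rfl | ⟨y, rfl⟩ | ⟨c, d, ht, hc, rfl⟩ |
    ⟨-, ht, c, r, hcr, hce, hre, rfl, -⟩
  · exact absurd hst not_lt_zero
  · rw [hgam]
    rcases zero_or_eps_or_cons s with rfl | ⟨x, rfl⟩ | ⟨a, b, hs, ha, rfl⟩ |
      ⟨-, hs, a, q, haq, hae, hqe, rfl, -⟩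
    · rw [h0]
      exact D.bot_lt_top y
    · rw [hgam]
      exact D.top_lt_top x y (gam_lt_gam.1 hst)
    · rw [hs.lt_gam] at hst
      have e1 := hs.enc_left
      have e2 := hs.enc_right
      rw [hphi a b hs ha]
      refine D.hi_lt_top _ _ _ ?_ ?_ <;> rw [← hgam]
      · exact ih _ _ (by gcongr) hst.1
      · exact ih _ _ (by gcongr) hst.2
    · rw [hcons a q haq hs hae hqe]
      refine D.lo_lt_top _ _ _ ?_ ?_ <;> rw [← hgam]
      · refine ih _ _ (by gcongr) ?_
        -- The leading power `ω^a` lies below the `ε`-number `Γ_y = ω^(Γ_y)`, so `a` lies below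
        -- `Γ_y`. The same argument works for `φ_c d` with `c ≠ 0`.
        have := haq.prin_le.trans_lt hst
        rwa [← eps_gam.om_eq, om_lt_om] at this
      · exact ih _ _ (by gcongr) (haq.lt_cons.trans hst)
  · have e1 := ht.enc_left
    have e2 := ht.enc_right
    rw [hphi c d ht hc]
    rcases zero_or_eps_or_cons s with rfl | ⟨x, rfl⟩ | ⟨a, b, hs, ha, rfl⟩ |
      ⟨-, hs, a, q, haq, hae, hqe, rfl, -⟩
    · rw [h0]
      exact D.bot_lt_hi _ _
    · rcases ht.gam_lt.1 hst with h | h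
      · exact (ih' _ _ (by gcongr) h).trans_lt (D.lt_hi _ _).1
      · exact (ih' _ _ (by gcongr) h).trans_lt (D.lt_hi _ _).2
    · have e3 := hs.enc_left
      have e4 := hs.enc_right
      rcases (hs.lt ht).1 hst with ⟨h1, h2⟩ | ⟨rfl, h2⟩ | ⟨h1, h2⟩
      · have i1 := ih a c (by gcongr) h1
        have i2 := ih b _ (by gcongr) h2
        rw [hphi c d ht hc] at i2
        rw [hphi a b hs ha]
        exact D.hi_lt_hi _ _ _ _ (Or.inl i1) (i1.trans (D.lt_hi _ _).1) i2
      · have i2 := ih b d (by gcongr) h2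
        rw [hphi a b hs ha]
        exact D.hi_lt_hi _ _ _ _ (Or.inr ⟨rfl, i2⟩) (D.lt_hi _ _).1 (i2.trans (D.lt_hi _ _).2)
      · exact (ih _ d (by gcongr) h2).trans (D.lt_hi _ _).2
    · have he := ht.eps_iff.2 hc
      rw [hcons a q haq hs hae hqe]
      refine D.lo_lt_hi _ _ _ _ ?_ ?_ <;> rw [← hphi c d ht hc]
      · refine ih _ _ (by gcongr) ?_
        have := haq.prin_le.trans_lt hst
        rwa [← he.om_eq, om_lt_om] at this
      · exact ih _ _ (by gcongr) (haq.lt_cons.trans hst)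
  · rw [hcons c r hcr ht hce hre]
    -- An `ε`-number `s = ω^s` below `ω^c + r` satisfies `ω^s ≤ ω^c`, thus `s ≤ c`, and the bound on
    -- supports suffices.
    have key : Eps s → f s < D.lo (f c) (f r) := fun hs => by
      refine (ih' s c (by gcongr) ?_).trans_lt (D.lt_lo _ _).1
      have := (hs.prin.le_iff _).1 hst.le
      rw [hcr.hd_eq, ← hs.om_eq] at this
      exact om_strictMono.le_iff_le.1 this
    rcases zero_or_eps_or_cons s with rfl | ⟨x, rfl⟩ | ⟨a, b, hs, ha, rfl⟩ |
      ⟨-, hs, a, q, haq, hae, hqe, rfl, -⟩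
    · rw [h0]
      exact D.bot_lt_lo _ _
    · exact key eps_gam
    · exact key (hs.eps_iff.2 ha)
    · rw [hcons a q haq hs hae hqe]
      rcases (haq.lt hcr).1 hst with h | ⟨h, h'⟩
      · have i1 := ih a c (by gcongr) (om_lt_om.1 h)
        have i2 := ih q _ (by gcongr) (haq.lt_cons.trans hst)
        rw [hcons c r hcr ht hce hre] at i2
        exact D.lo_lt_lo _ _ _ _ (Or.inl i1) (i1.trans (D.lt_lo _ _).1) i2
      · have hac := om_strictMono.injective h
        subst hac
        have i2 := ih q r (by gcongr) h'
        exact D.lo_lt_lo _ _ _ _ (Or.inr ⟨rfl, i2⟩) (D.lt_lo _ _).1 (i2.trans (D.lt_lo _ _).2)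

/-! ### Arithmetic on codes -/

open Classical in
lemma val_om (s : GT X) : (om s).val = omegaT s.val := by
  unfold om omegaT
  by_cases h : Eps s
  · rw [if_pos h, if_pos (show IsEps s.val from h)]
  · rw [if_neg h, if_neg (show ¬ IsEps s.val from h), (phiOK_zero_iff.2 h).val, val_zero]

lemma val_one : (1 : GT X).val = oneT := by
  rw [one_def, om_of_not_eps not_eps_zero, (phiOK_zero_iff.2 not_eps_zero).val, val_zero, oneT]

/-- Addition on codes. -/
noncomputable def addN (X : LinOrd M) (m n : M) : M := (ofCode X m + ofCode X n).val

/-- Multiplication by powers of `ω` on codes. -/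
noncomputable def omulN (X : LinOrd M) (m n : M) : M := (omul (ofCode X m) (ofCode X n)).val

@[simp] lemma addN_val (s t : GT X) : addN X s.val t.val = (s + t).val := by simp [addN]

@[simp] lemma omulN_val (s t : GT X) : omulN X s.val t.val = (omul s t).val := by simp [omulN]

lemma isInnerFun₂_of_comp {A : Set M} (hA : A ∈ sets) {f : M → M → M}
    (hf : Comp M fun z : M × M => f z.1 z.2) (h : ∀ a ∈ A, ∀ b ∈ A, f a b ∈ A) :
    IsInnerFun₂ sets A f := by
  refine ⟨h, ?_⟩
  have hA' := comp_mem_iff.2 hA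
  have hf' : Comp M fun z : (M × M) × M => f z.1.1 z.1.2 :=
    hf.comp (f := fun z : (M × M) × M => z.1) (by fun_prop)
  have : Comp M fun z : (M × M) × M => z.1.1 ∈ A ∧ z.1.2 ∈ A ∧ z.2 = f z.1.1 z.1.2 := by
    fun_prop
  rw [comp_prop_iff] at this
  convert this using 1
  ext p
  simp only [Set.mem_ofPred_eq, Prod.exists, enc_prod, enc_id]
  constructor
  · rintro ⟨a, ha, b, hb, rfl⟩
    exact ⟨a, b, _, rfl, ha, hb, rfl⟩
  · rintro ⟨a, b, _, rfl, ha, hb, rfl⟩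
    exact ⟨a, ha, b, hb, rfl⟩

lemma isHead_val {t : GT X} {c : M} (h : IsHead t.val c) : t ≠ 0 ∧ c = (hd t).val := by
  rw [isHead_iff] at h
  rcases cases t with rfl | ⟨x, rfl⟩ | ⟨a, b, ht, rfl⟩ | ⟨a, b, ht, rfl⟩
  · simp [val_zero] at h
  · exact ⟨gam_ne_zero, by rw [h.2, prin_gam.hd_eq, val_gam, headT_gammaT]⟩
  · exact ⟨ht.ne_zero, by rw [h.2, ht.prin.hd_eq, ht.val, headT_phiT]⟩
  · exact ⟨ht.ne_zero, by rw [h.2, ht.hd_eq, ht.val, headT_sumT]⟩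

lemma exists_sumOK {p q : M} (h : sumT p q ∈ (gammaOrd X).carrier) :
    ∃ a b : GT X, SumOK a b ∧ p = a.val ∧ q = b.val :=
  ⟨⟨p, ((gammaOrd_isGammaSystem X).of_sumT h).1⟩, ⟨q, ((gammaOrd_isGammaSystem X).of_sumT h).2⟩,
    h, rfl, rfl⟩

theorem isArithmetic (X : LinOrd M) :
    IsArithmetic sets (gammaOrd X).toNOrder (addN X) (omulN X) where
  add_inner := isInnerFun₂_of_comp (gammaOrd X).isLinear.carrier_mem (by unfold addN; fun_prop)
    fun _ _ _ _ => LinOrd.El.mem _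
  mul_inner := isInnerFun₂_of_comp (gammaOrd X).isLinear.carrier_mem (by unfold omulN; fun_prop)
    fun _ _ _ _ => LinOrd.El.mem _
  zero_add t ht := by
    obtain ⟨t, rfl⟩ : ∃ u : GT X, t = u.val := ⟨⟨t, ht⟩, rfl⟩
    rw [← val_zero, addN_val, zero_add]
  add_zero s hs := by
    obtain ⟨s, rfl⟩ : ∃ u : GT X, s = u.val := ⟨⟨s, hs⟩, rfl⟩
    rw [← val_zero, addN_val, add_zero]
  principal_add_of_lt p hp t ht c hpp hc h := by
    obtain ⟨p, rfl⟩ : ∃ u : GT X, p = u.val := ⟨⟨p, hp⟩, rfl⟩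
    obtain ⟨t, rfl⟩ : ∃ u : GT X, t = u.val := ⟨⟨t, ht⟩, rfl⟩
    obtain ⟨-, rfl⟩ := isHead_val hc
    have hpp : Prin p := hpp
    rw [addN_val, hpp.add_eq, padd_of_lt h]
  principal_add_of_le p hp t ht c hpp hc h := by
    obtain ⟨p, rfl⟩ : ∃ u : GT X, p = u.val := ⟨⟨p, hp⟩, rfl⟩
    obtain ⟨t, rfl⟩ : ∃ u : GT X, t = u.val := ⟨⟨t, ht⟩, rfl⟩
    obtain ⟨ht0, rfl⟩ := isHead_val hc
    have hpp : Prin p := hpp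
    have hle : hd t ≤ p := h.imp LinOrd.El.ext id
    have hok : ConsOK p t := ⟨hpp, hle⟩
    rw [addN_val, hpp.add_eq, hok.padd_eq, cons_of_ne ht0, (hok.sumOK ht0).val]
  sum_add p q hpq t ht := by
    obtain ⟨t, rfl⟩ : ∃ u : GT X, t = u.val := ⟨⟨t, ht⟩, rfl⟩
    obtain ⟨p, q, h, rfl, rfl⟩ := exists_sumOK hpq
    rw [← h.val, addN_val, addN_val, addN_val, ← h.cons_eq, h.consOK.add_eq, h.consOK.1.add_eq]
  mul_zero e he := by
    obtain ⟨e, rfl⟩ : ∃ u : GT X, e = u.val := ⟨⟨e, he⟩, rfl⟩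
    rw [← val_zero, omulN_val, omul_zero]
  mul_omega e he c hc := by
    obtain ⟨e, rfl⟩ : ∃ u : GT X, e = u.val := ⟨⟨e, he⟩, rfl⟩
    obtain ⟨c, rfl⟩ : ∃ u : GT X, c = u.val := ⟨⟨c, hc⟩, rfl⟩
    rw [← val_om, omulN_val, omul_om, addN_val, val_om]
  mul_sum e he p q hpq := by
    obtain ⟨e, rfl⟩ : ∃ u : GT X, e = u.val := ⟨⟨e, he⟩, rfl⟩
    obtain ⟨p, q, h, rfl, rfl⟩ := exists_sumOK hpq
    rw [← h.val, omulN_val, omulN_val, omulN_val, addN_val, ← h.cons_eq, h.consOK.omul_eq,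
      h.consOK.1.omul_eq, (prin_om _).add_eq]

end GT

/-! ### The theorem for ordered semirings -/

theorem gammaOrd_isMinimal (X : LinOrd M) :
    IsMinimalBHFixedPoint sets (gammaTrans X.toNOrder) (gammaOrd X).toNOrder := by
  obtain ⟨θ, hθ, -⟩ := (GT.collapse X).exists_isCollapse
  refine ⟨⟨(gammaOrd X).isLinear, θ, hθ⟩, ?_⟩
  rintro Z ⟨hZ, θ', hθ'⟩
  obtain ⟨D⟩ := IsCollapse.nonempty_collapse (X := X) (Y := ⟨Z, hZ⟩) hθ'
  obtain ⟨f, hf, hmono⟩ := GT.exists_strictMono D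
  refine ⟨fun n => (f (GT.ofCode X n)).val, ⟨fun a _ => (f (GT.ofCode X a)).mem, ?_⟩, ?_⟩
  · have hc := (gammaOrd X).isLinear.comp_mem
    have : Comp M fun z : M × M =>
        z.1 ∈ (gammaOrd X).carrier ∧ z.2 = (f (GT.ofCode X z.1)).val := by fun_prop
    rw [comp_prop_iff] at this
    convert this using 1
    ext p
    simp only [Set.mem_ofPred_eq, Prod.exists, enc_prod, enc_id]
    constructor
    · rintro ⟨a, ha, rfl⟩
      exact ⟨a, _, rfl, ha, rfl⟩
    · rintro ⟨a, _, rfl, ha, rfl⟩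
      exact ⟨a, ha, rfl⟩
  · intro a ha b hb hab
    have h : (⟨a, ha⟩ : GT X) < ⟨b, hb⟩ := hab
    have ea : GT.ofCode X a = ⟨a, ha⟩ := GT.ofCode_val ⟨a, ha⟩
    have eb : GT.ofCode X b = ⟨b, hb⟩ := GT.ofCode_val ⟨b, hb⟩
    dsimp only
    rw [ea, eb]
    exact hmono h

theorem exists_explicitCollapse (X : LinOrd M) : ∃ θ : M → M,
    IsCollapse sets (gammaTrans X.toNOrder) (gammaOrd X).toNOrder θ ∧
    IsExplicitCollapse X.toNOrder (gammaOrd X).toNOrder (GT.addN X) (GT.omulN X) θ := by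
  obtain ⟨θ, hθ, h0, hlo, hhi, htop⟩ := (GT.collapse X).exists_isCollapse
  refine ⟨θ, hθ, ⟨h0, fun a ha b hb => ?_, fun a ha b hb => ?_, fun x hx => htop ⟨x, hx⟩⟩⟩
  · have := hlo ⟨a, ha⟩ ⟨b, hb⟩
    rw [this, ← GT.val_one (X := X)]
    have h1 : GT.addN X a (1 : GT X).val = ((⟨a, ha⟩ : GT X) + 1).val := GT.addN_val ⟨a, ha⟩ 1
    have h2 : GT.addN X b (1 : GT X).val = ((⟨b, hb⟩ : GT X) + 1).val := GT.addN_val ⟨b, hb⟩ 1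
    rw [h1, h2, ← GT.val_om, GT.omulN_val]
    rfl
  · have := hhi ⟨a, ha⟩ ⟨b, hb⟩
    rw [this, ← GT.val_one (X := X)]
    have h1 : GT.addN X (1 : GT X).val a = (1 + (⟨a, ha⟩ : GT X)).val := GT.addN_val 1 ⟨a, ha⟩
    have h2 : GT.addN X b (1 : GT X).val = ((⟨b, hb⟩ : GT X) + 1).val := GT.addN_val ⟨b, hb⟩ 1
    rw [h1, h2]
    exact (GT.phiOK_add_one _ _).val

theorem gamma_system_theorem (X : NOrder M) (hX : X.IsLinear (sets (M := M))) :
    ∃ G : NOrder M,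
      (IsGammaSystem sets X G ∧ ∀ G', IsGammaSystem sets X G' → G' = G) ∧
      IsMinimalBHFixedPoint sets (gammaTrans X) G ∧
      ∃ add mul θ, IsArithmetic sets G add mul ∧ IsCollapse sets (gammaTrans X) G θ ∧
        IsExplicitCollapse X G add mul θ := by
  obtain ⟨θ, h1, h2⟩ := exists_explicitCollapse ⟨X, hX⟩
  exact ⟨(gammaOrd ⟨X, hX⟩).toNOrder,
    ⟨gammaOrd_isGammaSystem ⟨X, hX⟩, fun G' hG' => (gammaOrd_isGammaSystem ⟨X, hX⟩).unique hG'⟩,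
    gammaOrd_isMinimal ⟨X, hX⟩, _, _, θ, GT.isArithmetic ⟨X, hX⟩, h1, h2⟩

end Main

end SecondOrder

theorem theorem3p4 {M : Type*} [Zero M] [One M] [Add M] [Mul M] [LT M] (S : Set (Set M))
    (hM : SecondOrder.IsModelRCA0 M S)
    (X : SecondOrder.NOrder M) (hX : X.IsLinear S) :
    ∃ G : SecondOrder.NOrder M,
      (SecondOrder.IsGammaSystem S X G ∧ ∀ G', SecondOrder.IsGammaSystem S X G' → G' = G) ∧
      SecondOrder.IsMinimalBHFixedPoint S (SecondOrder.gammaTrans X) G ∧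
      ∃ add mul θ, SecondOrder.IsArithmetic S G add mul ∧
        SecondOrder.IsCollapse S (SecondOrder.gammaTrans X) G θ ∧
        SecondOrder.IsExplicitCollapse X G add mul θ :=
  -- The semiring and the linear order obtained from `hM` have the given operations and the given
  -- relation `<` by definition, so the statement for ordered semirings is literally the required
  -- one.
  @SecondOrder.gamma_system_theorem M hM.toCommSemiring hM.toLinearOrder hM.isStrictOrderedRing
    (@SecondOrder.Model.mk M hM.toCommSemiring hM.toLinearOrder hM.isStrictOrderedRing S hM) X hX
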